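/- Let $n,m\ge 1$ be integers, $q>0$, $A\in\mathbb R^{n\times n}$, $B\in\mathbb R^{n\times 1}$ with $(A,B)$ controllable, $C_X\in\mathbb R^{1\times n}$, $\bar a_1,\dots,\bar a_m\in\mathbb R$. Let $A_z\in\mathbb R^{m\times m}$ be the companion matrix with ones on the superdiagonal, last row $(\bar a_1,\dots,\bar a_m)$ and zeros elsewhere, $B_z=[0,\dots,0,1]^T$, $C_z=[1,0,\dots,0]$. Consider the plant, for $x\in[0,1]$, $t\ge 0$, $$\dot X=AX+Bu_x(0,t),\quad u_t=qu_{xx},\quad u(0,t)=C_XX(t),\quad u(1,t)=C_zZ(t),\quad \dot Z=A_zZ+B_zU(t).$$ **The feedback law.** Let $K\in\mathbb R^{1\times n}$ be such that $A+BK$ is Hurwitz. Put $$D=\begin{pmatrix}0&A/q\\ I&-BC_X/q\end{pmatrix},\quad E=\begin{pmatrix}0&(A+BK)/q\\ I&0\end{pmatrix},$$ $$\Phi(x)=\big[C_X,\;K-\tfrac1qC_XBC_X\big]e^{Dx}\begin{pmatrix}I\\0\end{pmatrix},\quad \Gamma(x)=-[C_X,\;K]\,e^{Ex}\begin{pmatrix}I\\0\end{pmatrix},$$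 $\phi(x,y)=\frac1q\Phi(x-y)B$, $\psi(x,y)=\frac1q\Gamma(x-y)B$; these are the kernels for which $w=u-\int_0^x\phi(x,y)u(y,t)\,dy-\Phi(x)X$, with inverse $u=w-\int_0^x\psi(x,y)w(y,t)\,dy-\Gamma(x)X$, transforms the first three plant equations into $\dot X=(A+BK)X+Bw_x(0,t)$, $w_t=qw_{xx}$, $w(0,t)=0$. For a function $f$ on $[0,1]$ put $$S_kf(x)=\partial_x^kf(x)-\sum_{j=0}^{k-1}\partial_x^j\psi(x,y)\big|_{y=x}\,\partial_x^{k-1-j}f(x),$$ $$\mathcal Bf=\Big[\sum_{k=0}^{m-1}\bar a_{k+1}q^kS_{2k}f+q^m\sum_{i=1}^{2m}(-1)^i\partial_y^{i-1}\phi(1,1)\,S_{2m-i}f\Big]_{x=1},$$ $$\mathcal Cf=\Big[-q^m\sum_{i=1}^{2m}(-1)^i\partial_y^{i-1}\phi(1,0)\,S_{2m-i}f-\sum_{i=1}^{m}\Phi(1)A^{i-1}B\,q^{m-i}S_{2(m-i)+1}f\Big]_{x=0}.$$ For control parameters $c_1,\dots,c_m>0$ define polynomials in $s$ (where $s$ stands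 for $\partial_t$) by $\tau_0=0$, $y_0=0$, $y_i=s^{i-1}+\tau_{i-1}$, $\tau_i=s\tau_{i-1}+y_{i-1}+c_iy_i$ for $i\ge1$, and let $\alpha_i$, $\beta_i$ be the coefficients of $s^i$ in $y_{m-1}+s\tau_{m-1}$ and in $y_m$. Put $$\mathcal Lf=-\mathcal Bf-\sum_{i=0}^{m-1}q^i(\alpha_i+c_m\beta_i)\,\partial_x^{2i}f(1).$$ The state feedback is $$U(t)=\mathcal L[u(\cdot,t)]-\big(\mathcal L[\Phi]-\mathcal C[\Phi]\big)X(t)-\mathcal C[u(\cdot,t)]-\mathcal L\Big[\int_0^x\phi(x,y)u(y,t)\,dy\Big]+\mathcal C\Big[\int_0^x\phi(x,y)u(y,t)\,dy\Big].$$ **Solutions.** For an integer $k\ge2m$, $k\ge 2$, an $H^k$-solution of the closed loop is a triple $(u,X,Z)$ with $u\in C([0,\infty);H^k(0,1))$, $u_t=qu_{xx}$ for all $t\ge0$ with the time derivative taken in $L^2(0,1)$, and with the two boundary conditions and the two ordinary differential equations satisfied for all $t\ge0$. (In particular $u(\cdot,0)\in H^k(0,1)$, and the initial values satisfy the corresponding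 compatibility conditions.) $\|\cdot\|$ is the norm of $L^2(0,1)$. **Claim.** For every $K$ as above there are $c_1,\dots,c_m>0$ for which the following hold. (i) There is $\lambda_{2,3}>0$, and for all initial values $(u_0,X_0,Z_0)$ there is a constant $\Upsilon_{2,3}>0$ depending only on them (for the given system and parameters), such that every $H^{\max(2m,3)}$-solution with these initial values satisfies, for all $t\ge0$, $$\left(\|\partial_x^2u(\cdot,t)\|^2+\|\partial_x^3u(\cdot,t)\|^2\right)^{1/2}\le\Upsilon_{2,3}\,e^{-\lambda_{2,3}t}.$$ (ii) There is $\lambda_{2m}>0$, and for all initial values $(u_0,X_0,Z_0)$ there is a constant $\Upsilon_{2m}>0$ depending only on them, such that every $H^{2m}$-solution with these initial values satisfies, for all $t\ge0$, $$\sum_{i=2}^{2m}\|\partial_x^iu(\cdot,t)\|\le\Upsilon_{2m}\,e^{-\lambda_{2m}t}.$$ -/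

import Mathlib

open scoped Matrix Topology

noncomputable section

namespace SandwichedHeat

/-! ### Function spaces on the unit interval -/

/-- The `k`-th derivative of `f` on the closed interval `[0,1]` (one-sided at the end points). -/
def der (k : ℕ) (f : ℝ → ℝ) (x : ℝ) : ℝ :=
  iteratedDerivWithin k f (Set.Icc 0 1) x

/-- The norm of `L²(0,1)`. -/
def l2norm (f : ℝ → ℝ) : ℝ :=
  Real.sqrt (∫ x in (0 : ℝ)..1, f x ^ 2)

/-- `f ∈ H^k(0,1)`, for the continuous representative `f` of the class: the derivatives of order
less than `k` are absolutely continuous on `[0,1]`, and those of order at most `k` (the last one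
exists almost everywhere) are square integrable. -/
def MemH (k : ℕ) (f : ℝ → ℝ) : Prop :=
  (∀ i < k, AbsolutelyContinuousOnInterval (der i f) 0 1) ∧
    ∀ i ≤ k, MeasureTheory.MemLp (der i f) 2
      (MeasureTheory.volume.restrict (Set.Icc (0 : ℝ) 1))

/-- Continuity of `t ↦ v(·,t)` from `[0,∞)` to `H^k(0,1)`. -/
def ContinuousInH (k : ℕ) (v : ℝ → ℝ → ℝ) : Prop :=
  (∀ t, 0 ≤ t → MemH k (fun x => v x t)) ∧
    ∀ t, 0 ≤ t → ∀ i ≤ k,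
      Filter.Tendsto
        (fun s => l2norm (fun x => der i (fun ξ => v ξ s) x - der i (fun ξ => v ξ t) x))
        (𝓝[Set.Ici 0] t) (𝓝 0)

/-- `v_t(·,t) = g(·,t)` for all `t ≥ 0`, where the time derivative is the limit of the difference
quotients in `L²(0,1)` (one-sided at `t = 0`). -/
def HasL2TimeDeriv (v g : ℝ → ℝ → ℝ) : Prop :=
  ∀ t, 0 ≤ t →
    Filter.Tendsto (fun s => l2norm (fun x => (v x s - v x t) / (s - t) - g x t))
      (𝓝[Set.Ici 0 \ {t}] t) (𝓝 0)

/-! ### The plant -/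

/-- The data of the plant
`X' = A X + B u_x(0,t)`, `u_t = q u_xx`, `u(0,t) = C_X X`, `u(1,t) = C_z Z`,
`Z' = A_z Z + B_z U`, where `abar` is the last row of the companion matrix `A_z`
(its entries `abar 0, …, abar (m-1)` are `ā_1, …, ā_m`). -/
structure Plant (n m : ℕ) where
  A : Matrix (Fin n) (Fin n) ℝ
  B : Fin n → ℝ
  CX : Fin n → ℝ
  q : ℝ
  abar : Fin m → ℝ

variable {n m : ℕ}

/-- Controllability of a pair `(A, B)`: the vectors `B, AB, …, A^(n-1) B` span the state space. -/
def Controllable (A : Matrix (Fin n) (Fin n) ℝ) (B : Fin n → ℝ) : Prop :=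
  Submodule.span ℝ (Set.range fun k : Fin n => (A ^ (k : ℕ)) *ᵥ B) = ⊤

/-- All complex eigenvalues have negative real part. -/
def Hurwitz (M : Matrix (Fin n) (Fin n) ℝ) : Prop :=
  ∀ μ ∈ spectrum ℂ (M.map (algebraMap ℝ ℂ)), μ.re < 0

namespace Plant

variable (P : Plant n m)

/-- The companion matrix `A_z`. -/
def Az : Matrix (Fin m) (Fin m) ℝ :=
  Matrix.of fun i j =>
    if (i : ℕ) + 1 = m then P.abar j else if (j : ℕ) = (i : ℕ) + 1 then 1 else 0

/-- `B_z = [0, …, 0, 1]ᵀ`. -/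
def Bz (_ : Plant n m) : Fin m → ℝ := fun i => if (i : ℕ) + 1 = m then 1 else 0

/-- `C_z = [1, 0, …, 0]`. -/
def Cz (_ : Plant n m) : Fin m → ℝ := fun i => if (i : ℕ) = 0 then 1 else 0

/-- `A + B K`. -/
def AK (K : Fin n → ℝ) : Matrix (Fin n) (Fin n) ℝ := P.A + Matrix.vecMulVec P.B K

/-! ### Backstepping kernels

The direct transformation is `w = u - ∫_0^x φ(x,y) u(y) dy - Φ(x) X`, its inverse is
`u = w - ∫_0^x ψ(x,y) w(y) dy - Γ(x) X`. They exchange the plant with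
`X' = (A + B K) X + B w_x(0,t)`, `w_t = q w_xx`, `w(0,t) = 0`, that is,
* `Φ'' = (Φ A - Φ' B C_X) / q`, `Φ(0) = C_X`, `Φ'(0) = K - C_X B C_X / q`,
  `φ(x,y) = Φ(x-y) B / q`;
* `Γ'' = Γ (A + B K) / q`, `Γ(0) = -C_X`, `Γ'(0) = -K`, `ψ(x,y) = Γ(x-y) B / q`. -/

/-- The block matrix `D = [0, A/q; I, -B C_X/q]`. -/
def matD : Matrix (Fin n ⊕ Fin n) (Fin n ⊕ Fin n) ℝ :=
  Matrix.fromBlocks 0 (P.q⁻¹ • P.A) 1 (-(P.q⁻¹ • Matrix.vecMulVec P.B P.CX))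

/-- The block matrix `E = [0, (A + B K)/q; I, 0]`. -/
def matE (K : Fin n → ℝ) : Matrix (Fin n ⊕ Fin n) (Fin n ⊕ Fin n) ℝ :=
  Matrix.fromBlocks 0 (P.q⁻¹ • P.AK K) 1 0

/-- `Φ(x) = [C_X, K - C_X B C_X/q] e^{D x} [I; 0]`, a row vector. -/
def Phi (K : Fin n → ℝ) (x : ℝ) : Fin n → ℝ := fun j =>
  (Sum.elim P.CX (K - (P.q⁻¹ * (P.CX ⬝ᵥ P.B)) • P.CX) ᵥ* NormedSpace.exp (x • P.matD)) (Sum.inl j)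

/-- `φ(x,y) = Φ(x-y) B / q`. -/
def phi (K : Fin n → ℝ) (x y : ℝ) : ℝ := P.q⁻¹ * (P.Phi K (x - y) ⬝ᵥ P.B)

/-- `Γ(x) = -[C_X, K] e^{E x} [I; 0]`, a row vector. -/
def Gam (K : Fin n → ℝ) (x : ℝ) : Fin n → ℝ := fun j =>
  -(Sum.elim P.CX K ᵥ* NormedSpace.exp (x • P.matE K)) (Sum.inl j)

/-- `ψ(x,y) = Γ(x-y) B / q`. -/
def psi (K : Fin n → ℝ) (x y : ℝ) : ℝ := P.q⁻¹ * (P.Gam K (x - y) ⬝ᵥ P.B)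

/-- The coefficient `χ_{k,j}(x)` in
`∂_x^k ∫_0^x ψ(x,y) w(y) dy = ∫_0^x ∂_x^k ψ(x,y) w(y) dy + ∑_{j<k} χ_{k,j}(x) ∂_x^{k-1-j} w(x)`.
As `ψ(x,y)` depends on `x - y` only, it is `∂_x^j ψ(x,y)` at `y = x`, for every `k > j`. -/
def chi (K : Fin n → ℝ) (j : ℕ) (x : ℝ) : ℝ := iteratedDeriv j (fun ξ => P.psi K ξ x) x

/-- `∂_x^k f(x) - ∑_{j<k} χ_{k,j}(x) ∂_x^{k-j-1} f(x)`: the part of `∂_x^k u(x,t)` that is local in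
`w`, when `u` is expressed by `w` through the inverse transformation. -/
def localDer (K : Fin n → ℝ) (k : ℕ) (f : ℝ → ℝ) (x : ℝ) : ℝ :=
  der k f x - ∑ j ∈ Finset.range k, P.chi K j x * der (k - j - 1) f x

/-- The boundary operator `𝓑`, evaluated at `x = 1`. -/
def opB (K : Fin n → ℝ) (f : ℝ → ℝ) : ℝ :=
  (∑ k : Fin m, P.abar k * P.q ^ (k : ℕ) * P.localDer K (2 * (k : ℕ)) f 1) +
    P.q ^ m * ∑ i ∈ Finset.Icc 1 (2 * m),
      (-1) ^ i * iteratedDeriv (i - 1) (fun y => P.phi K 1 y) 1 * P.localDer K (2 * m - i) f 1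

/-- The boundary operator `𝓒`, evaluated at `x = 0`. -/
def opC (K : Fin n → ℝ) (f : ℝ → ℝ) : ℝ :=
  -(P.q ^ m * ∑ i ∈ Finset.Icc 1 (2 * m),
      (-1) ^ i * iteratedDeriv (i - 1) (fun y => P.phi K 1 y) 0 * P.localDer K (2 * m - i) f 0) -
    ∑ i ∈ Finset.Icc 1 m,
      (P.Phi K 1 ⬝ᵥ (P.A ^ (i - 1) *ᵥ P.B)) * P.q ^ (m - i) *
        P.localDer K (2 * (m - i) + 1) f 0

end Plant

/-! ### ODE backstepping at the boundary `x = 1`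

A polynomial `∑ p_i s^i` stands for the expression `∑ p_i ∂_t^i w(1,t)`, so that multiplication by
the variable is differentiation in time. -/

/-- The virtual controls: `τ_0 = 0`, `τ_1 = c_1 y_1`, `τ_i = τ̇_{i-1} + y_{i-1} + c_i y_i`, where
`y_i = ∂_t^{i-1} w(1,t) + τ_{i-1}`. -/
def tau (c : ℕ → ℝ) : ℕ → Polynomial ℝ
  | 0 => 0
  | 1 => Polynomial.C (c 1)
  | i + 2 => Polynomial.X * tau c (i + 1) + (Polynomial.X ^ i + tau c i) +
      Polynomial.C (c (i + 2)) * (Polynomial.X ^ (i + 1) + tau c (i + 1))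

/-- `y_i = ∂_t^{i-1} w(1,t) + τ_{i-1}` for `i ≥ 1`, and `y_0 = 0`. -/
def yPoly (c : ℕ → ℝ) : ℕ → Polynomial ℝ
  | 0 => 0
  | i + 1 => Polynomial.X ^ i + tau c i

/-- `α_i`: the coefficients of `y_{m-1} + τ̇_{m-1}`. -/
def alpha (c : ℕ → ℝ) (m i : ℕ) : ℝ :=
  (yPoly c (m - 1) + Polynomial.X * tau c (m - 1)).coeff i

/-- `β_i`: the coefficients of `y_m`. -/
def beta (c : ℕ → ℝ) (m i : ℕ) : ℝ := (yPoly c m).coeff i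

namespace Plant

variable (P : Plant n m)

/-- The boundary operator `𝓛 = -𝓑 - ∑_{i<m} q^i (α_i + c_m β_i) ∂_x^{2i}`, evaluated at `x = 1`. -/
def opL (K : Fin n → ℝ) (c : ℕ → ℝ) (f : ℝ → ℝ) : ℝ :=
  -P.opB K f -
    ∑ i ∈ Finset.range m, P.q ^ i * (alpha c m i + c m * beta c m i) * der (2 * i) f 1

/-- The state feedback law
`U = 𝓛u(1) - (𝓛Φ(1) - 𝓒Φ(0)) X - 𝓒u(0) - 𝓛 ∫ φ u (1) + 𝓒 ∫ φ u (0)`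
for the current profile `v = u(·,t)` and the current state `ξ = X(t)`. -/
def controlLaw (K : Fin n → ℝ) (c : ℕ → ℝ) (v : ℝ → ℝ) (ξ : Fin n → ℝ) : ℝ :=
  P.opL K c v -
    (P.opL K c (fun x => P.Phi K x ⬝ᵥ ξ) - P.opC K (fun x => P.Phi K x ⬝ᵥ ξ)) -
    P.opC K v -
    P.opL K c (fun x => ∫ y in (0 : ℝ)..x, P.phi K x y * v y) +
    P.opC K (fun x => ∫ y in (0 : ℝ)..x, P.phi K x y * v y)

/-- `(u, X, Z)` is a solution, on `0 ≤ t < ∞`, of the closed loop of the plant and the state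
feedback law, with `u ∈ C([0,∞); H^k(0,1))`. -/
structure IsClosedLoopSolution (K : Fin n → ℝ) (c : ℕ → ℝ) (k : ℕ)
    (u : ℝ → ℝ → ℝ) (X : ℝ → Fin n → ℝ) (Z : ℝ → Fin m → ℝ) : Prop where
  regular : ContinuousInH k u
  odeX : ∀ t, 0 ≤ t →
    HasDerivWithinAt X (P.A *ᵥ X t + der 1 (fun x => u x t) 0 • P.B) (Set.Ici 0) t
  heat : HasL2TimeDeriv u (fun x t => P.q * der 2 (fun ξ => u ξ t) x)
  left_bc : ∀ t, 0 ≤ t → u 0 t = P.CX ⬝ᵥ X t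
  right_bc : ∀ t, 0 ≤ t → u 1 t = P.Cz ⬝ᵥ Z t
  odeZ : ∀ t, 0 ≤ t →
    HasDerivWithinAt Z (P.Az *ᵥ Z t + P.controlLaw K c (fun x => u x t) (X t) • P.Bz)
      (Set.Ici 0) t

/-- The initial values of `(u, X, Z)` are `(u₀, X₀, Z₀)`. -/
def HasInitialValues (u : ℝ → ℝ → ℝ) (X : ℝ → Fin n → ℝ) (Z : ℝ → Fin m → ℝ)
    (u₀ : ℝ → ℝ) (X₀ : Fin n → ℝ) (Z₀ : Fin m → ℝ) : Prop :=
  (∀ x ∈ Set.Icc (0 : ℝ) 1, u x 0 = u₀ x) ∧ X 0 = X₀ ∧ Z 0 = Z₀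

end Plant

end SandwichedHeat

end

/-!
The backstepping transformation `w = u - ∫ φ u - Φ X` is read as an input-output map of a linear
system in the space variable: if `ξ(x)` solves `ξ' = D ξ + b u` with `ξ(0) = [X; 0]` and
`b = [B/q; 0]` (`Plant.stateSeq`), then `w = u - r ξ` with `r = [C_X, K - C_X B C_X / q]`
(`Plant.targetSeq`). A constant change of basis `h = T ξ` turns this system into `h' = E h + b w`,
`u = w + [C_X, K] h` (`Plant.auxSeq_succ`, `Plant.der_eq_targetSeq_add`). This is the inverse
transformation, and no integral equation for the kernels has to be solved. Unrolling the recursion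
for the derivatives of `h` shows that the local operators of the feedback law satisfy
`S_k w = ∂_x^k u - [C_X, K] E^k h` (`Plant.seqS_targetSeq`), and `p`, the second component of `h`,
satisfies `p_t = (A + B K) p + B w` in `L²(0,1)^n` (`Plant.auxRhs_eq`,
`Plant.IsClosedLoopSolution.hasDerivWithinAt_auxL2`).

In the target variables the closed loop is a cascade: the heat equation for `w` with `w(0,t) = 0`,
the equation for `p`, and an ordinary differential equation of order `m` for `w(1,t)`. In the last
one the feedback cancels all derivatives of `u`. What remains besides the damping is a linear
functional of `h(1)` and of `X` (`Plant.exists_linear_right`, `Plant.exists_linear_left`,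
`Plant.exists_boundary_ode`), and this functional is continuous in `(w, p)` for the norm of `L²`
(`Plant.exists_trace`): `p` has two derivatives in `x` that are expressed by `p` and `w`, and
`h(0) = [X; 0]`. If all `c_i` have the same value `c`, the variables `y_1, …, y_m` satisfy
`y' = -c y + J y + N(w, p) e` with `J` skew-symmetric and `e` the last unit vector
(`hasDerivWithinAt_evalSeq_yPoly`), and `w(1,t) = y_1`.

Such a cascade is exponentially stable if `c` is large (`TargetSystem.IsStabilizable.exists_gain`).
The boundary value of `w` is removed by a lift `y_1 l` with `l` of small norm, namely a monomial of
high degree (`heatGraph_lift`). The Lyapunov functional is the sum of `‖w - y_1 l‖²`, of a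
quadratic form in `p` that decreases because `A + B K` is Hurwitz (`stepForm_apply_le`,
`Hurwitz.exists_euler_matAct`), and of `‖y‖²` with a weight proportional to `c`. The derivative of
the lifted state contains `y_1' l`, hence a term of size `c ‖l‖ ‖y‖`; since the weighted `‖y‖²`
contributes a damping of order `c² ‖y‖²`, it suffices to fix `‖l‖` small and then `c` large
(`exists_gains`). Adding a small multiple of `q ‖∂_x (w - y_1 l)‖²` to the functional gives the
decay of `∂_x w`.

The system is linear and autonomous, so the same estimates hold for difference quotients in time and
hence for all time derivatives of `w` (`TargetSystem.IsStabilizable.exists_gain_deriv`,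
`TargetSystem.IsStabilizable.exists_gain_chain`). As `∂_t = q ∂_x²`, they bound the spatial
derivatives of `w` of order at most `2m`; those of odd order come from the estimate of `∂_x w`. The
third derivative, in the case `m = 1`, comes from the difference quotients of `∂_x w`
(`Plant.exists_decay`). The bounded inverse transformation carries the decay over to `u`
(`Plant.exists_l2norm_der_le`). The values of `y` at `t = 0` are boundary values of derivatives of
`w`, so that all constants are determined by `u_0` on `[0,1]` and `X_0`.
-/

noncomputable section

namespace SandwichedHeat

/-! ### Weights of the Lyapunov functional -/

/-- Young's inequality with the weights `s` and `t`. -/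
lemma mul_le_weighted_sq {s t : ℝ} (hs : 0 < s) (hst : 1 ≤ 4 * (s * t)) (x y : ℝ) :
    x * y ≤ s * x ^ 2 + t * y ^ 2 := by
  have h : 0 ≤ s * (s * x ^ 2 + t * y ^ 2 - x * y) := by
    nlinarith [sq_nonneg (s * x - y / 2), mul_nonneg (sub_nonneg.2 hst) (sq_nonneg y)]
  nlinarith [nonneg_of_mul_nonneg_right h hs]

set_option maxHeartbeats 1600000 in
/-- The choice of the weights: `a`, `b`, `d` stand for the norms of the lifted heat state, of the
auxiliary state and of the boundary state, `n` for the size of the coupling term, `ε` and `L` for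
the `L²` norms of the lift and of its image under the heat operator. The weight `δ * c` of the
boundary state grows with the gain `c`, and `ε` is fixed before `L` and `c`. -/
lemma exists_gains {lam κ β N : ℝ} (hl : 0 < lam) (hκ : 0 < κ) (hβ : 0 < β) (hN : 0 < N) :
    ∃ ρ > 0, ∃ δ > 0, ∃ ε > 0, ε ≤ 1 ∧ ∀ L : ℝ, 0 ≤ L → ∃ c : ℝ, 1 ≤ c ∧ ∃ μ > 0,
      ∀ a b d n : ℝ, 0 ≤ a → 0 ≤ b → 0 ≤ d → 0 ≤ n → n ≤ N * (a + ε * d + b) →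
        (-lam * a ^ 2 + a * (L * d + ε * ((c + 1) * d + n))) +
          ρ * (-κ * b ^ 2 + β * b * (a + ε * d)) + δ * c * (-c * d ^ 2 + d * n) ≤
        -μ * (a ^ 2 + b ^ 2 + d ^ 2) := by
  obtain ⟨ρ, hρ⟩ : ∃ ρ, ρ = lam * κ / (4 * β ^ 2) := ⟨_, rfl⟩
  have hρ0 : 0 < ρ := by rw [hρ]; positivity
  have hρ1 : ρ * β ^ 2 / κ = lam / 4 := by rw [hρ]; field_simp
  obtain ⟨K, hK⟩ : ∃ K, K = 1 / lam + 1 / (ρ * κ) := ⟨_, rfl⟩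
  have hK0 : 0 < K := by rw [hK]; positivity
  obtain ⟨δ, hδ⟩ : ∃ δ, δ = 1 / (8 * N ^ 2 * K) := ⟨_, rfl⟩
  have hδ0 : 0 < δ := by rw [hδ]; positivity
  have hδ1 : 2 * δ ^ 2 * N ^ 2 * K = δ / 4 := by rw [hδ]; field_simp; norm_num
  obtain ⟨ε, hε⟩ : ∃ ε, ε = min (min 1 (lam / (8 * N))) (min (lam * ρ * κ / (16 * N ^ 2))
    (δ * lam / 64)) := ⟨_, rfl⟩
  have hε0 : 0 < ε := by rw [hε]; positivity
  have hε1 : ε ≤ 1 := by rw [hε]; exact (min_le_left _ _).trans (min_le_left _ _)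
  have hε2 : ε * N ≤ lam / 8 := by
    have : ε ≤ lam / (8 * N) := by rw [hε]; exact (min_le_left _ _).trans (min_le_right _ _)
    rw [le_div_iff₀ (by positivity)] at this; linarith
  have hεε : ε ^ 2 ≤ ε := by nlinarith
  have hε3 : 16 * (ε ^ 2 * N ^ 2) ≤ lam * ρ * κ := by
    have : ε ≤ lam * ρ * κ / (16 * N ^ 2) := by
      rw [hε]; exact (min_le_right _ _).trans (min_le_left _ _)
    rw [le_div_iff₀ (by positivity)] at this
    nlinarith [mul_le_mul_of_nonneg_right hεε (sq_nonneg N)]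
  have hε4 : 64 * ε ^ 2 ≤ δ * lam := by
    have : ε ≤ δ * lam / 64 := by
      rw [hε]; exact (min_le_right _ _).trans (min_le_right _ _)
    linarith
  refine ⟨ρ, hρ0, δ, hδ0, ε, hε0, hε1, fun L hL => ?_⟩
  obtain ⟨R, hR⟩ : ∃ R, R = 2 * ρ * β ^ 2 / κ + 4 / lam * (L + N) ^ 2 + 1 := ⟨_, rfl⟩
  have hR0 : 0 < R := by rw [hR]; positivity
  obtain ⟨c, hc⟩ : ∃ c, c = 1 + 4 * N + 4 * R / δ := ⟨_, rfl⟩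
  have hc1 : 1 ≤ c := by rw [hc]; have : 0 < 4 * R / δ := by positivity
                         linarith
  have hcN : 4 * N ≤ c := by rw [hc]; have : 0 < 4 * R / δ := by positivity
                             linarith
  have hcR : 4 * R ≤ δ * c := by
    have : 4 * R / δ ≤ c := by rw [hc]; linarith
    rw [div_le_iff₀ hδ0] at this; linarith
  refine ⟨c, hc1, min (min (lam / 4) (3 / 8 * (ρ * κ))) 1, by positivity, ?_⟩
  intro a b d n ha hb hd hn hnle
  have hn' : n ≤ N * (a + d + b) := hnle.trans (by
    have : ε * d ≤ d := mul_le_of_le_one_left hd hε1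
    gcongr)
  have hc0 : 0 < c := by linarith
  -- the coupling term is replaced by its bound
  have e1 : a * (L * d + ε * ((c + 1) * d + n)) ≤
      a * d * (L + N + 2 * c * ε) + ε * N * a ^ 2 + ε * N * (a * b) := by
    have h1 : a * (ε * n) ≤ a * (ε * (N * (a + d + b))) := by gcongr
    have h2 : a * ε * ((c + 1) * d) ≤ a * ε * (2 * c * d) := by gcongr; linarith
    have h3 : ε * (N * (a * d)) ≤ N * (a * d) := mul_le_of_le_one_left (by positivity) hε1
    nlinarith
  have e2 : β * b * (a + ε * d) ≤ β * b * a + β * b * d := by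
    have : β * b * (ε * d) ≤ β * b * d := by
      gcongr; exact mul_le_of_le_one_left hd hε1
    linarith
  have e3 : d * n ≤ N * (a * d) + N * d ^ 2 + N * (b * d) := by
    have : d * n ≤ d * (N * (a + d + b)) := by gcongr
    linarith
  -- weighted inequalities of arithmetic and geometric means
  have y1 := mul_le_weighted_sq (s := lam / 8) (t := 2 / lam) (by positivity)
    (by field_simp; norm_num) a (d * (L + N + 2 * c * ε))
  have y2 : ρ * (β * b * a) ≤ ρ * κ / 4 * b ^ 2 + lam / 4 * a ^ 2 := by
    have := mul_le_weighted_sq (s := ρ * κ / 4) (t := 1 / (ρ * κ)) (by positivity)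
      (by field_simp; norm_num) b (ρ * β * a)
    have h : 1 / (ρ * κ) * (ρ * β * a) ^ 2 = ρ * β ^ 2 / κ * a ^ 2 := by field_simp
    rw [h, hρ1] at this; linarith
  have y3 : ε * N * (a * b) ≤ lam / 8 * a ^ 2 + ρ * κ / 8 * b ^ 2 := by
    have := mul_le_weighted_sq (s := lam / 8) (t := 2 / lam) (by positivity)
      (by field_simp; norm_num) a (ε * N * b)
    have h : 2 / lam * (ε * N * b) ^ 2 ≤ ρ * κ / 8 * b ^ 2 := by
      have h' : 2 / lam * (ε * N * b) ^ 2 = (16 * (ε ^ 2 * N ^ 2)) * b ^ 2 / (8 * lam) := by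
        field_simp; ring
      have h'' : ρ * κ / 8 * b ^ 2 = (lam * ρ * κ) * b ^ 2 / (8 * lam) := by field_simp
      rw [h', h'']; gcongr
    linarith
  have y4 : ρ * (β * b * d) ≤ ρ * κ / 8 * b ^ 2 + 2 * ρ * β ^ 2 / κ * d ^ 2 := by
    have := mul_le_weighted_sq (s := ρ * κ / 8) (t := 2 / (ρ * κ)) (by positivity)
      (by field_simp; norm_num) b (ρ * β * d)
    have h : 2 / (ρ * κ) * (ρ * β * d) ^ 2 = 2 * ρ * β ^ 2 / κ * d ^ 2 := by field_simp
    rw [h] at this; linarith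
  have y5 := mul_le_weighted_sq (s := lam / 8) (t := 2 / lam) (by positivity)
    (by field_simp; norm_num) a (δ * c * N * d)
  have y6 := mul_le_weighted_sq (s := ρ * κ / 8) (t := 2 / (ρ * κ)) (by positivity)
    (by field_simp; norm_num) b (δ * c * N * d)
  have y56 : 2 / lam * (δ * c * N * d) ^ 2 + 2 / (ρ * κ) * (δ * c * N * d) ^ 2 =
      δ / 4 * (c ^ 2 * d ^ 2) := by
    rw [← hδ1, hK]; ring
  have y7 : 2 / lam * (d * (L + N + 2 * c * ε)) ^ 2 ≤
      (4 / lam * (L + N) ^ 2 + δ / 4 * c ^ 2) * d ^ 2 := by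
    have h1 : (L + N + 2 * c * ε) ^ 2 ≤ 2 * (L + N) ^ 2 + 8 * c ^ 2 * ε ^ 2 := by
      nlinarith [sq_nonneg (L + N - 2 * c * ε)]
    have h2 : 2 / lam * (8 * c ^ 2 * ε ^ 2) ≤ δ / 4 * c ^ 2 := by
      have : 2 / lam * (8 * c ^ 2 * ε ^ 2) = (64 * ε ^ 2) * c ^ 2 / (4 * lam) := by
        field_simp; norm_num
      have h'' : δ / 4 * c ^ 2 = (δ * lam) * c ^ 2 / (4 * lam) := by field_simp
      rw [this, h'']; gcongr
    have h3 : 2 / lam * (L + N + 2 * c * ε) ^ 2 ≤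
        2 / lam * (2 * (L + N) ^ 2 + 8 * c ^ 2 * ε ^ 2) := by gcongr
    have h4 : 2 / lam * (L + N + 2 * c * ε) ^ 2 ≤ 4 / lam * (L + N) ^ 2 + δ / 4 * c ^ 2 := by
      have : 2 / lam * (2 * (L + N) ^ 2) = 4 / lam * (L + N) ^ 2 := by ring
      linarith
    calc _ = (2 / lam * (L + N + 2 * c * ε) ^ 2) * d ^ 2 := by ring
      _ ≤ _ := by gcongr
  have z1 : δ * c * (N * d ^ 2) ≤ δ / 4 * (c ^ 2 * d ^ 2) := by
    have : δ * c * d ^ 2 * (4 * N) ≤ δ * c * d ^ 2 * c := by gcongr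
    linarith
  have z2 : R * d ^ 2 ≤ δ / 4 * (c ^ 2 * d ^ 2) := by
    have h1 : 4 * R * d ^ 2 ≤ δ * c * d ^ 2 := by gcongr
    have h2 : δ * c * d ^ 2 * 1 ≤ δ * c * d ^ 2 * c := by gcongr
    linarith
  have z3 : R * d ^ 2 = (2 * ρ * β ^ 2 / κ + 4 / lam * (L + N) ^ 2) * d ^ 2 + d ^ 2 := by
    rw [hR]; ring
  have f1 : ε * N * a ^ 2 ≤ lam / 8 * a ^ 2 := by gcongr
  have g2 : ρ * (-κ * b ^ 2 + β * b * (a + ε * d)) ≤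
      -(ρ * κ) * b ^ 2 + ρ * (β * b * a) + ρ * (β * b * d) := by
    have := mul_le_mul_of_nonneg_left e2 hρ0.le
    linarith
  have g3 : δ * c * (-c * d ^ 2 + d * n) ≤ -(δ * (c ^ 2 * d ^ 2)) + a * (δ * c * N * d) +
      δ * c * (N * d ^ 2) + b * (δ * c * N * d) := by
    have := mul_le_mul_of_nonneg_left e3 (mul_pos hδ0 hc0).le
    linarith
  have m1 : min (min (lam / 4) (3 / 8 * (ρ * κ))) 1 * a ^ 2 ≤ lam / 4 * a ^ 2 := by
    gcongr; exact (min_le_left _ _).trans (min_le_left _ _)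
  have m2 : min (min (lam / 4) (3 / 8 * (ρ * κ))) 1 * b ^ 2 ≤ 3 / 8 * (ρ * κ) * b ^ 2 := by
    gcongr; exact (min_le_left _ _).trans (min_le_right _ _)
  have m3 : min (min (lam / 4) (3 / 8 * (ρ * κ))) 1 * d ^ 2 ≤ 1 * d ^ 2 := by
    gcongr; exact min_le_right _ _
  linarith only [e1, y1, y2, y3, y4, y5, y6, y56, y7, z1, z2, z3, f1, g2, g3, m1, m2, m3]

/-- Exponential decay from a differential inequality on `[0,∞)`. -/
lemma le_exp_of_deriv_le {V V' : ℝ → ℝ} {κ : ℝ}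
    (hV : ∀ t, 0 ≤ t → HasDerivWithinAt V (V' t) (Set.Ici 0) t)
    (hle : ∀ t, 0 ≤ t → V' t ≤ -κ * V t) {t : ℝ} (ht : 0 ≤ t) :
    V t ≤ V 0 * Real.exp (-κ * t) := by
  have hd : ∀ s, 0 ≤ s → HasDerivWithinAt (fun s => Real.exp (κ * s) * V s)
      (Real.exp (κ * s) * (κ * V s + V' s)) (Set.Ici 0) s := fun s hs => by
    have h1 : HasDerivWithinAt (fun s => Real.exp (κ * s)) (Real.exp (κ * s) * κ) (Set.Ici 0) s :=
      (((hasDerivAt_id s).const_mul κ).exp.congr_deriv (by simp)).hasDerivWithinAt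
    exact (h1.mul (hV s hs)).congr_deriv (by ring)
  have hanti : AntitoneOn (fun s => Real.exp (κ * s) * V s) (Set.Ici 0) := by
    refine antitoneOn_of_hasDerivWithinAt_nonpos (convex_Ici 0)
      (fun s hs => (hd s hs).continuousWithinAt) (f' := fun s =>
        Real.exp (κ * s) * (κ * V s + V' s)) ?_ ?_
    · intro s hs
      exact (hd s (interior_subset hs)).mono interior_subset
    · intro s hs
      have := hle s (interior_subset hs)
      exact mul_nonpos_of_nonneg_of_nonpos (Real.exp_pos _).le (by linarith)
  have h := hanti (Set.self_mem_Ici) (Set.mem_Ici.2 ht) ht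
  simp only [mul_zero, Real.exp_zero, one_mul] at h
  have h2 := mul_le_mul_of_nonneg_right h (Real.exp_pos (-κ * t)).le
  calc V t = Real.exp (κ * t) * V t * Real.exp (-κ * t) := by
        rw [mul_right_comm, ← Real.exp_add]; simp
    _ ≤ _ := h2

end SandwichedHeat

namespace SandwichedHeat

section Target
open scoped RealInnerProductSpace

variable {H Hp Y : Type*} [NormedAddCommGroup H] [InnerProductSpace ℝ H]
  [NormedAddCommGroup Hp] [InnerProductSpace ℝ Hp] [NormedAddCommGroup Y] [InnerProductSpace ℝ Y]

/-! ### A quadratic form that decreases along `p' = M p` -/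

/-- `k` explicit Euler steps of size `r` for `p' = M p`. -/
def eulerStep (M : Hp →L[ℝ] Hp) (r : ℝ) (k : ℕ) : Hp →L[ℝ] Hp := (1 + r • M) ^ k

lemma eulerStep_succ (M : Hp →L[ℝ] Hp) (r : ℝ) (k : ℕ) (u : Hp) :
    eulerStep M r (k + 1) u = eulerStep M r k u + r • eulerStep M r k (M u) := by
  have h : eulerStep M r (k + 1) u = eulerStep M r k (u + r • M u) := by
    rw [eulerStep, pow_succ]; rfl
  rw [h, map_add, map_smul]

/-- The bilinear form `∑_{k<n} ⟪S^k u, S^k v⟫` with `S = 1 + r M`. -/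
def stepForm (M : Hp →L[ℝ] Hp) (r : ℝ) (n : ℕ) (u v : Hp) : ℝ :=
  ∑ k ∈ Finset.range n, ⟪eulerStep M r k u, eulerStep M r k v⟫

lemma stepForm_add_right (M : Hp →L[ℝ] Hp) (r : ℝ) (n : ℕ) (u v w : Hp) :
    stepForm M r n u (v + w) = stepForm M r n u v + stepForm M r n u w := by
  simp [stepForm, inner_add_right, Finset.sum_add_distrib]

lemma exists_stepForm_le (M : Hp →L[ℝ] Hp) (r : ℝ) (n : ℕ) :
    ∃ C > 0, ∀ u v, stepForm M r n u v ≤ C * (‖u‖ * ‖v‖) := by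
  refine ⟨(∑ k ∈ Finset.range n, ‖eulerStep M r k‖ ^ 2) + 1, by positivity, fun u v => ?_⟩
  have h : stepForm M r n u v ≤ (∑ k ∈ Finset.range n, ‖eulerStep M r k‖ ^ 2) * (‖u‖ * ‖v‖) := by
    rw [stepForm, Finset.sum_mul]
    refine Finset.sum_le_sum fun k _ => (real_inner_le_norm _ _).trans ?_
    calc _ ≤ (‖eulerStep M r k‖ * ‖u‖) * (‖eulerStep M r k‖ * ‖v‖) := by
          gcongr <;> exact ContinuousLinearMap.le_opNorm _ _
      _ = _ := by ring
  have : 0 ≤ ‖u‖ * ‖v‖ := by positivity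
  linarith

lemma sq_norm_le_stepForm (M : Hp →L[ℝ] Hp) (r : ℝ) {n : ℕ} (hn : 0 < n) (u : Hp) :
    ‖u‖ ^ 2 ≤ stepForm M r n u u := by
  have h := Finset.single_le_sum (f := fun k => ⟪eulerStep M r k u, eulerStep M r k u⟫)
    (fun k _ => real_inner_self_nonneg) (Finset.mem_range.2 hn)
  simpa [stepForm, eulerStep] using h

/-- One explicit Euler step decreases the form, and convexity of the squared norm turns this into
a statement on the derivative. -/
lemma stepForm_apply_le {M : Hp →L[ℝ] Hp} {r : ℝ} (hr : 0 < r) {n : ℕ}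
    (hS : ‖(1 + r • M) ^ n‖ ≤ 1 / 2) (u : Hp) :
    stepForm M r n u (M u) ≤ -(3 / (8 * r)) * ‖u‖ ^ 2 := by
  have h1 : ∀ k, 2 * r * ⟪eulerStep M r k u, eulerStep M r k (M u)⟫ ≤
      ‖eulerStep M r (k + 1) u‖ ^ 2 - ‖eulerStep M r k u‖ ^ 2 := fun k => by
    rw [eulerStep_succ, norm_add_sq_real, inner_smul_right]
    nlinarith [sq_nonneg ‖r • eulerStep M r k (M u)‖]
  have h3 : 2 * r * stepForm M r n u (M u) ≤ ‖eulerStep M r n u‖ ^ 2 - ‖u‖ ^ 2 := by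
    rw [stepForm, Finset.mul_sum]
    refine (Finset.sum_le_sum fun k _ => h1 k).trans ?_
    rw [Finset.sum_range_sub (fun k => ‖eulerStep M r k u‖ ^ 2)]
    simp [eulerStep]
  have h4 : ‖eulerStep M r n u‖ ≤ 1 / 2 * ‖u‖ :=
    (ContinuousLinearMap.le_opNorm _ _).trans (mul_le_mul_of_nonneg_right hS (norm_nonneg u))
  have h5 : ‖eulerStep M r n u‖ ^ 2 ≤ (1 / 2 * ‖u‖) ^ 2 := by gcongr
  have h6 : 2 * r * stepForm M r n u (M u) ≤ 2 * r * (-(3 / (8 * r)) * ‖u‖ ^ 2) := by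
    have : 2 * r * (-(3 / (8 * r)) * ‖u‖ ^ 2) = -(3 / 4) * ‖u‖ ^ 2 := by field_simp; ring
    rw [this]; linarith
  exact le_of_mul_le_mul_left h6 (by positivity)

lemma hasDerivWithinAt_stepForm (M : Hp →L[ℝ] Hp) (r : ℝ) (n : ℕ) {p : ℝ → Hp} {p' : Hp}
    {s : Set ℝ} {t : ℝ} (hp : HasDerivWithinAt p p' s t) :
    HasDerivWithinAt (fun t => stepForm M r n (p t) (p t)) (2 * stepForm M r n (p t) p') s t := by
  unfold stepForm
  have : 2 * ∑ k ∈ Finset.range n, ⟪eulerStep M r k (p t), eulerStep M r k p'⟫ =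
      ∑ k ∈ Finset.range n, (⟪eulerStep M r k (p t), eulerStep M r k p'⟫ +
        ⟪eulerStep M r k p', eulerStep M r k (p t)⟫) := by
    rw [Finset.mul_sum]
    refine Finset.sum_congr rfl fun k _ => ?_
    rw [real_inner_comm (eulerStep M r k p')]; ring
  rw [this]
  refine HasDerivWithinAt.fun_sum fun k _ => ?_
  have h := (eulerStep M r k).hasFDerivAt.comp_hasDerivWithinAt t hp
  exact h.inner ℝ h

/-- If `⟪h s, A t⟫` is symmetric in `s` and `t`, then `⟪h, A⟫` has derivative `2 ⟪h', A⟫`, even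
though `A` is only continuous. -/
lemma hasDerivWithinAt_inner_of_symm {h A : ℝ → H} {h' : H} {s : Set ℝ} {t : ℝ} (ht : t ∈ s)
    (hh : HasDerivWithinAt h h' s t) (hA : ContinuousWithinAt A s t)
    (hsymm : ∀ a ∈ s, ∀ b ∈ s, ⟪h a, A b⟫ = ⟪h b, A a⟫) :
    HasDerivWithinAt (fun t => ⟪h t, A t⟫) (2 * ⟪h', A t⟫) s t := by
  rw [hasDerivWithinAt_iff_tendsto_slope] at hh ⊢
  have hA' : Filter.Tendsto A (𝓝[s \ {t}] t) (𝓝 (A t)) :=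
    hA.tendsto.mono_left (nhdsWithin_mono _ Set.sdiff_subset)
  have h1 := hh.inner (𝕜 := ℝ) (hA'.add_const (A t))
  have h2 : ⟪h', A t + A t⟫ = 2 * ⟪h', A t⟫ := by rw [inner_add_right]; ring
  rw [h2] at h1
  refine h1.congr' ?_
  filter_upwards [self_mem_nhdsWithin] with a ha
  rw [slope_def_module, slope_def_module, real_inner_smul_left, smul_eq_mul]
  congr 1
  rw [inner_sub_left, inner_add_right, inner_add_right, hsymm t ht a ha.1]
  ring

/-! ### Abstract target systems -/

variable (H Hp Y) in
/-- The constant data of an abstract cascade `W' = 𝒜 W`, `p' = M p + Bp W`,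
`y' = A_c y + N(W, p) e`, in which the boundary value of `W` is the first coordinate of `y`.
The heat operator with an inhomogeneous boundary value is encoded by its graph: `(f, f', 𝒜 f, g)`
belongs to `graph` if `f` has the derivative `f'`, the image `𝒜 f` and the boundary value `g`. -/
structure TargetSystem where
  graph : Submodule ℝ (H × H × H × ℝ)
  M : Hp →L[ℝ] Hp
  Bp : H →L[ℝ] Hp
  N : H × Hp →L[ℝ] ℝ
  e : Y
  first : Y →L[ℝ] ℝ

/-- Solutions on `[0,∞)` of a target system with boundary dynamics `Ay`; `W1` is the spatial and
`W'` the time derivative of `W`. -/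
structure TargetSystem.IsSolution (S : TargetSystem H Hp Y) (Ay : Y →L[ℝ] Y) (W W1 W' : ℝ → H)
    (p : ℝ → Hp) (y : ℝ → Y) : Prop where
  mem : ∀ t, 0 ≤ t → (W t, W1 t, W' t, S.first (y t)) ∈ S.graph
  cont : ContinuousOn W' (Set.Ici 0)
  derivW : ∀ t, 0 ≤ t → HasDerivWithinAt W (W' t) (Set.Ici 0) t
  derivp : ∀ t, 0 ≤ t → HasDerivWithinAt p (S.M (p t) + S.Bp (W t)) (Set.Ici 0) t
  derivy : ∀ t, 0 ≤ t → HasDerivWithinAt y (Ay (y t) + S.N (W t, p t) • S.e) (Set.Ici 0) t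

/-- The structural properties that make a target system stable for a large gain `c`: the heat
operator is symmetric and negative on functions with zero boundary value, boundary values have
lifts of small norm, an Euler step for `M` is eventually contractive, and `A c` damps the boundary
state with rate `c`. -/
structure TargetSystem.IsStabilizable (S : TargetSystem H Hp Y) (q : ℝ) (A : ℝ → Y →L[ℝ] Y) :
    Prop where
  q_pos : 0 < q
  green : ∀ h h1 h2 k k1 k2 : H, (h, h1, h2, (0 : ℝ)) ∈ S.graph → (k, k1, k2, (0 : ℝ)) ∈ S.graph →
    ⟪h, k2⟫ = -q * ⟪h1, k1⟫
  poincare : ∀ h h1 h2 : H, (h, h1, h2, (0 : ℝ)) ∈ S.graph → ‖h‖ ≤ ‖h1‖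
  lift : ∀ ε : ℝ, 0 < ε → ∃ l l1 l2 : H, (l, l1, l2, (1 : ℝ)) ∈ S.graph ∧ ‖l‖ ≤ ε
  euler : ∃ r : ℝ, 0 < r ∧ ∃ n : ℕ, 0 < n ∧ ‖(1 + r • S.M) ^ n‖ ≤ 1 / 2
  damping : ∀ c y, ⟪y, A c y⟫ = -c * ‖y‖ ^ 2
  damping_first : ∀ c y, |S.first (A c y) + c * S.first y| ≤ ‖y‖
  first_le : ∀ y, |S.first y| ≤ ‖y‖
  norm_e_le : ‖S.e‖ ≤ 1

namespace TargetSystem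

variable {S : TargetSystem H Hp Y} {A : ℝ → Y →L[ℝ] Y} {q : ℝ}

lemma hasDerivWithinAt_smul_shift_sub {E : Type*} [NormedAddCommGroup E] [NormedSpace ℝ E]
    (a : ℝ) {d : ℝ} (hd : 0 ≤ d) {f f' : ℝ → E}
    (hf : ∀ t, 0 ≤ t → HasDerivWithinAt f (f' t) (Set.Ici 0) t) (t : ℝ) (ht : 0 ≤ t) :
    HasDerivWithinAt (fun t => a • (f (t + d) - f t)) (a • (f' (t + d) - f' t))
      (Set.Ici 0) t := by
  have hmaps : Set.MapsTo (fun t : ℝ => t + d) (Set.Ici 0) (Set.Ici 0) := fun t ht => by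
    simp only [Set.mem_Ici] at ht ⊢; linarith
  have h1 := (hf (t + d) (by linarith)).scomp t
    ((hasDerivAt_id t).add_const d).hasDerivWithinAt hmaps
  rw [one_smul] at h1
  exact (h1.sub (hf t ht)).const_smul a

/-- The target system is linear and autonomous. -/
lemma IsSolution.smul_shift_sub {Ay : Y →L[ℝ] Y} {W W1 W' : ℝ → H} {p : ℝ → Hp} {y : ℝ → Y}
    (h : S.IsSolution Ay W W1 W' p y) (a : ℝ) {d : ℝ} (hd : 0 ≤ d) :
    S.IsSolution Ay (fun t => a • (W (t + d) - W t)) (fun t => a • (W1 (t + d) - W1 t))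
      (fun t => a • (W' (t + d) - W' t)) (fun t => a • (p (t + d) - p t))
      (fun t => a • (y (t + d) - y t)) := by
  have hmaps : Set.MapsTo (fun t : ℝ => t + d) (Set.Ici 0) (Set.Ici 0) := fun t ht => by
    simp only [Set.mem_Ici] at ht ⊢; linarith
  refine ⟨fun t ht => ?_, ?_, hasDerivWithinAt_smul_shift_sub a hd h.derivW,
    fun t ht => ?_, fun t ht => ?_⟩
  · have := S.graph.smul_mem a (S.graph.sub_mem (h.mem (t + d) (by linarith)) (h.mem t ht))
    simpa using this
  · exact ((h.cont.comp (by fun_prop) hmaps).sub h.cont).const_smul a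
  · refine (hasDerivWithinAt_smul_shift_sub a hd h.derivp t ht).congr_deriv ?_
    simp only [map_sub, map_smul, smul_add, smul_sub]
    abel
  · refine (hasDerivWithinAt_smul_shift_sub a hd h.derivy t ht).congr_deriv ?_
    have : (a • (W (t + d) - W t), a • (p (t + d) - p t)) =
        a • ((W (t + d), p (t + d)) - (W t, p t)) := rfl
    rw [this]
    simp only [map_sub, map_smul, smul_add, smul_sub, sub_smul, smul_eq_mul, mul_smul]
    abel

set_option maxHeartbeats 2000000 in
/-- Exponential stability of the target system for a large gain. The second estimate includes the
spatial derivative. -/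
theorem IsStabilizable.exists_gain (hS : S.IsStabilizable q A) :
    ∃ c > 0, ∃ κ > 0, ∃ C > 0, ∀ (W W1 W' : ℝ → H) (p : ℝ → Hp) (y : ℝ → Y),
      S.IsSolution (A c) W W1 W' p y → ∀ t, 0 ≤ t →
      ‖W t‖ ^ 2 + ‖p t‖ ^ 2 + ‖y t‖ ^ 2 ≤
        C * (‖W 0‖ ^ 2 + ‖p 0‖ ^ 2 + ‖y 0‖ ^ 2) * Real.exp (-κ * t) ∧
      ‖W t‖ ^ 2 + ‖W1 t‖ ^ 2 + ‖p t‖ ^ 2 + ‖y t‖ ^ 2 ≤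
        C * (‖W 0‖ ^ 2 + ‖W1 0‖ ^ 2 + ‖p 0‖ ^ 2 + ‖y 0‖ ^ 2) * Real.exp (-κ * t) := by
  have hq := hS.q_pos
  obtain ⟨r, hr, n, hn, hSn⟩ := hS.euler
  obtain ⟨Cf, hCf, hform⟩ := exists_stepForm_le S.M r n
  obtain ⟨β, hβdef⟩ : ∃ β, β = Cf * (‖S.Bp‖ + 1) := ⟨_, rfl⟩
  have hβ : 0 < β := by rw [hβdef]; positivity
  have hκ : 0 < 3 / (8 * r) := by positivity
  obtain ⟨N, hNdef⟩ : ∃ N, N = ‖S.N‖ + 1 := ⟨_, rfl⟩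
  have hN : 0 < N := by rw [hNdef]; positivity
  obtain ⟨ρ, hρ, δ, hδ, ε, hε, hε1, hL⟩ := exists_gains hq hκ hβ hN
  obtain ⟨l, l1, l2, hl, hlε⟩ := hS.lift ε hε
  obtain ⟨c, hc1, μ, hμ, hgain⟩ := hL ‖l2‖ (norm_nonneg _)
  have hc : 0 < c := by linarith
  -- constants of the equivalence of the Lyapunov functional and the squared norms
  obtain ⟨C2, hC2⟩ : ∃ C2, C2 = 1 / 2 + ρ / 2 * Cf + δ * c / 2 := ⟨_, rfl⟩
  have hC2p : 0 < C2 := by rw [hC2]; positivity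
  obtain ⟨c0, hc0⟩ : ∃ c0, c0 = min (min (1 / 2) (ρ / 2)) (δ * c / 2) := ⟨_, rfl⟩
  have hc0p : 0 < c0 := by rw [hc0]; positivity
  obtain ⟨R, hR⟩ : ∃ R, R = ‖l2‖ + c + 1 + N := ⟨_, rfl⟩
  have hRp : 0 < R := by rw [hR]; positivity
  obtain ⟨σ, hσ⟩ : ∃ σ, σ = μ / (6 * R ^ 2) := ⟨_, rfl⟩
  have hσp : 0 < σ := by rw [hσ]; positivity
  obtain ⟨κ, hκd⟩ : ∃ κ, κ = min (μ / (2 * C2)) q := ⟨_, rfl⟩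
  have hκp : 0 < κ := by rw [hκd]; positivity
  have hκ1 : κ * C2 ≤ μ / 2 := by
    have : κ ≤ μ / (2 * C2) := by rw [hκd]; exact min_le_left _ _
    rw [le_div_iff₀ (by positivity)] at this; linarith
  have hκ2 : κ ≤ q := by rw [hκd]; exact min_le_right _ _
  obtain ⟨C3, hC3⟩ : ∃ C3, C3 = C2 + σ * q := ⟨_, rfl⟩
  have hC3p : 0 < C3 := by rw [hC3]; positivity
  obtain ⟨c3, hc3⟩ : ∃ c3, c3 = min c0 (σ * q) := ⟨_, rfl⟩
  have hc3p : 0 < c3 := by rw [hc3]; positivity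
  obtain ⟨D, hD⟩ : ∃ D, D = 3 + 2 * ‖l1‖ ^ 2 := ⟨_, rfl⟩
  have hDp : 3 ≤ D := by rw [hD]; have := sq_nonneg ‖l1‖; linarith
  refine ⟨c, hc, κ, hκp, C2 / c0 * 9 + C3 / c3 * D ^ 2, by positivity,
    fun W W1 W' p y hsol t ht => ?_⟩
  -- the lifted state
  set g : ℝ → ℝ := fun t => S.first (y t) with hg
  set h : ℝ → H := fun t => W t - g t • l with hh
  set h1 : ℝ → H := fun t => W1 t - g t • l1 with hh1
  set Ah : ℝ → H := fun t => W' t - g t • l2 with hAh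
  set y' : ℝ → Y := fun t => A c (y t) + S.N (W t, p t) • S.e with hy'
  have hmem : ∀ s, 0 ≤ s → (h s, h1 s, Ah s, (0 : ℝ)) ∈ S.graph := fun s hs => by
    have := S.graph.sub_mem (hsol.mem s hs) (S.graph.smul_mem (g s) hl)
    simpa [hh, hh1, hAh, hg] using this
  have hgd : ∀ s, 0 ≤ s → HasDerivWithinAt g (S.first (y' s)) (Set.Ici 0) s := fun s hs =>
    S.first.hasFDerivAt.comp_hasDerivWithinAt s (hsol.derivy s hs)
  have hhd : ∀ s, 0 ≤ s → HasDerivWithinAt h (W' s - S.first (y' s) • l) (Set.Ici 0) s :=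
    fun s hs => (hsol.derivW s hs).sub ((hgd s hs).smul_const l)
  have hgle : ∀ s, |g s| ≤ ‖y s‖ := fun s => hS.first_le (y s)
  have hgl : ∀ s, ‖g s • l‖ ≤ ε * ‖y s‖ := fun s => by
    rw [norm_smul, Real.norm_eq_abs, mul_comm]
    exact mul_le_mul hlε (hgle s) (abs_nonneg _) hε.le
  have hW : ∀ s, ‖W s‖ ≤ ‖h s‖ + ε * ‖y s‖ := fun s => by
    have : W s = h s + g s • l := by simp [hh]
    rw [this]; exact (norm_add_le _ _).trans (by gcongr; exact hgl s)
  have hNle : ∀ s, |S.N (W s, p s)| ≤ N * (‖h s‖ + ε * ‖y s‖ + ‖p s‖) := fun s => by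
    have h2 : ‖(W s, p s)‖ ≤ ‖h s‖ + ε * ‖y s‖ + ‖p s‖ := by
      rw [Prod.norm_def]
      have := hW s
      have h3 := norm_nonneg (p s)
      have h4 := norm_nonneg (W s)
      exact max_le (by linarith) (by linarith)
    have h5 := S.N.le_opNorm (W s, p s)
    rw [Real.norm_eq_abs] at h5
    refine h5.trans (mul_le_mul ?_ h2 (norm_nonneg _) hN.le)
    rw [hNdef]; linarith
  have hg'le : ∀ s, |S.first (y' s)| ≤ (c + 1) * ‖y s‖ + |S.N (W s, p s)| := fun s => by
    have h2 : S.first (y' s) = (S.first (A c (y s)) + c * S.first (y s)) - c * g s +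
        S.N (W s, p s) * S.first S.e := by
      simp [hy', hg]
    have h3 := hS.damping_first c (y s)
    have h4 : |S.first S.e| ≤ 1 := (hS.first_le _).trans hS.norm_e_le
    have h5 : |S.N (W s, p s) * S.first S.e| ≤ |S.N (W s, p s)| := by
      rw [abs_mul]; exact mul_le_of_le_one_right (abs_nonneg _) h4
    have h6 : |c * g s| ≤ c * ‖y s‖ := by
      rw [abs_mul, abs_of_pos hc]; exact mul_le_mul_of_nonneg_left (hgle s) hc.le
    rw [h2]
    refine (abs_add_le _ _).trans ?_
    have := abs_sub (S.first (A c (y s)) + c * S.first (y s)) (c * g s)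
    linarith
  have hAh0 : ∀ s, 0 ≤ s → ⟪h s, Ah s⟫ = -q * ‖h1 s‖ ^ 2 := fun s hs => by
    rw [hS.green _ _ _ _ _ _ (hmem s hs) (hmem s hs), real_inner_self_eq_norm_sq]
  have hhh1 : ∀ s, 0 ≤ s → ‖h s‖ ≤ ‖h1 s‖ := fun s hs => hS.poincare _ _ _ (hmem s hs)
  have hrem : ∀ s, ‖g s • l2 - S.first (y' s) • l‖ ≤
      ‖l2‖ * ‖y s‖ + ε * ((c + 1) * ‖y s‖ + |S.N (W s, p s)|) := fun s => by
    refine (norm_sub_le _ _).trans ?_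
    rw [norm_smul, norm_smul, Real.norm_eq_abs, Real.norm_eq_abs, mul_comm, mul_comm _ ‖l‖]
    gcongr
    · exact hgle s
    · exact hg'le s
  -- the functional without the spatial derivative
  set Q : ℝ → ℝ := fun s => ‖h s‖ ^ 2 + ‖p s‖ ^ 2 + ‖y s‖ ^ 2 with hQ
  set V : ℝ → ℝ := fun s => 1 / 2 * ⟪h s, h s⟫ + ρ / 2 * stepForm S.M r n (p s) (p s) +
    δ * c / 2 * ⟪y s, y s⟫ with hV
  have hVd : ∀ s, 0 ≤ s → HasDerivWithinAt V (⟪h s, W' s - S.first (y' s) • l⟫ +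
      ρ * stepForm S.M r n (p s) (S.M (p s) + S.Bp (W s)) + δ * c * ⟪y s, y' s⟫)
      (Set.Ici 0) s := fun s hs => by
    have d1 := ((hhd s hs).inner ℝ (hhd s hs)).const_mul (1 / 2)
    have d2 := (hasDerivWithinAt_stepForm S.M r n (hsol.derivp s hs)).const_mul (ρ / 2)
    have d3 := ((hsol.derivy s hs).inner ℝ (hsol.derivy s hs)).const_mul (δ * c / 2)
    refine ((d1.add d2).add d3).congr_deriv ?_
    rw [real_inner_comm (h s) (W' s - _), real_inner_comm (y s) (_ + _)]
    ring
  have hVle : ∀ s, 0 ≤ s → ⟪h s, W' s - S.first (y' s) • l⟫ +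
      ρ * stepForm S.M r n (p s) (S.M (p s) + S.Bp (W s)) + δ * c * ⟪y s, y' s⟫ ≤
      -μ * Q s := fun s hs => by
    have t1 : ⟪h s, W' s - S.first (y' s) • l⟫ ≤ -q * ‖h s‖ ^ 2 + ‖h s‖ * (‖l2‖ * ‖y s‖ +
        ε * ((c + 1) * ‖y s‖ + |S.N (W s, p s)|)) := by
      have e1 : W' s - S.first (y' s) • l = Ah s + (g s • l2 - S.first (y' s) • l) := by
        simp [hAh]
      rw [e1, inner_add_right, hAh0 s hs]
      have e2 : q * ‖h s‖ ^ 2 ≤ q * ‖h1 s‖ ^ 2 := by gcongr; exact hhh1 s hs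
      have e3 := (real_inner_le_norm (h s) (g s • l2 - S.first (y' s) • l)).trans
        (mul_le_mul_of_nonneg_left (hrem s) (norm_nonneg _))
      linarith
    have t2 : stepForm S.M r n (p s) (S.M (p s) + S.Bp (W s)) ≤
        -(3 / (8 * r)) * ‖p s‖ ^ 2 + β * ‖p s‖ * (‖h s‖ + ε * ‖y s‖) := by
      rw [stepForm_add_right]
      refine add_le_add (stepForm_apply_le hr hSn _) ((hform _ _).trans ?_)
      have e1 : ‖S.Bp (W s)‖ ≤ (‖S.Bp‖ + 1) * (‖h s‖ + ε * ‖y s‖) :=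
        (S.Bp.le_opNorm _).trans (mul_le_mul (by linarith) (hW s) (norm_nonneg _) (by positivity))
      calc _ ≤ Cf * (‖p s‖ * ((‖S.Bp‖ + 1) * (‖h s‖ + ε * ‖y s‖))) := by gcongr
        _ = _ := by rw [hβdef]; ring
    have t3 : ⟪y s, y' s⟫ ≤ -c * ‖y s‖ ^ 2 + ‖y s‖ * |S.N (W s, p s)| := by
      rw [hy']
      simp only [inner_add_right, inner_smul_right]
      rw [hS.damping]
      have e1 : S.N (W s, p s) * ⟪y s, S.e⟫ ≤ |S.N (W s, p s)| * ‖y s‖ := by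
        refine (le_abs_self _).trans ?_
        rw [abs_mul]
        gcongr
        exact (abs_real_inner_le_norm _ _).trans
          (mul_le_of_le_one_right (norm_nonneg _) hS.norm_e_le)
      linarith
    refine le_trans ?_ (hgain ‖h s‖ ‖p s‖ ‖y s‖ |S.N (W s, p s)| (norm_nonneg _) (norm_nonneg _)
      (norm_nonneg _) (abs_nonneg _) (hNle s))
    gcongr
  have hV1 : ∀ s, c0 * Q s ≤ V s := fun s => by
    have e1 := sq_norm_le_stepForm S.M r hn (p s)
    have e2 : c0 ≤ 1 / 2 := by rw [hc0]; exact (min_le_left _ _).trans (min_le_left _ _)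
    have e3 : c0 ≤ ρ / 2 := by rw [hc0]; exact (min_le_left _ _).trans (min_le_right _ _)
    have e4 : c0 ≤ δ * c / 2 := by rw [hc0]; exact min_le_right _ _
    simp only [hQ, hV, real_inner_self_eq_norm_sq, mul_add]
    gcongr
  have hV2 : ∀ s, V s ≤ C2 * Q s := fun s => by
    have e1 : ρ / 2 * stepForm S.M r n (p s) (p s) ≤ ρ / 2 * (Cf * (‖p s‖ * ‖p s‖)) := by
      gcongr; exact hform _ _
    simp only [hQ, hV, real_inner_self_eq_norm_sq, hC2]
    have : 0 ≤ (1 / 2 + δ * c / 2) * ‖p s‖ ^ 2 + (ρ / 2 * Cf) * (‖h s‖ ^ 2 + ‖y s‖ ^ 2) +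
      1 / 2 * ‖y s‖ ^ 2 + δ * c / 2 * ‖h s‖ ^ 2 := by positivity
    nlinarith only [this, e1]
  have hQ0 : ∀ s, 0 ≤ Q s := fun s => by simp only [hQ]; positivity
  -- `-⟪h, Ah⟫ = q ‖h1‖²` is differentiated through `h` alone, as `Ah` is only continuous in time
  have hJd : ∀ s, 0 ≤ s → HasDerivWithinAt (fun s => ⟪h s, Ah s⟫)
      (2 * ⟪W' s - S.first (y' s) • l, Ah s⟫) (Set.Ici 0) s := fun s hs => by
    refine hasDerivWithinAt_inner_of_symm hs (hhd s hs) ?_ ?_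
    · exact (hsol.cont s hs).sub ((hgd s hs).continuousWithinAt.smul continuousWithinAt_const)
    · intro a ha b hb
      rw [hS.green _ _ _ _ _ _ (hmem a ha) (hmem b hb), real_inner_comm,
        ← hS.green _ _ _ _ _ _ (hmem b hb) (hmem a ha)]
  have hJle : ∀ s, 0 ≤ s → -(2 * ⟪W' s - S.first (y' s) • l, Ah s⟫) ≤
      -q * (q * ‖h1 s‖ ^ 2) + 3 * R ^ 2 * Q s := fun s hs => by
    have e1 : W' s - S.first (y' s) • l = Ah s + (g s • l2 - S.first (y' s) • l) := by
      simp [hAh]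
    have e2 : ‖g s • l2 - S.first (y' s) • l‖ ≤ R * (‖h s‖ + ‖p s‖ + ‖y s‖) := by
      refine (hrem s).trans ?_
      have f0 : ε * ‖y s‖ ≤ ‖y s‖ := mul_le_of_le_one_left (norm_nonneg _) hε1
      have f1 : |S.N (W s, p s)| ≤ N * (‖h s‖ + ‖y s‖ + ‖p s‖) := (hNle s).trans (by gcongr)
      have f2 : ε * ((c + 1) * ‖y s‖ + |S.N (W s, p s)|) ≤ (c + 1) * ‖y s‖ + |S.N (W s, p s)| :=
        mul_le_of_le_one_left (by positivity) hε1
      have f3 : 0 ≤ (‖l2‖ + c + 1) * (‖h s‖ + ‖p s‖) := by positivity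
      rw [hR]
      linarith
    have e3 : ‖g s • l2 - S.first (y' s) • l‖ ^ 2 ≤ 3 * R ^ 2 * Q s := by
      calc _ ≤ (R * (‖h s‖ + ‖p s‖ + ‖y s‖)) ^ 2 := by gcongr
        _ = R ^ 2 * (‖h s‖ + ‖p s‖ + ‖y s‖) ^ 2 := by ring
        _ ≤ R ^ 2 * (3 * Q s) := by
          gcongr
          simp only [hQ]
          nlinarith only [sq_nonneg (‖h s‖ - ‖p s‖), sq_nonneg (‖h s‖ - ‖y s‖),
            sq_nonneg (‖p s‖ - ‖y s‖)]
        _ = _ := by ring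
    have e4 : q * ‖h1 s‖ ≤ ‖Ah s‖ := by
      rcases eq_or_lt_of_le (norm_nonneg (h1 s)) with h0 | h0
      · rw [← h0]; simp
      have f1 := abs_real_inner_le_norm (h s) (Ah s)
      rw [hAh0 s hs, neg_mul, abs_neg, abs_of_nonneg (by positivity)] at f1
      have f2 : ‖h s‖ * ‖Ah s‖ ≤ ‖h1 s‖ * ‖Ah s‖ := by gcongr; exact hhh1 s hs
      refine le_of_mul_le_mul_left ?_ h0
      linarith
    have e5 : (q * ‖h1 s‖) ^ 2 ≤ ‖Ah s‖ ^ 2 := by gcongr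
    rw [e1, inner_add_left, real_inner_self_eq_norm_sq]
    have e6 := (neg_le_abs _).trans (abs_real_inner_le_norm (g s • l2 - S.first (y' s) • l) (Ah s))
    nlinarith only [e3, e5, e6, sq_nonneg (‖g s • l2 - S.first (y' s) • l‖ - ‖Ah s‖)]
  set V1 : ℝ → ℝ := fun s => V s + σ * -⟪h s, Ah s⟫ with hV1d
  have hσR : σ * (3 * R ^ 2) = μ / 2 := by rw [hσ]; field_simp; norm_num
  have hdec : ∀ s, 0 ≤ s → V s ≤ V 0 * Real.exp (-κ * s) := fun s hs => by
    refine le_exp_of_deriv_le hVd (fun s hs => (hVle s hs).trans ?_) hs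
    have := mul_le_mul_of_nonneg_left (hV2 s) hκp.le
    have := mul_le_mul_of_nonneg_right hκ1 (hQ0 s)
    have := mul_nonneg hμ.le (hQ0 s)
    linarith
  have hdec1 : ∀ s, 0 ≤ s → V1 s ≤ V1 0 * Real.exp (-κ * s) := fun s hs => by
    refine le_exp_of_deriv_le (fun s hs => (hVd s hs).add (((hJd s hs).neg).const_mul σ))
      (fun s hs => ?_) hs
    have f1 := hVle s hs
    have f2 := mul_le_mul_of_nonneg_left (hJle s hs) hσp.le
    have f3 := mul_le_mul_of_nonneg_left (hV2 s) hκp.le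
    have f4 := mul_le_mul_of_nonneg_right hκ1 (hQ0 s)
    have f5 : κ * (σ * (q * ‖h1 s‖ ^ 2)) ≤ q * (σ * (q * ‖h1 s‖ ^ 2)) := by gcongr
    have f6 : σ * (3 * R ^ 2 * Q s) = μ / 2 * Q s := by rw [← hσR]; ring
    have f7 : V1 s = V s + σ * (q * ‖h1 s‖ ^ 2) := by simp only [hV1d, hAh0 s hs]; ring
    change _ ≤ -κ * V1 s
    rw [f7]
    linarith
  -- comparison with the norms
  have hgl1 : ∀ s, ‖g s • l1‖ ^ 2 ≤ ‖l1‖ ^ 2 * ‖y s‖ ^ 2 := fun s => by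
    rw [norm_smul, mul_pow, mul_comm, Real.norm_eq_abs]
    gcongr
    exact hgle s
  have hgl0 : ∀ s, ‖g s • l‖ ^ 2 ≤ ‖y s‖ ^ 2 := fun s => by
    gcongr; exact (hgl s).trans (mul_le_of_le_one_left (norm_nonneg _) hε1)
  have hsq : ∀ u v : H, ‖u + v‖ ^ 2 ≤ 2 * ‖u‖ ^ 2 + 2 * ‖v‖ ^ 2 := fun u v => by
    nlinarith only [parallelogram_law_with_norm ℝ u v, sq_nonneg ‖u - v‖]
  have hsq' : ∀ u v : H, ‖u - v‖ ^ 2 ≤ 2 * ‖u‖ ^ 2 + 2 * ‖v‖ ^ 2 := fun u v => by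
    nlinarith only [parallelogram_law_with_norm ℝ u v, sq_nonneg ‖u + v‖]
  have hE1 : ∀ s, ‖W s‖ ^ 2 + ‖p s‖ ^ 2 + ‖y s‖ ^ 2 ≤ 3 * Q s := fun s => by
    have e1 := hsq (h s) (g s • l)
    have e2 : h s + g s • l = W s := by simp [hh]
    rw [e2] at e1
    have := hgl0 s
    simp only [hQ]
    nlinarith only [e1, this, sq_nonneg ‖h s‖, sq_nonneg ‖p s‖]
  have hE2 : ∀ s, Q s ≤ 3 * (‖W s‖ ^ 2 + ‖p s‖ ^ 2 + ‖y s‖ ^ 2) := fun s => by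
    have e1 := hsq' (W s) (g s • l)
    have := hgl0 s
    simp only [hQ]
    have e2 : h s = W s - g s • l := rfl
    rw [← e2] at e1
    nlinarith only [e1, this, sq_nonneg ‖W s‖, sq_nonneg ‖p s‖]
  have hE3 : ∀ s, ‖W s‖ ^ 2 + ‖W1 s‖ ^ 2 + ‖p s‖ ^ 2 + ‖y s‖ ^ 2 ≤ D * (Q s + ‖h1 s‖ ^ 2) :=
    fun s => by
    have e1 := hsq (h1 s) (g s • l1)
    have e2 : h1 s + g s • l1 = W1 s := by simp [hh1]
    rw [e2] at e1
    have e3 := hgl1 s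
    have e4 := hE1 s
    have e5 : ‖l1‖ ^ 2 * ‖y s‖ ^ 2 ≤ ‖l1‖ ^ 2 * Q s := by
      gcongr; simp only [hQ]; have := sq_nonneg ‖h s‖; have := sq_nonneg ‖p s‖; linarith
    have e6 : 0 ≤ (1 + 2 * ‖l1‖ ^ 2) * ‖h1 s‖ ^ 2 := by positivity
    rw [hD]
    linarith
  have hE4 : ∀ s, Q s + ‖h1 s‖ ^ 2 ≤
      D * (‖W s‖ ^ 2 + ‖W1 s‖ ^ 2 + ‖p s‖ ^ 2 + ‖y s‖ ^ 2) := fun s => by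
    have e1 := hsq' (W1 s) (g s • l1)
    have e2 : h1 s = W1 s - g s • l1 := rfl
    rw [← e2] at e1
    have e3 := hgl1 s
    have e4 := hE2 s
    have e6 : 0 ≤ (1 + 2 * ‖l1‖ ^ 2) * ‖W1 s‖ ^ 2 + 2 * ‖l1‖ ^ 2 * (‖W s‖ ^ 2 + ‖p s‖ ^ 2) := by
      positivity
    rw [hD]
    linarith
  have hV11 : ∀ s, 0 ≤ s → c3 * (Q s + ‖h1 s‖ ^ 2) ≤ V1 s := fun s hs => by
    have e1 : c3 * Q s ≤ c0 * Q s := by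
      have := hQ0 s; gcongr; rw [hc3]; exact min_le_left _ _
    have e2 : c3 * ‖h1 s‖ ^ 2 ≤ (σ * q) * ‖h1 s‖ ^ 2 := by
      gcongr; rw [hc3]; exact min_le_right _ _
    have := hV1 s
    simp only [hV1d, hAh0 s hs]
    linarith
  have hV12 : ∀ s, 0 ≤ s → V1 s ≤ C3 * (Q s + ‖h1 s‖ ^ 2) := fun s hs => by
    have e1 := hV2 s
    have e2 : 0 ≤ C2 * ‖h1 s‖ ^ 2 + σ * q * Q s := by have := hQ0 s; positivity
    simp only [hV1d, hAh0 s hs, hC3]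
    linarith
  have hexp := Real.exp_pos (-κ * t)
  have hfac : ∀ {E0 E v v0 a b k : ℝ}, 0 < a → 0 < k → 0 ≤ b → 0 ≤ E0 → a * E ≤ k * v →
      v ≤ v0 * Real.exp (-κ * t) → v0 ≤ b * (k * E0) →
      E ≤ b / a * k ^ 2 * E0 * Real.exp (-κ * t) := by
    intro E0 E v v0 a b k ha hk hb hE0 h1 h2 h3
    refine le_of_mul_le_mul_left ?_ ha
    calc a * E ≤ k * v := h1
      _ ≤ k * ((b * (k * E0)) * Real.exp (-κ * t)) := by
        gcongr
        exact h2.trans (by gcongr)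
      _ = _ := by field_simp
  constructor
  · have key := hfac (E0 := ‖W 0‖ ^ 2 + ‖p 0‖ ^ 2 + ‖y 0‖ ^ 2)
      (E := ‖W t‖ ^ 2 + ‖p t‖ ^ 2 + ‖y t‖ ^ 2) hc0p (by norm_num : (0 : ℝ) < 3) hC2p.le
      (by positivity) (by
        have := mul_le_mul_of_nonneg_left (hE1 t) hc0p.le
        have := hV1 t
        linarith) (hdec t ht) ((hV2 0).trans (by gcongr; exact hE2 0))
    refine key.trans ?_
    have h9 : C2 / c0 * 3 ^ 2 ≤ C2 / c0 * 9 + C3 / c3 * D ^ 2 := by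
      have : 0 ≤ C3 / c3 * D ^ 2 := by positivity
      linarith
    gcongr
  · have key := hfac (E0 := ‖W 0‖ ^ 2 + ‖W1 0‖ ^ 2 + ‖p 0‖ ^ 2 + ‖y 0‖ ^ 2)
      (E := ‖W t‖ ^ 2 + ‖W1 t‖ ^ 2 + ‖p t‖ ^ 2 + ‖y t‖ ^ 2) hc3p (by linarith : (0 : ℝ) < D)
      hC3p.le (by positivity) (by
        have h6 := mul_le_mul_of_nonneg_left (hE3 t) hc3p.le
        have h7 := mul_le_mul_of_nonneg_left (hV11 t ht) (by linarith : (0 : ℝ) ≤ D)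
        linarith) (hdec1 t ht) ((hV12 0 le_rfl).trans (by gcongr; exact hE4 0))
    refine key.trans ?_
    have h9 : C3 / c3 * D ^ 2 ≤ C2 / c0 * 9 + C3 / c3 * D ^ 2 := by
      have : 0 ≤ C2 / c0 * 9 := by positivity
      linarith
    gcongr

lemma tendsto_slope_shift {E : Type*} [NormedAddCommGroup E] [NormedSpace ℝ E] {f : ℝ → E}
    {f' : E} {t : ℝ} (ht : 0 ≤ t) (hf : HasDerivWithinAt f f' (Set.Ici 0) t) :
    Filter.Tendsto (fun d : ℝ => d⁻¹ • (f (t + d) - f t)) (𝓝[>] 0) (𝓝 f') := by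
  have h1 : HasDerivWithinAt f f' (Set.Ioi t) t :=
    hf.mono fun x hx => ht.trans (le_of_lt hx)
  rw [hasDerivWithinAt_iff_tendsto_slope' (by simp)] at h1
  have h2 : Filter.Tendsto (fun d : ℝ => t + d) (𝓝[>] 0) (𝓝[>] t) := by
    refine tendsto_nhdsWithin_iff.2 ⟨?_, ?_⟩
    · have : Filter.Tendsto (fun d : ℝ => t + d) (𝓝 0) (𝓝 (t + 0)) := by
        exact (continuous_const.add continuous_id).tendsto 0
      rw [add_zero] at this
      exact this.mono_left nhdsWithin_le_nhds
    · filter_upwards [self_mem_nhdsWithin] with d hd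
      simp only [Set.mem_Ioi] at hd ⊢; linarith
  refine (h1.comp h2).congr fun d => ?_
  simp [slope_def_module]

/-- Time derivatives of solutions decay like solutions: the estimates of `exists_gain` apply to
difference quotients in time. -/
theorem IsStabilizable.exists_gain_deriv (hS : S.IsStabilizable q A) :
    ∃ c > 0, ∃ κ > 0, ∃ C > 0, ∀ (W W1 W' : ℝ → H) (p : ℝ → Hp) (y : ℝ → Y),
      S.IsSolution (A c) W W1 W' p y → ∀ t, 0 ≤ t →
      ‖W t‖ ^ 2 + ‖W1 t‖ ^ 2 + ‖p t‖ ^ 2 + ‖y t‖ ^ 2 ≤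
        C * (‖W 0‖ ^ 2 + ‖W1 0‖ ^ 2 + ‖p 0‖ ^ 2 + ‖y 0‖ ^ 2) * Real.exp (-κ * t) ∧
      ‖W' t‖ ^ 2 ≤ C * (‖W' 0‖ ^ 2 + ‖S.M (p 0) + S.Bp (W 0)‖ ^ 2 +
        ‖A c (y 0) + S.N (W 0, p 0) • S.e‖ ^ 2) * Real.exp (-κ * t) ∧
      ∀ W1' : ℝ → H, (∀ t, 0 ≤ t → HasDerivWithinAt W1 (W1' t) (Set.Ici 0) t) →
        ‖W1' t‖ ^ 2 ≤ C * (‖W' 0‖ ^ 2 + ‖W1' 0‖ ^ 2 + ‖S.M (p 0) + S.Bp (W 0)‖ ^ 2 +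
          ‖A c (y 0) + S.N (W 0, p 0) • S.e‖ ^ 2) * Real.exp (-κ * t) := by
  obtain ⟨c, hc, κ, hκ, C, hC, hmain⟩ := hS.exists_gain
  refine ⟨c, hc, κ, hκ, C, hC, fun W W1 W' p y hsol t ht => ⟨(hmain _ _ _ _ _ hsol t ht).2, ?_⟩⟩
  have hW := fun s hs => tendsto_slope_shift hs (hsol.derivW s hs)
  have hp := fun s hs => tendsto_slope_shift hs (hsol.derivp s hs)
  have hy := fun s hs => tendsto_slope_shift hs (hsol.derivy s hs)
  have hdiff : ∀ᶠ d in 𝓝[>] (0 : ℝ), 0 ≤ d := by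
    filter_upwards [self_mem_nhdsWithin] with d hd using le_of_lt hd
  have sq : ∀ {E : Type _} [NormedAddCommGroup E] {f : ℝ → E} {a : E},
      Filter.Tendsto f (𝓝[>] 0) (𝓝 a) →
      Filter.Tendsto (fun d => ‖f d‖ ^ 2) (𝓝[>] 0) (𝓝 (‖a‖ ^ 2)) := fun h => h.norm.pow 2
  have sqp : ∀ {f : ℝ → Hp} {a : Hp}, Filter.Tendsto f (𝓝[>] 0) (𝓝 a) →
      Filter.Tendsto (fun d => ‖f d‖ ^ 2) (𝓝[>] 0) (𝓝 (‖a‖ ^ 2)) := fun h => h.norm.pow 2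
  have sqy : ∀ {f : ℝ → Y} {a : Y}, Filter.Tendsto f (𝓝[>] 0) (𝓝 a) →
      Filter.Tendsto (fun d => ‖f d‖ ^ 2) (𝓝[>] 0) (𝓝 (‖a‖ ^ 2)) := fun h => h.norm.pow 2
  constructor
  · have h0 := (((sq (hW 0 le_rfl)).add (sqp (hp 0 le_rfl))).add (sqy (hy 0 le_rfl)) |>.const_mul
      C).mul_const (Real.exp (-κ * t))
    refine le_of_tendsto_of_tendsto (sq (hW t ht)) h0 ?_
    filter_upwards [hdiff] with d hd
    have h1 := (hmain _ _ _ _ _ (hsol.smul_shift_sub d⁻¹ hd) t ht).1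
    refine le_trans ?_ h1
    have := sq_nonneg ‖d⁻¹ • (p (t + d) - p t)‖
    have := sq_nonneg ‖d⁻¹ • (y (t + d) - y t)‖
    linarith
  · intro W1' hW1'
    have hW1 := fun s hs => tendsto_slope_shift hs (hW1' s hs)
    have h0 := ((((sq (hW 0 le_rfl)).add (sq (hW1 0 le_rfl))).add (sqp (hp 0 le_rfl))).add
      (sqy (hy 0 le_rfl)) |>.const_mul C).mul_const (Real.exp (-κ * t))
    refine le_of_tendsto_of_tendsto (sq (hW1 t ht)) h0 ?_
    filter_upwards [hdiff] with d hd
    have h1 := (hmain _ _ _ _ _ (hsol.smul_shift_sub d⁻¹ hd) t ht).2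
    refine le_trans ?_ h1
    have := sq_nonneg ‖d⁻¹ • (p (t + d) - p t)‖
    have := sq_nonneg ‖d⁻¹ • (y (t + d) - y t)‖
    have := sq_nonneg ‖d⁻¹ • (W (t + d) - W t)‖
    linarith

/-- The time derivative of a solution is a solution if it is differentiable and satisfies the heat
equation. -/
lemma IsSolution.deriv {Ay : Y →L[ℝ] Y} {W W1 W' W1' W'' : ℝ → H} {p : ℝ → Hp} {y : ℝ → Y}
    (h : S.IsSolution Ay W W1 W' p y)
    (hmem : ∀ t, 0 ≤ t →
      (W' t, W1' t, W'' t, S.first (Ay (y t) + S.N (W t, p t) • S.e)) ∈ S.graph)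
    (hcont : ContinuousOn W'' (Set.Ici 0))
    (hderiv : ∀ t, 0 ≤ t → HasDerivWithinAt W' (W'' t) (Set.Ici 0) t) :
    S.IsSolution Ay W' W1' W'' (fun t => S.M (p t) + S.Bp (W t))
      (fun t => Ay (y t) + S.N (W t, p t) • S.e) where
  mem := hmem
  cont := hcont
  derivW := hderiv
  derivp t ht := (S.M.hasFDerivAt.comp_hasDerivWithinAt t (h.derivp t ht)).add
    (S.Bp.hasFDerivAt.comp_hasDerivWithinAt t (h.derivW t ht))
  derivy t ht := (Ay.hasFDerivAt.comp_hasDerivWithinAt t (h.derivy t ht)).add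
    ((S.N.hasFDerivAt.comp_hasDerivWithinAt t
      ((h.derivW t ht).prodMk (h.derivp t ht))).smul_const S.e)

end TargetSystem
end Target
end SandwichedHeat

namespace SandwichedHeat

/-! ### Hurwitz matrices and explicit Euler steps -/

section Hurwitz

attribute [local instance] Matrix.linftyOpNormedRing Matrix.linftyOpNormedAlgebra

/-- If `spectralRadius a < 1`, then the powers of `a` tend to zero. -/
lemma tendsto_pow_of_spectralRadius_lt_one {A : Type*} [NormedRing A] [NormedAlgebra ℂ A]
    [CompleteSpace A] {a : A} (ha : spectralRadius ℂ a < 1) :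
    Filter.Tendsto (fun k : ℕ => ‖a ^ k‖) Filter.atTop (𝓝 0) := by
  obtain ⟨b, hb1, hb2⟩ := ENNReal.lt_iff_exists_nnreal_btwn.1 ha
  have hb : (b : ℝ) < 1 := by exact_mod_cast hb2
  have h := (spectrum.pow_norm_pow_one_div_tendsto_nhds_spectralRadius a).eventually_lt_const hb1
  refine squeeze_zero' (Filter.Eventually.of_forall fun k => norm_nonneg _) ?_
    (tendsto_pow_atTop_nhds_zero_of_lt_one b.2 hb)
  filter_upwards [h, Filter.eventually_gt_atTop 0] with k hk hk0
  have h1 : ‖a ^ k‖ ^ (1 / k : ℝ) < b := by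
    rw [ENNReal.ofReal_lt_coe_iff (by positivity)] at hk
    exact_mod_cast hk
  have h2 : (‖a ^ k‖ ^ (1 / k : ℝ)) ^ k = ‖a ^ k‖ := by
    rw [← Real.rpow_natCast, ← Real.rpow_mul (norm_nonneg _)]
    rw [one_div_mul_cancel (by positivity), Real.rpow_one]
  rw [← h2]
  exact pow_le_pow_left₀ (by positivity) h1.le k

open scoped Pointwise in
/-- Explicit Euler steps for a Hurwitz matrix contract eventually: for small `r` the eigenvalues
`1 + r μ` of `1 + r M` lie in the open unit disc. -/
lemma Hurwitz.exists_euler {n : ℕ} (hn : 0 < n) {M : Matrix (Fin n) (Fin n) ℝ} (hM : Hurwitz M) :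
    ∃ r : ℝ, 0 < r ∧ ∀ ε : ℝ, 0 < ε → ∃ k : ℕ, 0 < k ∧ ∀ i j, |((1 + r • M) ^ k) i j| ≤ ε := by
  have : Nonempty (Fin n) := ⟨⟨0, hn⟩⟩
  set Mc : Matrix (Fin n) (Fin n) ℂ := M.map (algebraMap ℝ ℂ) with hMc
  have hcomp : IsCompact (spectrum ℂ Mc) := spectrum.isCompact Mc
  have hne : (spectrum ℂ Mc).Nonempty := spectrum.nonempty Mc
  obtain ⟨μ1, hμ1, hmax⟩ := hcomp.exists_isMaxOn hne Complex.continuous_re.continuousOn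
  obtain ⟨μ2, hμ2, hmax2⟩ := hcomp.exists_isMaxOn hne continuous_norm.continuousOn
  have hneg : μ1.re < 0 := hM μ1 hμ1
  obtain ⟨r, hr⟩ : ∃ r, r = -μ1.re / (‖μ2‖ ^ 2 + 1) := ⟨_, rfl⟩
  have hr0 : 0 < r := by rw [hr]; exact div_pos (by linarith) (by positivity)
  refine ⟨r, hr0, fun ε hε => ?_⟩
  have hlt : ∀ z ∈ spectrum ℂ (1 + (r : ℂ) • Mc), ‖z‖₊ < 1 := fun z hz => by
    have hrc : (r : ℂ) ≠ 0 := by exact_mod_cast hr0.ne'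
    have h1 : z ∈ ({1} : Set ℂ) + (r : ℂ) • spectrum ℂ Mc := by
      rw [← spectrum.smul_eq_smul _ _ hne, spectrum.singleton_add_eq]
      simpa using hz
    obtain ⟨_, rfl, _, ⟨μ, hμ, rfl⟩, rfl⟩ := h1
    have h2 : μ.re ≤ μ1.re := hmax hμ
    have h3 : ‖μ‖ ≤ ‖μ2‖ := hmax2 hμ
    have h4 : ‖(1 : ℂ) + (r : ℂ) • μ‖ ^ 2 = 1 + 2 * r * μ.re + r ^ 2 * ‖μ‖ ^ 2 := by
      rw [Complex.sq_norm, Complex.sq_norm, Complex.normSq_apply, Complex.normSq_apply]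
      simp
      ring
    have h5 : r * ‖μ‖ ^ 2 ≤ -μ1.re := by
      calc r * ‖μ‖ ^ 2 ≤ r * (‖μ2‖ ^ 2 + 1) := by
            gcongr
            have : ‖μ‖ ^ 2 ≤ ‖μ2‖ ^ 2 := by gcongr
            linarith
        _ = -μ1.re := by rw [hr]; field_simp
    have h6 : ‖(1 : ℂ) + (r : ℂ) • μ‖ ^ 2 < 1 := by
      rw [h4]
      have h7 := mul_le_mul_of_nonneg_left h5 hr0.le
      have h8 := mul_le_mul_of_nonneg_left h2 hr0.le
      have h9 := mul_pos hr0 (neg_pos.2 hneg)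
      linarith
    have h7 : ‖(1 : ℂ) + (r : ℂ) • μ‖ < 1 := by
      by_contra hcon
      push Not at hcon
      nlinarith
    exact_mod_cast h7
  have hsr : spectralRadius ℂ (1 + (r : ℂ) • Mc) < 1 := by
    exact_mod_cast spectrum.spectralRadius_lt_of_forall_lt (1 + (r : ℂ) • Mc) (r := 1) hlt
  have htend := tendsto_pow_of_spectralRadius_lt_one hsr
  obtain ⟨k, hk, hk0⟩ := ((htend.eventually_lt_const hε).and
    (Filter.eventually_gt_atTop 0)).exists
  refine ⟨k, hk0, fun i j => ?_⟩
  have hmap : (1 + (r : ℂ) • Mc) ^ k = ((1 + r • M) ^ k).map (algebraMap ℝ ℂ) := by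
    have h1 : 1 + (r : ℂ) • Mc = (algebraMap ℝ ℂ).mapMatrix (1 + r • M) := by
      ext i j
      by_cases hij : i = j <;> simp [hMc, hij]
    rw [h1, ← map_pow]; rfl
  have hentry : ‖((1 + (r : ℂ) • Mc) ^ k) i j‖ ≤ ‖(1 + (r : ℂ) • Mc) ^ k‖ := by
    have h1 : ‖((1 + (r : ℂ) • Mc) ^ k) i j‖₊ ≤ ‖(1 + (r : ℂ) • Mc) ^ k‖₊ := by
      rw [Matrix.linfty_opNNNorm_def]
      exact (Finset.single_le_sum (f := fun j => ‖((1 + (r : ℂ) • Mc) ^ k) i j‖₊)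
        (fun _ _ => zero_le) (Finset.mem_univ j)).trans
        (Finset.le_sup (f := fun i => ∑ j, ‖((1 + (r : ℂ) • Mc) ^ k) i j‖₊) (Finset.mem_univ i))
    exact_mod_cast h1
  have h2 : ‖((1 + (r : ℂ) • Mc) ^ k) i j‖ = |((1 + r • M) ^ k) i j| := by
    rw [hmap]; simp
  rw [← h2]
  exact hentry.trans hk.le

end Hurwitz

section MatrixAction

variable {H : Type*} [NormedAddCommGroup H] [InnerProductSpace ℝ H] {n : ℕ}

/-- The action of a matrix on vectors with entries in a Hilbert space. -/
def matAct (M : Matrix (Fin n) (Fin n) ℝ) :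
    PiLp 2 (fun _ : Fin n => H) →L[ℝ] PiLp 2 (fun _ : Fin n => H) :=
  ((PiLp.continuousLinearEquiv 2 ℝ (fun _ : Fin n => H)).symm : _ →L[ℝ] _) ∘L
    ContinuousLinearMap.pi fun i => ∑ j, M i j • PiLp.proj 2 (fun _ : Fin n => H) j

@[simp] lemma matAct_apply (M : Matrix (Fin n) (Fin n) ℝ) (p : PiLp 2 (fun _ : Fin n => H))
    (i : Fin n) : matAct M p i = ∑ j, M i j • p j := by
  simp [matAct]

lemma matAct_mul (M N : Matrix (Fin n) (Fin n) ℝ) :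
    (matAct (M * N) : PiLp 2 (fun _ : Fin n => H) →L[ℝ] _) = matAct M * matAct N := by
  ext p i
  simp only [matAct_apply, Matrix.mul_apply, ContinuousLinearMap.mul_def,
    ContinuousLinearMap.comp_apply, Finset.sum_smul, Finset.smul_sum, smul_smul]
  exact Finset.sum_comm

lemma matAct_one_add_smul (M : Matrix (Fin n) (Fin n) ℝ) (r : ℝ) :
    (matAct (1 + r • M) : PiLp 2 (fun _ : Fin n => H) →L[ℝ] _) = 1 + r • matAct M := by
  ext p i
  simp [add_smul, Finset.sum_add_distrib, Matrix.one_apply, ite_smul, Finset.smul_sum, smul_smul]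

lemma matAct_pow (M : Matrix (Fin n) (Fin n) ℝ) (k : ℕ) :
    (matAct (M ^ k) : PiLp 2 (fun _ : Fin n => H) →L[ℝ] _) = matAct M ^ k := by
  induction k with
  | zero =>
    ext p i
    simp [Matrix.one_apply, ite_smul]
  | succ k ih => rw [pow_succ, matAct_mul, ih, pow_succ]

lemma norm_matAct_le (M : Matrix (Fin n) (Fin n) ℝ) {ε : ℝ} (hε : 0 ≤ ε)
    (hM : ∀ i j, |M i j| ≤ ε) :
    ‖(matAct M : PiLp 2 (fun _ : Fin n => H) →L[ℝ] _)‖ ≤ n * (n * ε) := by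
  refine ContinuousLinearMap.opNorm_le_bound _ (by positivity) fun p => ?_
  have h1 : ∀ i, ‖matAct M p i‖ ≤ n * ε * ‖p‖ := fun i => by
    rw [matAct_apply]
    refine (norm_sum_le _ _).trans ?_
    calc _ ≤ ∑ _j : Fin n, ε * ‖p‖ := by
          refine Finset.sum_le_sum fun j _ => ?_
          rw [norm_smul]
          exact mul_le_mul (hM i j) (PiLp.norm_apply_le p j) (norm_nonneg _) hε
      _ = _ := by simp; ring
  have h2 : ‖matAct M p‖ ≤ ∑ i, ‖matAct M p i‖ := by
    rw [PiLp.norm_eq_of_L2, Real.sqrt_le_left (by positivity)]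
    exact Finset.sum_sq_le_sq_sum_of_nonneg fun _ _ => norm_nonneg _
  calc _ ≤ ∑ _i : Fin n, n * ε * ‖p‖ := h2.trans (Finset.sum_le_sum fun i _ => h1 i)
    _ = _ := by simp; ring

lemma Hurwitz.exists_euler_matAct (hn : 0 < n) {M : Matrix (Fin n) (Fin n) ℝ} (hM : Hurwitz M) :
    ∃ r : ℝ, 0 < r ∧ ∃ k : ℕ, 0 < k ∧
      ‖(1 + r • (matAct M : PiLp 2 (fun _ : Fin n => H) →L[ℝ] _)) ^ k‖ ≤ 1 / 2 := by
  obtain ⟨r, hr, h⟩ := hM.exists_euler hn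
  have hn' : (0 : ℝ) < n := by exact_mod_cast hn
  obtain ⟨k, hk, hent⟩ := h (1 / (2 * n * n)) (by positivity)
  refine ⟨r, hr, k, hk, ?_⟩
  rw [← matAct_one_add_smul, ← matAct_pow]
  refine (norm_matAct_le _ (by positivity) hent).trans (le_of_eq ?_)
  field_simp

end MatrixAction
end SandwichedHeat

namespace SandwichedHeat

open MeasureTheory
open scoped RealInnerProductSpace

/-! ### `L²(0,1)` and primitives of square integrable functions -/

/-- Square integrability on `[0,1]`. -/
abbrev SqInt (f : ℝ → ℝ) : Prop := MemLp f 2 (volume.restrict (Set.Icc (0 : ℝ) 1))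

/-- The Hilbert space `L²(0,1)`. -/
abbrev L2 : Type := Lp ℝ 2 (volume.restrict (Set.Icc (0 : ℝ) 1))

open Classical in
/-- The class of `f` in `L²(0,1)`, and `0` if `f` is not square integrable. -/
def toL2 (f : ℝ → ℝ) : L2 := if h : SqInt f then h.toLp f else 0

lemma toL2_of_sqInt {f : ℝ → ℝ} (h : SqInt f) : toL2 f = h.toLp f := dif_pos h

lemma SqInt.congr {f g : ℝ → ℝ} (hf : SqInt f) (h : ∀ x ∈ Set.Icc (0 : ℝ) 1, f x = g x) :
    SqInt g :=
  (memLp_congr_ae (ae_restrict_of_forall_mem measurableSet_Icc h)).1 hf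

lemma toL2_congr_ae {f g : ℝ → ℝ} (h : f =ᵐ[volume.restrict (Set.Icc (0 : ℝ) 1)] g) :
    toL2 f = toL2 g := by
  by_cases hf : SqInt f
  · have hg : SqInt g := (memLp_congr_ae h).1 hf
    rw [toL2_of_sqInt hf, toL2_of_sqInt hg, MemLp.toLp_eq_toLp_iff]
    exact h
  · have hg : ¬ SqInt g := fun hg => hf ((memLp_congr_ae h).2 hg)
    rw [toL2, toL2, dif_neg hf, dif_neg hg]

lemma toL2_congr {f g : ℝ → ℝ} (h : ∀ x ∈ Set.Icc (0 : ℝ) 1, f x = g x) : toL2 f = toL2 g :=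
  toL2_congr_ae (ae_restrict_of_forall_mem measurableSet_Icc h)

lemma SqInt.add' {f g : ℝ → ℝ} (hf : SqInt f) (hg : SqInt g) : SqInt (fun x => f x + g x) :=
  hf.add hg

lemma SqInt.sub' {f g : ℝ → ℝ} (hf : SqInt f) (hg : SqInt g) : SqInt (fun x => f x - g x) :=
  hf.sub hg

lemma SqInt.const_mul' (c : ℝ) {f : ℝ → ℝ} (hf : SqInt f) : SqInt (fun x => c * f x) :=
  hf.const_mul c

lemma toL2_add {f g : ℝ → ℝ} (hf : SqInt f) (hg : SqInt g) :
    toL2 (fun x => f x + g x) = toL2 f + toL2 g := by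
  rw [toL2_of_sqInt hf, toL2_of_sqInt hg, ← MemLp.toLp_add hf hg]
  exact toL2_of_sqInt (hf.add hg)

lemma toL2_sub {f g : ℝ → ℝ} (hf : SqInt f) (hg : SqInt g) :
    toL2 (fun x => f x - g x) = toL2 f - toL2 g := by
  rw [toL2_of_sqInt hf, toL2_of_sqInt hg, ← MemLp.toLp_sub hf hg]
  exact toL2_of_sqInt (hf.sub hg)

lemma toL2_const_mul (c : ℝ) {f : ℝ → ℝ} (hf : SqInt f) :
    toL2 (fun x => c * f x) = c • toL2 f := by
  rw [toL2_of_sqInt hf, toL2_of_sqInt (hf.const_mul c)]; rfl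

lemma toL2_zero : toL2 (fun _ => 0) = 0 := by
  have h : SqInt (fun _ => (0 : ℝ)) := MemLp.zero
  rw [toL2_of_sqInt h]; exact MemLp.toLp_zero h

lemma sqInt_sum {ι : Type*} (s : Finset ι) {f : ι → ℝ → ℝ} (hf : ∀ i ∈ s, SqInt (f i)) :
    SqInt (fun x => ∑ i ∈ s, f i x) := memLp_finsetSum s hf

lemma toL2_sum {ι : Type*} (s : Finset ι) {f : ι → ℝ → ℝ} (hf : ∀ i ∈ s, SqInt (f i)) :
    toL2 (fun x => ∑ i ∈ s, f i x) = ∑ i ∈ s, toL2 (f i) := by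
  classical
  induction s using Finset.induction_on with
  | empty => simp [toL2_zero]
  | insert a s ha ih =>
    have h1 := fun i hi => hf i (Finset.mem_insert_of_mem hi)
    simp only [Finset.sum_insert ha]
    rw [toL2_add (hf a (Finset.mem_insert_self _ _)) (sqInt_sum s h1), ih h1]

lemma inner_toL2 {f g : ℝ → ℝ} (hf : SqInt f) (hg : SqInt g) :
    ⟪toL2 f, toL2 g⟫ = ∫ x in (0 : ℝ)..1, f x * g x := by
  rw [toL2_of_sqInt hf, toL2_of_sqInt hg, L2.inner_def,
    intervalIntegral.integral_of_le zero_le_one, ← integral_Icc_eq_integral_Ioc]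
  refine integral_congr_ae ?_
  filter_upwards [hf.coeFn_toLp, hg.coeFn_toLp] with x h1 h2
  rw [h1, h2, RCLike.inner_apply]
  simp [mul_comm]

lemma l2norm_eq_norm {f : ℝ → ℝ} (hf : SqInt f) : l2norm f = ‖toL2 f‖ := by
  rw [l2norm, norm_eq_sqrt_real_inner, inner_toL2 hf hf]
  simp only [pow_two]

lemma SqInt.intervalIntegrable {f : ℝ → ℝ} (hf : SqInt f) : IntervalIntegrable f volume 0 1 := by
  rw [intervalIntegrable_iff_integrableOn_Icc_of_le zero_le_one]
  exact hf.integrable (by norm_num)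

lemma SqInt.intervalIntegrable' {f : ℝ → ℝ} (hf : SqInt f) {x : ℝ} (hx : x ∈ Set.Icc (0 : ℝ) 1) :
    IntervalIntegrable f volume 0 x :=
  hf.intervalIntegrable.mono_set (by
    rw [Set.uIcc_of_le hx.1, Set.uIcc_of_le zero_le_one]; exact Set.Icc_subset_Icc_right hx.2)

lemma sqInt_of_continuousOn {f : ℝ → ℝ} (hf : ContinuousOn f (Set.Icc 0 1)) : SqInt f := by
  obtain ⟨C, hC⟩ := isCompact_Icc.exists_bound_of_continuousOn hf
  exact MemLp.of_bound (hf.aestronglyMeasurable measurableSet_Icc) C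
    (ae_restrict_of_forall_mem measurableSet_Icc hC)

lemma SqInt.mul_continuousOn {f g : ℝ → ℝ} (hf : SqInt f) (hg : ContinuousOn g (Set.Icc 0 1)) :
    SqInt (fun x => f x * g x) := by
  obtain ⟨C, hC⟩ := isCompact_Icc.exists_bound_of_continuousOn hg
  refine MemLp.of_le_mul (c := C) hf
    (hf.aestronglyMeasurable.mul (hg.aestronglyMeasurable measurableSet_Icc)) ?_
  refine ae_restrict_of_forall_mem measurableSet_Icc fun x hx => ?_
  rw [norm_mul, mul_comm]
  exact mul_le_mul_of_nonneg_right (hC x hx) (norm_nonneg _)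

/-- `f` is a primitive on `[0,1]` of the square integrable function `f'`; in other words,
`f` is the continuous representative of an element of `H¹(0,1)` with derivative `f'`. -/
structure IsPrim (f f' : ℝ → ℝ) : Prop where
  sqInt : SqInt f'
  eq_integral : ∀ x ∈ Set.Icc (0 : ℝ) 1, f x = f 0 + ∫ y in (0 : ℝ)..x, f' y

lemma IsPrim.continuousOn {f f' : ℝ → ℝ} (h : IsPrim f f') : ContinuousOn f (Set.Icc 0 1) := by
  have h1 : ContinuousOn (fun x => f 0 + ∫ y in (0 : ℝ)..x, f' y) (Set.Icc 0 1) := by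
    have := intervalIntegral.continuousOn_primitive_interval' h.sqInt.intervalIntegrable
      (a := (0 : ℝ)) (by simp)
    rw [Set.uIcc_of_le zero_le_one] at this
    exact continuousOn_const.add this
  exact h1.congr h.eq_integral

lemma IsPrim.sqInt_self {f f' : ℝ → ℝ} (h : IsPrim f f') : SqInt f :=
  sqInt_of_continuousOn h.continuousOn

lemma IsPrim.congr {f f' g g' : ℝ → ℝ} (h : IsPrim f f') (hf : ∀ x ∈ Set.Icc (0 : ℝ) 1, f x = g x)
    (hf' : ∀ x ∈ Set.Icc (0 : ℝ) 1, f' x = g' x) : IsPrim g g' where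
  sqInt := h.sqInt.congr hf'
  eq_integral x hx := by
    rw [← hf x hx, ← hf 0 (by simp), h.eq_integral x hx]
    congr 1
    refine intervalIntegral.integral_congr fun y hy => hf' y ?_
    rw [Set.uIcc_of_le hx.1] at hy
    exact ⟨hy.1, hy.2.trans hx.2⟩

lemma IsPrim.add {f f' g g' : ℝ → ℝ} (hf : IsPrim f f') (hg : IsPrim g g') :
    IsPrim (fun x => f x + g x) (fun x => f' x + g' x) where
  sqInt := hf.sqInt.add hg.sqInt
  eq_integral x hx := by
    rw [intervalIntegral.integral_add (hf.sqInt.intervalIntegrable' hx)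
      (hg.sqInt.intervalIntegrable' hx), hf.eq_integral x hx, hg.eq_integral x hx]
    ring

lemma IsPrim.const_mul (c : ℝ) {f f' : ℝ → ℝ} (hf : IsPrim f f') :
    IsPrim (fun x => c * f x) (fun x => c * f' x) where
  sqInt := hf.sqInt.const_mul c
  eq_integral x hx := by
    rw [intervalIntegral.integral_const_mul, hf.eq_integral x hx]
    ring

lemma IsPrim.sub {f f' g g' : ℝ → ℝ} (hf : IsPrim f f') (hg : IsPrim g g') :
    IsPrim (fun x => f x - g x) (fun x => f' x - g' x) := by
  refine (hf.add (hg.const_mul (-1))).congr (fun x _ => ?_) (fun x _ => ?_) <;> ring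

lemma isPrim_zero : IsPrim (fun _ => 0) (fun _ => 0) where
  sqInt := MemLp.zero
  eq_integral x _ := by simp

lemma IsPrim.sum {ι : Type*} (s : Finset ι) {f f' : ι → ℝ → ℝ}
    (hf : ∀ i ∈ s, IsPrim (f i) (f' i)) :
    IsPrim (fun x => ∑ i ∈ s, f i x) (fun x => ∑ i ∈ s, f' i x) := by
  classical
  induction s using Finset.induction_on with
  | empty => simpa using isPrim_zero
  | insert a s ha ih =>
    simp only [Finset.sum_insert ha]
    exact (hf a (Finset.mem_insert_self _ _)).add
      (ih fun i hi => hf i (Finset.mem_insert_of_mem hi))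

lemma isPrim_of_hasDerivWithinAt {f f' : ℝ → ℝ}
    (h : ∀ x ∈ Set.Icc (0 : ℝ) 1, HasDerivWithinAt f (f' x) (Set.Icc 0 1) x)
    (hf' : ContinuousOn f' (Set.Icc 0 1)) : IsPrim f f' where
  sqInt := sqInt_of_continuousOn hf'
  eq_integral x hx := by
    have hsub : Set.Icc 0 x ⊆ Set.Icc (0 : ℝ) 1 := Set.Icc_subset_Icc_right hx.2
    rw [intervalIntegral.integral_eq_sub_of_hasDeriv_right_of_le hx.1
      (fun y hy => (h y (hsub hy)).continuousWithinAt.mono hsub) (f' := f')]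
    · ring
    · intro y hy
      refine (h y (hsub (Set.Ioo_subset_Icc_self hy))).mono_of_mem_nhdsWithin ?_
      exact mem_nhdsWithin_of_mem_nhds (Icc_mem_nhds hy.1 (hy.2.trans_le hx.2))
    · exact (sqInt_of_continuousOn hf').intervalIntegrable' hx

lemma isPrim_of_hasDerivAt {f f' : ℝ → ℝ} (h : ∀ x, HasDerivAt f (f' x) x)
    (hf' : Continuous f') : IsPrim f f' :=
  isPrim_of_hasDerivWithinAt (fun x _ => (h x).hasDerivWithinAt) hf'.continuousOn

/-- Integration by parts. -/
lemma IsPrim.integral_mul {f f' g g' : ℝ → ℝ} (hf : IsPrim f f') (hg : IsPrim g g') {x : ℝ}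
    (hx : x ∈ Set.Icc (0 : ℝ) 1) :
    ∫ y in (0 : ℝ)..x, f y * g' y = f x * g x - f 0 * g 0 - ∫ y in (0 : ℝ)..x, f' y * g y := by
  have hac : ∀ {u u' : ℝ → ℝ}, IsPrim u u' →
      AbsolutelyContinuousOnInterval (fun x => u 0 + ∫ y in (0 : ℝ)..x, u' y) 0 x := fun h =>
    ((LipschitzWith.const (α := ℝ) _).lipschitzOnWith.absolutelyContinuousOnInterval).fun_add
      ((h.sqInt.intervalIntegrable' hx).absolutelyContinuousOnInterval_intervalIntegral (by simp))
  have hd : ∀ {u u' : ℝ → ℝ}, IsPrim u u' →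
      ∀ᵐ y, y ∈ Set.uIoc 0 x → deriv (fun x => u 0 + ∫ y in (0 : ℝ)..x, u' y) y = u' y := by
    intro u u' h
    filter_upwards [(h.sqInt.intervalIntegrable' hx).ae_hasDerivAt_integral] with y hy hyx
    exact ((hy (Set.uIoc_subset_uIcc hyx) 0 (by simp)).const_add (u 0)).deriv
  have heq : ∀ {u u' : ℝ → ℝ}, IsPrim u u' → ∀ y ∈ Set.uIoc 0 x,
      u 0 + ∫ y in (0 : ℝ)..y, u' y = u y := by
    intro u u' h y hy
    rw [Set.uIoc_of_le hx.1] at hy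
    exact (h.eq_integral y ⟨hy.1.le, hy.2.trans hx.2⟩).symm
  have key := (hac hf).integral_mul_deriv_eq_deriv_mul (hac hg)
  rw [← hf.eq_integral x hx, ← hg.eq_integral x hx] at key
  simp only [intervalIntegral.integral_same, add_zero] at key
  rw [intervalIntegral.integral_congr_ae (g := fun y => f y * g' y),
    intervalIntegral.integral_congr_ae (f := fun y => deriv _ y * _)
      (g := fun y => f' y * g y)] at key
  · exact key
  · filter_upwards [hd hf] with y hy hyx
    rw [hy hyx, heq hg y hyx]
  · filter_upwards [hd hg] with y hy hyx
    rw [hy hyx, heq hf y hyx]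

/-- Integration by parts on `[0,1]`, as an identity of inner products. -/
lemma IsPrim.inner_eq {f f' g g' : ℝ → ℝ} (hf : IsPrim f f') (hg : IsPrim g g') :
    ⟪toL2 f, toL2 g'⟫ = f 1 * g 1 - f 0 * g 0 - ⟪toL2 f', toL2 g⟫ := by
  rw [inner_toL2 hf.sqInt_self hg.sqInt, inner_toL2 hf.sqInt hg.sqInt_self,
    hf.integral_mul hg (by simp)]

/-- The boundary values of an `H¹` function are continuous functionals of the function and its
derivative. -/
lemma IsPrim.eq_inner_zero {f f' : ℝ → ℝ} (hf : IsPrim f f') :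
    f 0 = ⟪toL2 f, toL2 (fun _ => 1)⟫ + ⟪toL2 f', toL2 (fun y => y - 1)⟫ := by
  have hg : IsPrim (fun y : ℝ => y - 1) (fun _ => 1) :=
    isPrim_of_hasDerivAt (fun x => (hasDerivAt_id x).sub_const 1) continuous_const
  rw [hf.inner_eq hg]; simp

lemma IsPrim.eq_inner_one {f f' : ℝ → ℝ} (hf : IsPrim f f') :
    f 1 = ⟪toL2 f, toL2 (fun _ => 1)⟫ + ⟪toL2 f', toL2 (fun y => y)⟫ := by
  have hg : IsPrim (fun y : ℝ => y) (fun _ => 1) :=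
    isPrim_of_hasDerivAt (fun x => hasDerivAt_id x) continuous_const
  rw [hf.inner_eq hg]; simp

/-- The integral over an initial interval is bounded by the `L²` norm. -/
lemma abs_integral_mul_le {f g : ℝ → ℝ} (hf : SqInt f) {C : ℝ} (hC : 0 ≤ C) {x : ℝ}
    (hx : x ∈ Set.Icc (0 : ℝ) 1) (hg : ∀ y ∈ Set.Icc (0 : ℝ) x, |g y| ≤ C) :
    |∫ y in (0 : ℝ)..x, g y * f y| ≤ C * ‖toL2 f‖ := by
  have hone : SqInt (fun _ => (1 : ℝ)) := sqInt_of_continuousOn continuousOn_const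
  have hle : ∫ y in (0 : ℝ)..x, C * |f y| ≤ C * ∫ y in (0 : ℝ)..1, |f y| := by
    rw [intervalIntegral.integral_const_mul]
    refine mul_le_mul_of_nonneg_left ?_ hC
    refine intervalIntegral.integral_mono_interval le_rfl hx.1 hx.2
      (Filter.Eventually.of_forall fun y => abs_nonneg _) hf.intervalIntegrable.abs
  have h1 : |∫ y in (0 : ℝ)..x, g y * f y| ≤ ∫ y in (0 : ℝ)..x, C * |f y| := by
    rw [← Real.norm_eq_abs]
    refine intervalIntegral.norm_integral_le_of_norm_le hx.1 ?_
      ((hf.intervalIntegrable' hx).abs.const_mul C)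
    refine Filter.Eventually.of_forall fun y hy => ?_
    rw [Real.norm_eq_abs, abs_mul]
    exact mul_le_mul_of_nonneg_right (hg y ⟨hy.1.le, hy.2⟩) (abs_nonneg _)
  have h2 : ∫ y in (0 : ℝ)..1, |f y| ≤ ‖toL2 f‖ := by
    have habs : SqInt (fun y => |f y|) := hf.abs
    have h3 : ∫ y in (0 : ℝ)..1, |f y| = ⟪toL2 (fun y => |f y|), toL2 (fun _ => 1)⟫ := by
      rw [inner_toL2 habs hone]; simp
    have h4 : ‖toL2 (fun _ => (1 : ℝ))‖ = 1 := by
      rw [← l2norm_eq_norm hone, l2norm]; simp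
    have h5 : ‖toL2 (fun y => |f y|)‖ = ‖toL2 f‖ := by
      rw [← l2norm_eq_norm hf, ← l2norm_eq_norm habs, l2norm, l2norm]; simp
    rw [h3]
    refine (real_inner_le_norm _ _).trans ?_
    rw [h4, h5, mul_one]
  exact h1.trans (hle.trans (mul_le_mul_of_nonneg_left h2 hC))

lemma norm_toL2_le_of_bound {f : ℝ → ℝ} (hf : SqInt f) {C : ℝ} (hC : 0 ≤ C)
    (h : ∀ x ∈ Set.Icc (0 : ℝ) 1, |f x| ≤ C) : ‖toL2 f‖ ≤ C := by
  rw [← l2norm_eq_norm hf, l2norm]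
  refine Real.sqrt_le_iff.2 ⟨hC, ?_⟩
  have : ∫ x in (0 : ℝ)..1, f x ^ 2 ≤ ∫ _x in (0 : ℝ)..1, C ^ 2 := by
    refine intervalIntegral.integral_mono_on zero_le_one ?_ (by simp) fun x hx => ?_
    · rw [intervalIntegrable_iff_integrableOn_Icc_of_le zero_le_one]
      exact hf.integrable_sq
    · exact sq_le_sq' (by linarith [(abs_le.1 (h x hx)).1]) (abs_le.1 (h x hx)).2
  simpa using this

/-- The bound of an `H¹` function by its value at `0` and its derivative. -/
lemma IsPrim.abs_le {f f' : ℝ → ℝ} (hf : IsPrim f f') {x : ℝ} (hx : x ∈ Set.Icc (0 : ℝ) 1) :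
    |f x| ≤ |f 0| + ‖toL2 f'‖ := by
  rw [hf.eq_integral x hx]
  refine (abs_add_le _ _).trans (add_le_add le_rfl ?_)
  have := abs_integral_mul_le hf.sqInt zero_le_one hx (g := fun _ => 1) (by simp)
  simpa using this

/-! ### The heat operator with a boundary value at `x = 1` -/

/-- The graph of `f ↦ q f''` on `H²` functions with `f(0) = 0`, together with the derivative and
the value at `1`. -/
def heatGraph (q : ℝ) : Submodule ℝ (L2 × L2 × L2 × ℝ) where
  carrier := {z | ∃ f f1 f2 : ℝ → ℝ, IsPrim f f1 ∧ IsPrim f1 f2 ∧ f 0 = 0 ∧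
    z = (toL2 f, toL2 f1, q • toL2 f2, f 1)}
  zero_mem' := ⟨fun _ => 0, fun _ => 0, fun _ => 0, isPrim_zero, isPrim_zero, rfl, by
    simp only [toL2_zero, smul_zero]; rfl⟩
  add_mem' := by
    rintro _ _ ⟨f, f1, f2, hf, hf1, hf0, rfl⟩ ⟨g, g1, g2, hg, hg1, hg0, rfl⟩
    refine ⟨_, _, _, hf.add hg, hf1.add hg1, by simp [hf0, hg0], ?_⟩
    rw [toL2_add hf.sqInt_self hg.sqInt_self, toL2_add hf.sqInt hg.sqInt,
      toL2_add hf1.sqInt hg1.sqInt]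
    simp
  smul_mem' := by
    rintro c _ ⟨f, f1, f2, hf, hf1, hf0, rfl⟩
    refine ⟨_, _, _, hf.const_mul c, hf1.const_mul c, by simp [hf0], ?_⟩
    rw [toL2_const_mul c hf.sqInt_self, toL2_const_mul c hf.sqInt, toL2_const_mul c hf1.sqInt]
    simp [smul_comm c q]

lemma heatGraph_green {q : ℝ} {h h1 h2 k k1 k2 : L2} (hh : (h, h1, h2, (0 : ℝ)) ∈ heatGraph q)
    (hk : (k, k1, k2, (0 : ℝ)) ∈ heatGraph q) : ⟪h, k2⟫ = -q * ⟪h1, k1⟫ := by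
  obtain ⟨f, f1, f2, hf, hf1, hf0, he⟩ := hh
  obtain ⟨g, g1, g2, hg, hg1, hg0, he'⟩ := hk
  simp only [Prod.mk.injEq] at he he'
  obtain ⟨rfl, rfl, rfl, hf'⟩ := he
  obtain ⟨rfl, rfl, rfl, hg'⟩ := he'
  rw [inner_smul_right, hf.inner_eq hg1, ← hf', hf0]
  ring

lemma heatGraph_poincare {q : ℝ} {h h1 h2 : L2} (hh : (h, h1, h2, (0 : ℝ)) ∈ heatGraph q) :
    ‖h‖ ≤ ‖h1‖ := by
  obtain ⟨f, f1, f2, hf, hf1, hf0, he⟩ := hh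
  simp only [Prod.mk.injEq] at he
  obtain ⟨rfl, rfl, rfl, hf'⟩ := he
  refine norm_toL2_le_of_bound hf.sqInt_self (norm_nonneg _) fun x hx => ?_
  simpa [hf0] using hf.abs_le hx

/-- Monomials of high degree are lifts of the boundary value `1` with small `L²` norm. -/
lemma heatGraph_lift (q : ℝ) {ε : ℝ} (hε : 0 < ε) :
    ∃ l l1 l2 : L2, (l, l1, l2, (1 : ℝ)) ∈ heatGraph q ∧ ‖l‖ ≤ ε := by
  obtain ⟨k, hk⟩ := exists_nat_gt (1 / ε ^ 2)
  have hp : ∀ j : ℕ, IsPrim (fun x : ℝ => x ^ (j + 1)) (fun x => ((j + 1 : ℕ) : ℝ) * x ^ j) :=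
    fun j => isPrim_of_hasDerivAt (fun x => by simpa using hasDerivAt_pow (j + 1) x)
      (by fun_prop)
  have hmem : (toL2 (fun x => x ^ (k + 1 + 1)), _, _, (1 : ℝ) ^ (k + 1 + 1)) ∈ heatGraph q :=
    ⟨_, _, _, hp (k + 1), (hp k).const_mul ((k + 1 + 1 : ℕ) : ℝ), by simp, rfl⟩
  rw [one_pow] at hmem
  refine ⟨_, _, _, hmem, ?_⟩
  rw [← l2norm_eq_norm (hp _).sqInt_self, l2norm]
  refine Real.sqrt_le_iff.2 ⟨hε.le, ?_⟩
  simp only [← pow_mul]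
  rw [integral_pow]
  have h1 : 1 / ε ^ 2 ≤ (((k + 1 + 1) * 2 : ℕ) : ℝ) + 1 := by push_cast; linarith
  rw [div_le_iff₀ (by positivity)] at h1
  rw [div_le_iff₀ (by positivity)]
  push_cast at h1
  simp
  linarith

end SandwichedHeat

namespace SandwichedHeat

open MeasureTheory
open scoped RealInnerProductSpace

/-! ### Time derivatives of the spatial derivatives -/

lemma MemH.isPrim {k : ℕ} {f : ℝ → ℝ} (hf : MemH k f) {i : ℕ} (hi : i < k) :
    IsPrim (der i f) (der (i + 1) f) where
  sqInt := hf.2 (i + 1) hi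
  eq_integral x hx := by
    have hac := (hf.1 i hi).mono (c := 0) (d := x) (by
      rw [Set.uIcc_of_le hx.1, Set.uIcc_of_le zero_le_one]; exact Set.Icc_subset_Icc_right hx.2)
    have h1 : ∫ y in (0 : ℝ)..x, der (i + 1) f y = ∫ y in (0 : ℝ)..x, deriv (der i f) y := by
      refine intervalIntegral.integral_congr_ae ?_
      have hne : ∀ᵐ y : ℝ, y ≠ 1 := by simp [ae_iff, measure_singleton]
      filter_upwards [hne] with y hy hyx
      rw [Set.uIoc_of_le hx.1] at hyx
      have hy1 : y < 1 := lt_of_le_of_ne (hyx.2.trans hx.2) hy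
      rw [der, iteratedDerivWithin_succ, derivWithin_of_mem_nhds (Icc_mem_nhds hyx.1 hy1)]
      rfl
    rw [h1, hac.integral_deriv_eq_sub]
    ring

/-- An element of `L²(0,1)` that is orthogonal to all test functions vanishes. -/
lemma eq_zero_of_inner_test_eq_zero (F : L2)
    (h : ∀ φ φ' : ℝ → ℝ, IsPrim φ φ' → IsPrim φ' (deriv φ') → φ 0 = 0 → φ 1 = 0 →
      ⟪F, toL2 φ⟫ = 0) : F = 0 := by
  have hF : SqInt F := Lp.memLp F
  have hint : IntegrableOn F (Set.Icc (0 : ℝ) 1) volume := hF.integrable (by norm_num)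
  have hloc : LocallyIntegrableOn F (Set.Ioo (0 : ℝ) 1) volume :=
    (hint.mono_set Set.Ioo_subset_Icc_self).locallyIntegrableOn
  have key := isOpen_Ioo.ae_eq_zero_of_integral_contDiff_smul_eq_zero hloc fun g hg hgc hgs => by
    have hg2 : ContDiff ℝ 2 g := contDiff_infty.1 hg 2
    have hd1 : ContDiff ℝ 1 (deriv g) := by
      have : ContDiff ℝ (1 + 1) g := by simpa [one_add_one_eq_two] using hg2
      exact (contDiff_succ_iff_deriv.1 this).2.2
    have hp1 : IsPrim g (deriv g) := isPrim_of_hasDerivAt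
      (fun x => (hg2.differentiable (by norm_num) x).hasDerivAt) hd1.continuous
    have hp2 : IsPrim (deriv g) (deriv (deriv g)) := isPrim_of_hasDerivAt
      (fun x => (hd1.differentiable (by norm_num) x).hasDerivAt) (hd1.continuous_deriv le_rfl)
    have hz : ∀ x, x ∉ Set.Ioo (0 : ℝ) 1 → g x = 0 := fun x hx =>
      image_eq_zero_of_notMem_tsupport fun hx' => hx (hgs hx')
    have h1 := h g (deriv g) hp1 hp2 (hz 0 (by simp)) (hz 1 (by simp))
    have hFeq : F = toL2 F := by rw [toL2_of_sqInt hF, Lp.toLp_coeFn]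
    rw [hFeq, inner_toL2 hF hp1.sqInt_self, intervalIntegral.integral_of_le zero_le_one,
      ← integral_Icc_eq_integral_Ioc] at h1
    refine Eq.trans ?_ h1
    rw [← integral_indicator measurableSet_Icc]
    refine integral_congr_ae (Filter.Eventually.of_forall fun x => ?_)
    by_cases hx : x ∈ Set.Icc (0 : ℝ) 1
    · simp [hx, mul_comm]
    · have : g x = 0 := hz x fun hx' => hx (Set.Ioo_subset_Icc_self hx')
      simp [hx, this]
  rw [Lp.eq_zero_iff_ae_eq_zero, Filter.EventuallyEq, ae_restrict_iff' measurableSet_Icc]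
  have hne0 : ∀ᵐ y : ℝ, y ≠ 0 := by simp [ae_iff, measure_singleton]
  have hne1 : ∀ᵐ y : ℝ, y ≠ 1 := by simp [ae_iff, measure_singleton]
  filter_upwards [key, hne0, hne1] with x hx h0 h1 hxI
  exact hx ⟨lt_of_le_of_ne hxI.1 h0.symm, lt_of_le_of_ne hxI.2 h1⟩

/-- A curve in `L²(0,1)` that is weakly differentiable with a continuous derivative is
differentiable. -/
lemma hasDerivWithinAt_of_test {V G : ℝ → L2} (hG : ContinuousOn G (Set.Ici 0))
    (h : ∀ φ φ' : ℝ → ℝ, IsPrim φ φ' → IsPrim φ' (deriv φ') → φ 0 = 0 → φ 1 = 0 →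
      ∀ t, 0 ≤ t → HasDerivWithinAt (fun t => ⟪V t, toL2 φ⟫) ⟪G t, toL2 φ⟫ (Set.Ici 0) t)
    {t : ℝ} (ht : 0 ≤ t) : HasDerivWithinAt V (G t) (Set.Ici 0) t := by
  set G' : ℝ → L2 := fun s => G (max s 0) with hG'
  have hG'c : Continuous G' := hG.comp_continuous (by fun_prop) fun s => le_max_right s 0
  set Q : ℝ → L2 := fun s => V 0 + ∫ r in (0 : ℝ)..s, G' r with hQ
  have hQd : ∀ s, HasDerivAt Q (G' s) s := fun s =>
    (hG'c.integral_hasStrictDerivAt 0 s).hasDerivAt.const_add (V 0)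
  have hQV : ∀ s, 0 ≤ s → V s = Q s := fun s hs => by
    rw [← sub_eq_zero]
    refine eq_zero_of_inner_test_eq_zero _ fun φ φ' h1 h2 h3 h4 => ?_
    have hd : ∀ r, 0 ≤ r → HasDerivWithinAt (fun r => ⟪V r - Q r, toL2 φ⟫) 0 (Set.Ici 0) r := by
      intro r hr
      have e1 := h φ φ' h1 h2 h3 h4 r hr
      have e2 := ((hQd r).inner ℝ (hasDerivAt_const r (toL2 φ))).hasDerivWithinAt (s := Set.Ici 0)
      have e3 := e1.sub e2
      have e4 : G' r = G r := by simp [hG', hr]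
      simp only [e4, inner_zero_right, zero_add, sub_self] at e3
      refine e3.congr_of_eventuallyEq (Filter.Eventually.of_forall fun r => ?_) ?_ <;>
        simp [inner_sub_left]
    have hconst := constant_of_has_deriv_right_zero (a := 0) (b := s)
      (f := fun r => ⟪V r - Q r, toL2 φ⟫)
      (fun r hr => ((hd r hr.1).continuousWithinAt).mono Set.Icc_subset_Ici_self)
      (fun r hr => (hd r hr.1).mono (Set.Ici_subset_Ici.2 hr.1)) s ⟨hs, le_rfl⟩
    rw [hconst]
    simp [hQ]
  have hGt : G' t = G t := by simp [hG', ht]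
  rw [← hGt]
  exact (hQd t).hasDerivWithinAt.congr (fun s hs => hQV s hs) (hQV t ht)

section Curve

variable {k : ℕ} {v : ℝ → ℝ → ℝ} {q : ℝ}

lemma ContinuousInH.sqInt (hv : ContinuousInH k v) {t : ℝ} (ht : 0 ≤ t) {i : ℕ} (hi : i ≤ k) :
    SqInt (der i (fun x => v x t)) := (hv.1 t ht).2 i hi

lemma ContinuousInH.continuousOn (hv : ContinuousInH k v) {i : ℕ} (hi : i ≤ k) :
    ContinuousOn (fun t => toL2 (der i (fun x => v x t))) (Set.Ici 0) := by
  intro t ht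
  rw [ContinuousWithinAt, tendsto_iff_norm_sub_tendsto_zero]
  refine (hv.2 t ht i hi).congr' ?_
  filter_upwards [self_mem_nhdsWithin] with s hs
  rw [← toL2_sub (hv.sqInt hs hi) (hv.sqInt ht hi),
    l2norm_eq_norm ((hv.sqInt hs hi).sub' (hv.sqInt ht hi))]

lemma HasL2TimeDeriv.hasDerivWithinAt (hv : ContinuousInH k v) (hk : 2 ≤ k)
    (hd : HasL2TimeDeriv v (fun x t => q * der 2 (fun ξ => v ξ t) x)) {t : ℝ} (ht : 0 ≤ t) :
    HasDerivWithinAt (fun t => toL2 (der 0 (fun x => v x t)))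
      (q • toL2 (der 2 (fun x => v x t))) (Set.Ici 0) t := by
  rw [hasDerivWithinAt_iff_tendsto_slope, tendsto_iff_norm_sub_tendsto_zero]
  refine (hd t ht).congr' ?_
  filter_upwards [self_mem_nhdsWithin] with s hs
  have h0 : ∀ s, 0 ≤ s → SqInt (der 0 (fun x => v x s)) := fun s hs => hv.sqInt hs (by omega)
  have h2 : SqInt (der 2 (fun x => v x t)) := hv.sqInt ht hk
  have e1 : ∀ x, (v x s - v x t) / (s - t) - q * der 2 (fun ξ => v ξ t) x =
      (s - t)⁻¹ * (der 0 (fun x => v x s) x - der 0 (fun x => v x t) x) -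
        q * der 2 (fun ξ => v ξ t) x := fun x => by
    simp [der]; ring
  have h3 := ((h0 s hs.1).sub' (h0 t ht)).const_mul' (s - t)⁻¹
  have h4 := h2.const_mul' q
  simp only [e1]
  rw [l2norm_eq_norm (h3.sub' h4), toL2_sub h3 h4,
    toL2_const_mul (s - t)⁻¹ ((h0 s hs.1).sub' (h0 t ht)), toL2_sub (h0 s hs.1) (h0 t ht),
    toL2_const_mul q h2, slope_def_module]

/-- For a solution of the heat equation in `C([0,∞); H^k)`, the spatial derivatives of order at
most `k - 2` are differentiable in time. -/
lemma HasL2TimeDeriv.hasDerivWithinAt_der (hv : ContinuousInH k v)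
    (hd : HasL2TimeDeriv v (fun x t => q * der 2 (fun ξ => v ξ t) x)) {i : ℕ} (hi : i + 2 ≤ k)
    {t : ℝ} (ht : 0 ≤ t) :
    HasDerivWithinAt (fun t => toL2 (der i (fun x => v x t)))
      (q • toL2 (der (i + 2) (fun x => v x t))) (Set.Ici 0) t := by
  induction i generalizing t with
  | zero => exact hd.hasDerivWithinAt hv hi ht
  | succ i ih =>
    refine hasDerivWithinAt_of_test (G := fun t => q • toL2 (der (i + 1 + 2) (fun x => v x t)))
      ((hv.continuousOn hi).const_smul q) ?_ ht
    intro φ φ' h1 h2 h3 h4 s hs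
    have e1 : ∀ s, 0 ≤ s → ∀ j, j < k → ⟪toL2 (der (j + 1) (fun x => v x s)), toL2 φ⟫ =
        -⟪toL2 (der j (fun x => v x s)), toL2 φ'⟫ := fun s hs j hj => by
      have := ((hv.1 s hs).isPrim hj).inner_eq h1
      rw [h3, h4] at this
      linarith
    have e2 := ((ih (by omega) hs).inner ℝ (hasDerivWithinAt_const s (Set.Ici 0) (toL2 φ'))).neg
    rw [inner_zero_right, zero_add, inner_smul_left] at e2
    rw [inner_smul_left, show i + 1 + 2 = (i + 2) + 1 by ring, e1 s hs (i + 2) (by omega),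
      mul_neg]
    exact e2.congr (fun r hr => e1 r hr i (by omega)) (e1 s hs i (by omega))

end Curve

end SandwichedHeat

namespace SandwichedHeat

open MeasureTheory
open scoped RealInnerProductSpace

/-! ### Linear systems in the space variable -/

lemma IsPrim.mul {f f' g g' : ℝ → ℝ} (hf : IsPrim f f') (hg : IsPrim g g') :
    IsPrim (fun x => f x * g x) (fun x => f' x * g x + f x * g' x) where
  sqInt := by
    have h1 := hf.sqInt.mul_continuousOn hg.continuousOn
    have h2 : SqInt (fun x => f x * g' x) :=
      (hg.sqInt.mul_continuousOn hf.continuousOn).congr fun x _ => mul_comm _ _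
    exact h1.add' h2
  eq_integral x hx := by
    have h1 := hf.sqInt.mul_continuousOn hg.continuousOn
    have h2 : SqInt (fun x => f x * g' x) :=
      (hg.sqInt.mul_continuousOn hf.continuousOn).congr fun x _ => mul_comm _ _
    rw [intervalIntegral.integral_add (h1.intervalIntegrable' hx) (h2.intervalIntegrable' hx),
      hf.integral_mul hg hx]
    ring

lemma IsPrim.hasDerivWithinAt {f f' : ℝ → ℝ} (hf : IsPrim f f')
    (hc : ContinuousOn f' (Set.Icc 0 1)) {x : ℝ} (hx : x ∈ Set.Icc (0 : ℝ) 1) :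
    HasDerivWithinAt f (f' x) (Set.Icc 0 1) x := by
  have : Fact (x ∈ Set.Icc (0 : ℝ) 1) := ⟨hx⟩
  have h1 : HasDerivWithinAt (fun u => ∫ y in (0 : ℝ)..u, f' y) (f' x) (Set.Icc 0 1) x :=
    intervalIntegral.integral_hasDerivWithinAt_right (hf.sqInt.intervalIntegrable' hx)
      (hc.stronglyMeasurableAtFilter_nhdsWithin measurableSet_Icc x) (hc x hx)
  exact (h1.const_add (f 0)).congr (fun y hy => hf.eq_integral y hy) (hf.eq_integral x hx)

/-- The derivatives of a function are read off from a chain of primitives. -/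
lemma der_eq_of_isPrim {G : ℕ → ℝ → ℝ} {N : ℕ} (h : ∀ i < N, IsPrim (G i) (G (i + 1)))
    (hc : ContinuousOn (G N) (Set.Icc 0 1)) {i : ℕ} (hi : i ≤ N) {x : ℝ}
    (hx : x ∈ Set.Icc (0 : ℝ) 1) : der i (G 0) x = G i x := by
  induction i generalizing x with
  | zero => simp [der]
  | succ i ih =>
    have hcont : ContinuousOn (G (i + 1)) (Set.Icc 0 1) := by
      rcases eq_or_lt_of_le hi with h1 | h1
      · rw [h1]; exact hc
      · exact (h (i + 1) h1).continuousOn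
    have hd := (h i hi).hasDerivWithinAt hcont hx
    rw [der, iteratedDerivWithin_succ]
    have := hd.congr (f₁ := iteratedDerivWithin i (G 0) (Set.Icc 0 1))
      (fun y hy => ih (by omega) hy) (ih (by omega) hx)
    exact this.derivWithin (uniqueDiffOn_Icc zero_lt_one x hx)

section Exp

attribute [local instance] Matrix.linftyOpNormedRing Matrix.linftyOpNormedAlgebra

variable {ι : Type*} [Fintype ι] [DecidableEq ι]

lemma hasDerivAt_exp_mulVec (D : Matrix ι ι ℝ) (v : ι → ℝ) (x : ℝ) :
    HasDerivAt (fun x : ℝ => NormedSpace.exp (x • D) *ᵥ v)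
      (NormedSpace.exp (x • D) *ᵥ (D *ᵥ v)) x := by
  have h := hasDerivAt_exp_smul_const (𝕂 := ℝ) D x
  have hL : IsLinearMap ℝ (fun M : Matrix ι ι ℝ => M *ᵥ v) :=
    ⟨fun M N => Matrix.add_mulVec M N v, fun c M => Matrix.smul_mulVec c M v⟩
  have := (LinearMap.toContinuousLinearMap hL.mk').hasFDerivAt.comp_hasDerivAt x h
  rw [Matrix.mulVec_mulVec]
  exact this

lemma hasDerivAt_exp_entry (D : Matrix ι ι ℝ) (a c : ι) (x : ℝ) :
    HasDerivAt (fun x : ℝ => NormedSpace.exp (x • D) a c)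
      ((D * NormedSpace.exp (x • D)) a c) x := by
  have h := hasDerivAt_exp_smul_const' (𝕂 := ℝ) D x
  have hL : IsLinearMap ℝ (fun M : Matrix ι ι ℝ => M a c) := ⟨fun M N => rfl, fun c M => rfl⟩
  exact (LinearMap.toContinuousLinearMap hL.mk').hasFDerivAt.comp_hasDerivAt x h

lemma continuous_exp_entry (D : Matrix ι ι ℝ) (a c : ι) :
    Continuous fun x : ℝ => NormedSpace.exp (x • D) a c :=
  continuous_iff_continuousAt.2 fun x => (hasDerivAt_exp_entry D a c x).continuousAt

lemma exp_smul_mul_exp_smul (D : Matrix ι ι ℝ) (x y : ℝ) :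
    NormedSpace.exp (x • D) * NormedSpace.exp (y • D) = NormedSpace.exp ((x + y) • D) := by
  rw [add_smul, Matrix.exp_add_of_commute]
  exact ((Commute.refl D).smul_left x).smul_right y

lemma exp_zero_smul (D : Matrix ι ι ℝ) : NormedSpace.exp ((0 : ℝ) • D) = 1 := by
  rw [zero_smul, NormedSpace.exp_zero]

lemma exp_smul_mul_neg (D : Matrix ι ι ℝ) (x : ℝ) :
    NormedSpace.exp (x • D) * NormedSpace.exp ((-x) • D) = 1 := by
  rw [exp_smul_mul_exp_smul, add_neg_cancel, exp_zero_smul]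

/-- The solution of `ξ' = D ξ + f b`, `ξ(0) = x₀`, by variation of constants. -/
def ltiSol (D : Matrix ι ι ℝ) (b x₀ : ι → ℝ) (f : ℝ → ℝ) (x : ℝ) : ι → ℝ := fun a =>
  (NormedSpace.exp (x • D) *ᵥ x₀) a +
    ∫ y in (0 : ℝ)..x, (NormedSpace.exp ((x - y) • D) *ᵥ b) a * f y

/-- The derivatives of `ltiSol` for an input `F 0` with derivatives `F 1, F 2, …`. -/
def ltiDer (D : Matrix ι ι ℝ) (b x₀ : ι → ℝ) (F : ℕ → ℝ → ℝ) : ℕ → ℝ → ι → ℝ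
  | 0 => ltiSol D b x₀ (F 0)
  | i + 1 => fun x => D *ᵥ ltiDer D b x₀ F i x + F i x • b

variable (D : Matrix ι ι ℝ) (b : ι → ℝ)

lemma continuous_exp_mulVec (v : ι → ℝ) (a : ι) :
    Continuous fun x : ℝ => (NormedSpace.exp (x • D) *ᵥ v) a :=
  continuous_iff_continuousAt.2 fun x =>
    ((hasDerivAt_pi.1 (hasDerivAt_exp_mulVec D v x)) a).continuousAt

lemma ltiSol_eq (x₀ : ι → ℝ) {f : ℝ → ℝ} (hf : SqInt f) {x : ℝ} (hx : x ∈ Set.Icc (0 : ℝ) 1) :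
    ltiSol D b x₀ f x = NormedSpace.exp (x • D) *ᵥ
      fun c => x₀ c + ∫ y in (0 : ℝ)..x, (NormedSpace.exp ((-y) • D) *ᵥ b) c * f y := by
  funext a
  have hint : ∀ c, IntervalIntegrable (fun y => (NormedSpace.exp ((-y) • D) *ᵥ b) c * f y)
      volume 0 x := fun c => by
    have := hf.mul_continuousOn (g := fun y => (NormedSpace.exp ((-y) • D) *ᵥ b) c)
      ((continuous_exp_mulVec D b c).comp continuous_neg).continuousOn
    exact (this.congr fun y _ => mul_comm _ _).intervalIntegrable' hx
  have h1 : ∀ y, (NormedSpace.exp ((x - y) • D) *ᵥ b) a * f y =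
      ∑ c, NormedSpace.exp (x • D) a c * ((NormedSpace.exp ((-y) • D) *ᵥ b) c * f y) := fun y => by
    rw [sub_eq_add_neg, ← exp_smul_mul_exp_smul, ← Matrix.mulVec_mulVec]
    simp only [Matrix.mulVec, dotProduct, Finset.sum_mul, mul_assoc]
  have h2 : (NormedSpace.exp (x • D) *ᵥ
      fun c => x₀ c + ∫ y in (0 : ℝ)..x, (NormedSpace.exp ((-y) • D) *ᵥ b) c * f y) =
      NormedSpace.exp (x • D) *ᵥ x₀ + NormedSpace.exp (x • D) *ᵥ
        fun c => ∫ y in (0 : ℝ)..x, (NormedSpace.exp ((-y) • D) *ᵥ b) c * f y := by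
    rw [← Matrix.mulVec_add]; rfl
  rw [h2, Pi.add_apply, ltiSol]
  congr 1
  simp only [h1]
  rw [intervalIntegral.integral_finsetSum fun c _ => (hint c).const_mul _]
  simp only [Matrix.mulVec, dotProduct, intervalIntegral.integral_const_mul]

lemma ltiSol_zero (x₀ : ι → ℝ) (f : ℝ → ℝ) : ltiSol D b x₀ f 0 = x₀ := by
  funext a
  simp [ltiSol]

lemma isPrim_exp_entry (a c : ι) : IsPrim (fun x : ℝ => NormedSpace.exp (x • D) a c)
    (fun x => (D * NormedSpace.exp (x • D)) a c) := by
  refine isPrim_of_hasDerivAt (hasDerivAt_exp_entry D a c) ?_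
  simp only [Matrix.mul_apply]
  exact continuous_finsetSum _ fun d _ => continuous_const.mul (continuous_exp_entry D d c)

lemma isPrim_ltiSol (x₀ : ι → ℝ) {f : ℝ → ℝ} (hf : SqInt f) (a : ι) :
    IsPrim (fun x => ltiSol D b x₀ f x a) (fun x => (D *ᵥ ltiSol D b x₀ f x + f x • b) a) := by
  have hJ : ∀ c, IsPrim
      (fun x => x₀ c + ∫ y in (0 : ℝ)..x, (NormedSpace.exp ((-y) • D) *ᵥ b) c * f y)
      (fun x => (NormedSpace.exp ((-x) • D) *ᵥ b) c * f x) := fun c =>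
    { sqInt := (hf.mul_continuousOn (g := fun y => (NormedSpace.exp ((-y) • D) *ᵥ b) c)
        ((continuous_exp_mulVec D b c).comp continuous_neg).continuousOn).congr
        fun y _ => mul_comm _ _
      eq_integral := fun x _ => by simp }
  refine (IsPrim.sum Finset.univ fun c _ => (isPrim_exp_entry D a c).mul (hJ c)).congr
    (fun x hx => ?_) (fun x hx => ?_)
  · rw [ltiSol_eq D b x₀ hf hx]; rfl
  · rw [ltiSol_eq D b x₀ hf hx, Finset.sum_add_distrib, Matrix.mulVec_mulVec, Pi.add_apply]
    congr 1
    have h1 : ∑ c, NormedSpace.exp (x • D) a c * ((NormedSpace.exp ((-x) • D) *ᵥ b) c * f x) =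
        (NormedSpace.exp (x • D) *ᵥ (NormedSpace.exp ((-x) • D) *ᵥ b)) a * f x := by
      simp only [Matrix.mulVec, dotProduct, Finset.sum_mul, mul_assoc]
    rw [h1, Matrix.mulVec_mulVec, exp_smul_mul_neg, Matrix.one_mulVec]
    simp [mul_comm]

/-- Uniqueness for `ξ' = D ξ + f b`. -/
lemma eq_ltiSol {ξ : ℝ → ι → ℝ} {f : ℝ → ℝ} (hf : SqInt f)
    (hξ : ∀ a, IsPrim (fun x => ξ x a) (fun x => (D *ᵥ ξ x + f x • b) a)) {x : ℝ}
    (hx : x ∈ Set.Icc (0 : ℝ) 1) : ξ x = ltiSol D b (ξ 0) f x := by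
  have hneg : ∀ a c, IsPrim (fun x : ℝ => NormedSpace.exp ((-x) • D) a c)
      (fun x => -(NormedSpace.exp ((-x) • D) * D) a c) := fun a c => by
    have h := isPrim_exp_entry (-D) a c
    refine h.congr (fun y _ => by simp) fun y _ => ?_
    have hcomm : D * NormedSpace.exp ((-y) • D) = NormedSpace.exp ((-y) • D) * D :=
      ((Commute.refl D).smul_right (-y)).exp_right.eq
    rw [smul_neg, ← neg_smul, Matrix.neg_mul, hcomm, Matrix.neg_apply]
  have key : ∀ a, (NormedSpace.exp ((-x) • D) *ᵥ ξ x) a =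
      ξ 0 a + ∫ y in (0 : ℝ)..x, (NormedSpace.exp ((-y) • D) *ᵥ b) a * f y := fun a => by
    have h1 := IsPrim.sum Finset.univ fun c _ => (hneg a c).mul (hξ c)
    have h2 := h1.eq_integral x hx
    have h3 : ∀ y, ∑ c, (-(NormedSpace.exp ((-y) • D) * D) a c * ξ y c +
        NormedSpace.exp ((-y) • D) a c * (D *ᵥ ξ y + f y • b) c) =
        (NormedSpace.exp ((-y) • D) *ᵥ b) a * f y := fun y => by
      have e1 : ∑ c, (-(NormedSpace.exp ((-y) • D) * D) a c * ξ y c +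
          NormedSpace.exp ((-y) • D) a c * (D *ᵥ ξ y + f y • b) c) =
          -((NormedSpace.exp ((-y) • D) * D) *ᵥ ξ y) a +
            (NormedSpace.exp ((-y) • D) *ᵥ (D *ᵥ ξ y + f y • b)) a := by
        simp only [Matrix.mulVec, dotProduct, Finset.sum_add_distrib, neg_mul,
          Finset.sum_neg_distrib]
      rw [e1, Matrix.mulVec_add, Matrix.mulVec_mulVec, Matrix.mulVec_smul]
      simp [mul_comm]
    simp only [h3] at h2
    have h4 : ∑ c, NormedSpace.exp ((-(0 : ℝ)) • D) a c * ξ 0 c = ξ 0 a := by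
      rw [neg_zero, exp_zero_smul]
      simp [Matrix.one_apply]
    rw [h4] at h2
    exact h2
  rw [ltiSol_eq D b _ hf hx, ← (funext key : _ = fun c => _), Matrix.mulVec_mulVec,
    exp_smul_mul_neg, Matrix.one_mulVec]

variable {D b}

lemma isPrim_ltiDer {x₀ : ι → ℝ} {F : ℕ → ℝ → ℝ} {k : ℕ} (h0 : SqInt (F 0))
    (hF : ∀ i < k, IsPrim (F i) (F (i + 1))) {i : ℕ} (hi : i ≤ k) (a : ι) :
    IsPrim (fun x => ltiDer D b x₀ F i x a) (fun x => ltiDer D b x₀ F (i + 1) x a) := by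
  induction i generalizing a with
  | zero => exact isPrim_ltiSol D b x₀ h0 a
  | succ i ih =>
    have h1 := (IsPrim.sum Finset.univ fun c _ => (ih (by omega) c).const_mul (D a c)).add
      ((hF i hi).const_mul (b a))
    refine h1.congr (fun x _ => ?_) (fun x _ => ?_) <;>
      simp [ltiDer, Matrix.mulVec, dotProduct, mul_comm]

/-- The second derivative of the solution solves the same system, with the input replaced by its
second derivative. -/
lemma ltiDer_two_eq {x₀ : ι → ℝ} {F : ℕ → ℝ → ℝ} {k : ℕ} (hk : 2 ≤ k) (h0 : SqInt (F 0))
    (hF : ∀ i < k, IsPrim (F i) (F (i + 1))) {x : ℝ} (hx : x ∈ Set.Icc (0 : ℝ) 1) :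
    ltiDer D b x₀ F 2 x =
      ltiSol D b (D *ᵥ (D *ᵥ x₀ + F 0 0 • b) + F 1 0 • b) (F 2) x := by
  have h1 := eq_ltiSol D b (ξ := ltiDer D b x₀ F 2) (hF 1 (by omega)).sqInt
    (fun a => isPrim_ltiDer h0 hF hk a) hx
  rw [h1]
  congr 1
  simp only [ltiDer, ltiSol_zero]

/-- Unrolling the recursion `G (i+1) = D G i + f i b`. -/
lemma recursion_eq_sum {G : ℕ → ι → ℝ} {f : ℕ → ℝ} (h : ∀ i, G (i + 1) = D *ᵥ G i + f i • b)
    (i : ℕ) : G i = (D ^ i) *ᵥ G 0 + ∑ j ∈ Finset.range i, f (i - 1 - j) • ((D ^ j) *ᵥ b) := by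
  induction i with
  | zero => simp
  | succ i ih =>
    rw [h, ih, Matrix.mulVec_add, Matrix.mulVec_mulVec, ← pow_succ', Finset.sum_range_succ',
      Matrix.mulVec_sum]
    have h1 : ∀ j ∈ Finset.range i, D *ᵥ (f (i - 1 - j) • ((D ^ j) *ᵥ b)) =
        f (i + 1 - 1 - (j + 1)) • ((D ^ (j + 1)) *ᵥ b) := fun j hj => by
      rw [Matrix.mulVec_smul, Matrix.mulVec_mulVec, ← pow_succ']
      congr 2; omega
    rw [Finset.sum_congr rfl h1]
    simp [add_assoc]

lemma iteratedDeriv_exp_mulVec (r v : ι → ℝ) (j : ℕ) :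
    iteratedDeriv j (fun x : ℝ => r ⬝ᵥ (NormedSpace.exp (x • D) *ᵥ v)) =
      fun x => r ⬝ᵥ (NormedSpace.exp (x • D) *ᵥ ((D ^ j) *ᵥ v)) := by
  induction j with
  | zero => simp
  | succ j ih =>
    rw [iteratedDeriv_succ, ih]
    funext x
    have h := hasDerivAt_exp_mulVec D ((D ^ j) *ᵥ v) x
    have h2 : HasDerivAt (fun x : ℝ => r ⬝ᵥ (NormedSpace.exp (x • D) *ᵥ ((D ^ j) *ᵥ v)))
        (r ⬝ᵥ (NormedSpace.exp (x • D) *ᵥ (D *ᵥ ((D ^ j) *ᵥ v)))) x := by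
      simp only [dotProduct]
      exact HasDerivAt.fun_sum fun c _ => ((hasDerivAt_pi.1 h) c).const_mul (r c)
    rw [h2.deriv, pow_succ', ← Matrix.mulVec_mulVec v D (D ^ j)]

/-! ### Continuity with respect to the initial value and the input -/

lemma exists_bound_exp_mulVec (D : Matrix ι ι ℝ) (v : ι → ℝ) (a : ι) :
    ∃ C, 0 ≤ C ∧ ∀ x ∈ Set.Icc (0 : ℝ) 1, |(NormedSpace.exp (x • D) *ᵥ v) a| ≤ C := by
  obtain ⟨C, hC⟩ := isCompact_Icc.exists_bound_of_continuousOn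
    (continuous_exp_mulVec D v a).continuousOn (s := Set.Icc (0 : ℝ) 1)
  exact ⟨C, (norm_nonneg _).trans (hC 0 (by simp)), hC⟩

variable (D b)

lemma exists_ltiSol_bound (a : ι) : ∃ C, 0 ≤ C ∧ ∀ (x₀ : ι → ℝ) (f : ℝ → ℝ), SqInt f →
    ∀ x ∈ Set.Icc (0 : ℝ) 1, |ltiSol D b x₀ f x a| ≤ C * (‖x₀‖ + ‖toL2 f‖) := by
  obtain ⟨C, hC0, hC⟩ := exists_bound_exp_mulVec D b a
  choose C' hC0' hC' using fun c : ι => exists_bound_exp_mulVec D (Pi.single c 1) a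
  have hsum : 0 ≤ ∑ c, C' c := Finset.sum_nonneg fun c _ => hC0' c
  refine ⟨C + ∑ c, C' c, by positivity, fun x₀ f hf x hx => ?_⟩
  have h1 : |(NormedSpace.exp (x • D) *ᵥ x₀) a| ≤ (∑ c, C' c) * ‖x₀‖ := by
    rw [Matrix.mulVec, dotProduct, Finset.sum_mul]
    refine (Finset.abs_sum_le_sum_abs _ _).trans (Finset.sum_le_sum fun c _ => ?_)
    rw [abs_mul]
    have := hC' c x hx
    rw [Matrix.mulVec_single_one] at this
    exact mul_le_mul this (norm_le_pi_norm x₀ c) (abs_nonneg _) (hC0' c)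
  have h2 := abs_integral_mul_le hf hC0 hx
    (g := fun y => (NormedSpace.exp ((x - y) • D) *ᵥ b) a)
    fun y hy => hC (x - y) ⟨by linarith [hy.2], by linarith [hy.1, hx.2]⟩
  rw [ltiSol]
  refine (abs_add_le _ _).trans ?_
  have := mul_nonneg hC0 (norm_nonneg x₀)
  have := mul_nonneg hsum (norm_nonneg (toL2 f))
  linarith

lemma ltiSol_congr_ae (x₀ : ι → ℝ) {f g : ℝ → ℝ}
    (h : f =ᵐ[volume.restrict (Set.Icc (0 : ℝ) 1)] g) {x : ℝ} (hx : x ∈ Set.Icc (0 : ℝ) 1) :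
    ltiSol D b x₀ f x = ltiSol D b x₀ g x := by
  funext a
  rw [ltiSol, ltiSol]
  congr 1
  refine intervalIntegral.integral_congr_ae ?_
  filter_upwards [(ae_restrict_iff' measurableSet_Icc).1 h] with y hy hyx
  rw [Set.uIoc_of_le hx.1] at hyx
  rw [hy ⟨hyx.1.le, hyx.2.trans hx.2⟩]

lemma ltiSol_add (x₀ x₁ : ι → ℝ) {f g : ℝ → ℝ} (hf : SqInt f) (hg : SqInt g) {x : ℝ}
    (hx : x ∈ Set.Icc (0 : ℝ) 1) : ltiSol D b (x₀ + x₁) (fun y => f y + g y) x =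
      ltiSol D b x₀ f x + ltiSol D b x₁ g x := by
  rw [ltiSol_eq D b _ (hf.add' hg) hx, ltiSol_eq D b _ hf hx, ltiSol_eq D b _ hg hx,
    ← Matrix.mulVec_add]
  congr 1
  funext c
  have hint : ∀ {f : ℝ → ℝ}, SqInt f →
      IntervalIntegrable (fun y => (NormedSpace.exp ((-y) • D) *ᵥ b) c * f y) volume 0 x := by
    intro f hf
    have := hf.mul_continuousOn (g := fun y => (NormedSpace.exp ((-y) • D) *ᵥ b) c)
      ((continuous_exp_mulVec D b c).comp continuous_neg).continuousOn
    exact (this.congr fun y _ => mul_comm _ _).intervalIntegrable' hx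
  simp only [Pi.add_apply, mul_add]
  rw [intervalIntegral.integral_add (hint hf) (hint hg)]
  ring

lemma ltiSol_smul (s : ℝ) (x₀ : ι → ℝ) (f : ℝ → ℝ) (x : ℝ) :
    ltiSol D b (s • x₀) (fun y => s * f y) x = s • ltiSol D b x₀ f x := by
  funext a
  simp only [ltiSol, Matrix.mulVec_smul, Pi.smul_apply, smul_eq_mul, mul_left_comm _ s,
    intervalIntegral.integral_const_mul]
  ring

/-- `ltiSol` at the point `x ∈ [0,1]` as a continuous functional of the initial value and the
input. -/
lemma exists_ltiEval {x : ℝ} (hx : x ∈ Set.Icc (0 : ℝ) 1) (a : ι) :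
    ∃ L : (ι → ℝ) × L2 →L[ℝ] ℝ, ∀ x₀ f, SqInt f → L (x₀, toL2 f) = ltiSol D b x₀ f x a := by
  obtain ⟨C, hC0, hC⟩ := exists_ltiSol_bound D b a
  have hmem : ∀ F : L2, SqInt F := fun F => Lp.memLp F
  have hself : ∀ F : L2, toL2 F = F := fun F => by
    rw [toL2_of_sqInt (hmem F), Lp.toLp_coeFn]
  refine ⟨LinearMap.mkContinuous ⟨⟨fun z => ltiSol D b z.1 (z.2 : ℝ → ℝ) x a, ?_⟩, ?_⟩ (2 * C) ?_,
    ?_⟩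
  · intro z w
    have h1 : ltiSol D b (z + w).1 ((z + w).2 : ℝ → ℝ) x =
        ltiSol D b (z.1 + w.1) (fun y => (z.2 : ℝ → ℝ) y + (w.2 : ℝ → ℝ) y) x :=
      ltiSol_congr_ae D b _ (Lp.coeFn_add z.2 w.2) hx
    rw [h1, ltiSol_add D b _ _ (hmem _) (hmem _) hx, Pi.add_apply]
  · intro s z
    have h1 : ltiSol D b (s • z).1 ((s • z).2 : ℝ → ℝ) x =
        ltiSol D b (s • z.1) (fun y => s * (z.2 : ℝ → ℝ) y) x :=
      ltiSol_congr_ae D b _ (Lp.coeFn_smul s z.2) hx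
    change ltiSol D b (s • z).1 ((s • z).2 : ℝ → ℝ) x a = _
    rw [h1, ltiSol_smul]
    rfl
  · intro z
    have h1 := hC z.1 (z.2 : ℝ → ℝ) (hmem _) x hx
    rw [hself] at h1
    refine h1.trans ?_
    have h2 : ‖z.1‖ + ‖z.2‖ ≤ 2 * ‖z‖ := by
      have := norm_fst_le z; have := norm_snd_le z; linarith
    calc _ ≤ C * (2 * ‖z‖) := by gcongr
      _ = _ := by ring
  · intro x₀ f hf
    change ltiSol D b x₀ (toL2 f : ℝ → ℝ) x a = _
    rw [toL2_of_sqInt hf]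
    rw [ltiSol_congr_ae D b x₀ hf.coeFn_toLp hx]

/-- `ltiSol` as an element of `L²(0,1)` that depends continuously on the initial value and the
input. -/
lemma exists_ltiL2 (a : ι) : ∃ L : (ι → ℝ) × L2 →L[ℝ] L2,
    ∀ x₀ f, SqInt f → L (x₀, toL2 f) = toL2 (fun x => ltiSol D b x₀ f x a) := by
  obtain ⟨C, hC0, hC⟩ := exists_ltiSol_bound D b a
  have hmem : ∀ F : L2, SqInt F := fun F => Lp.memLp F
  have hself : ∀ F : L2, toL2 F = F := fun F => by
    rw [toL2_of_sqInt (hmem F), Lp.toLp_coeFn]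
  have hsq : ∀ (x₀ : ι → ℝ) (F : L2), SqInt (fun x => ltiSol D b x₀ F x a) := fun x₀ F =>
    (isPrim_ltiSol D b x₀ (hmem F) a).sqInt_self
  refine ⟨LinearMap.mkContinuous ⟨⟨fun z => toL2 (fun x => ltiSol D b z.1 (z.2 : ℝ → ℝ) x a), ?_⟩,
    ?_⟩ (2 * C) ?_, ?_⟩
  · intro z w
    rw [← toL2_add (hsq _ _) (hsq _ _)]
    refine toL2_congr fun x hx => ?_
    have h1 : ltiSol D b (z + w).1 ((z + w).2 : ℝ → ℝ) x =
        ltiSol D b (z.1 + w.1) (fun y => (z.2 : ℝ → ℝ) y + (w.2 : ℝ → ℝ) y) x :=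
      ltiSol_congr_ae D b _ (Lp.coeFn_add z.2 w.2) hx
    rw [h1, ltiSol_add D b _ _ (hmem _) (hmem _) hx, Pi.add_apply]
  · intro s z
    change toL2 (fun x => ltiSol D b (s • z).1 ((s • z).2 : ℝ → ℝ) x a) = _
    rw [RingHom.id_apply, ← toL2_const_mul s (hsq _ _)]
    refine toL2_congr fun x hx => ?_
    have h1 : ltiSol D b (s • z).1 ((s • z).2 : ℝ → ℝ) x =
        ltiSol D b (s • z.1) (fun y => s * (z.2 : ℝ → ℝ) y) x :=
      ltiSol_congr_ae D b _ (Lp.coeFn_smul s z.2) hx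
    rw [h1, ltiSol_smul]
    rfl
  · intro z
    have h2 : ‖z.1‖ + ‖z.2‖ ≤ 2 * ‖z‖ := by
      have := norm_fst_le z; have := norm_snd_le z; linarith
    refine (norm_toL2_le_of_bound (hsq z.1 z.2) (C := C * (‖z.1‖ + ‖z.2‖)) (by positivity)
      fun x hx => ?_).trans ?_
    · have h1 := hC z.1 (z.2 : ℝ → ℝ) (hmem _) x hx
      rwa [hself] at h1
    · calc _ ≤ C * (2 * ‖z‖) := by gcongr
        _ = _ := by ring
  · intro x₀ f hf
    refine toL2_congr fun x hx => ?_
    change ltiSol D b x₀ (toL2 f : ℝ → ℝ) x a = _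
    rw [toL2_of_sqInt hf, ltiSol_congr_ae D b x₀ hf.coeFn_toLp hx]

end Exp

end SandwichedHeat

namespace SandwichedHeat

open MeasureTheory
open scoped RealInnerProductSpace

/-! ### The backstepping transformation -/

variable {n m : ℕ}

namespace Plant

variable (P : Plant n m)

/-- The input vector `[B/q; 0]`. -/
def inputVec : Fin n ⊕ Fin n → ℝ := Sum.elim (P.q⁻¹ • P.B) 0

/-- The row vector `[C_X, K - C_X B C_X/q]`, so that `Φ(x) = rowD e^{Dx} [I; 0]`. -/
def rowD (K : Fin n → ℝ) : Fin n ⊕ Fin n → ℝ :=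
  Sum.elim P.CX (K - (P.q⁻¹ * (P.CX ⬝ᵥ P.B)) • P.CX)

/-- The row vector `[C_X, K]`, so that `Γ(x) = -rowE e^{Ex} [I; 0]`. -/
def rowE (K : Fin n → ℝ) : Fin n ⊕ Fin n → ℝ := Sum.elim P.CX K

/-- The change of basis `T = [I, -B C_X/q; 0, I]` with `T (D + b r) = E T`, `T b = b`, `s T = r`,
where `b`, `r`, `s` are `inputVec`, `rowD`, `rowE`. -/
def matT : Matrix (Fin n ⊕ Fin n) (Fin n ⊕ Fin n) ℝ :=
  Matrix.fromBlocks 1 (-(P.q⁻¹ • Matrix.vecMulVec P.B P.CX)) 0 1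

/-- The inverse of `matT`. -/
def matTinv : Matrix (Fin n ⊕ Fin n) (Fin n ⊕ Fin n) ℝ :=
  Matrix.fromBlocks 1 (P.q⁻¹ • Matrix.vecMulVec P.B P.CX) 0 1

lemma matTinv_mul_matT : P.matTinv * P.matT = 1 := by
  rw [matTinv, matT, Matrix.fromBlocks_multiply, ← Matrix.fromBlocks_one]
  simp

lemma matT_mulVec_inputVec : P.matT *ᵥ P.inputVec = P.inputVec := by
  simp [matT, inputVec, Matrix.fromBlocks_mulVec]

lemma rowE_vecMul_matT (K : Fin n → ℝ) : P.rowE K ᵥ* P.matT = P.rowD K := by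
  rw [rowE, matT, rowD, Matrix.vecMul_fromBlocks]
  simp [Matrix.vecMul_neg, Matrix.vecMul_smul, Matrix.vecMul_vecMulVec, smul_smul, sub_eq_neg_add]

lemma matT_mul (K : Fin n → ℝ) :
    P.matT * (P.matD + Matrix.vecMulVec P.inputVec (P.rowD K)) = P.matE K * P.matT := by
  have h1 : Matrix.vecMulVec P.inputVec (P.rowD K) =
      Matrix.fromBlocks (P.q⁻¹ • Matrix.vecMulVec P.B P.CX)
        (P.q⁻¹ • Matrix.vecMulVec P.B (K - (P.q⁻¹ * (P.CX ⬝ᵥ P.B)) • P.CX)) 0 0 := by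
    ext i j
    rcases i with i | i <;> rcases j with j | j <;>
      simp [Matrix.vecMulVec_apply, inputVec, rowD, mul_assoc]
  rw [h1, matT, matD, matE, AK, Matrix.fromBlocks_add, Matrix.fromBlocks_multiply,
    Matrix.fromBlocks_multiply]
  congr 1
  · simp
  · simp [Matrix.vecMulVec_sub, Matrix.vecMulVec_smul, Matrix.vecMulVec_mul_vecMulVec, smul_smul,
      smul_sub, smul_add]
    ext i j
    simp [Matrix.vecMulVec_apply]
    ring
  · simp
  · simp

/-- `Φ(x) ξ` is an output of the system in `x` without input. -/
lemma Phi_dotProduct (K : Fin n → ℝ) (x : ℝ) (ξ : Fin n → ℝ) :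
    P.Phi K x ⬝ᵥ ξ = P.rowD K ⬝ᵥ (NormedSpace.exp (x • P.matD) *ᵥ Sum.elim ξ 0) := by
  rw [Matrix.dotProduct_mulVec]
  simp [dotProduct, Fintype.sum_sum_type, Phi, rowD]

lemma phi_eq (K : Fin n → ℝ) (x y : ℝ) :
    P.phi K x y = P.rowD K ⬝ᵥ (NormedSpace.exp ((x - y) • P.matD) *ᵥ P.inputVec) := by
  have h : P.inputVec = P.q⁻¹ • Sum.elim P.B 0 := by
    ext i; rcases i with i | i <;> simp [inputVec]
  rw [phi, Phi_dotProduct, h, Matrix.mulVec_smul, dotProduct_smul, smul_eq_mul]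

lemma psi_eq (K : Fin n → ℝ) (x y : ℝ) :
    P.psi K x y = -(P.rowE K ⬝ᵥ (NormedSpace.exp ((x - y) • P.matE K) *ᵥ P.inputVec)) := by
  rw [Matrix.dotProduct_mulVec]
  simp [dotProduct, Fintype.sum_sum_type, psi, Gam, rowE, inputVec, Finset.mul_sum, mul_comm,
    mul_left_comm]

lemma chi_eq (K : Fin n → ℝ) (j : ℕ) (x : ℝ) :
    P.chi K j x = -(P.rowE K ⬝ᵥ ((P.matE K ^ j) *ᵥ P.inputVec)) := by
  obtain ⟨g, hg⟩ : ∃ g : ℝ → ℝ, g = fun z : ℝ =>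
    P.rowE K ⬝ᵥ (NormedSpace.exp (z • P.matE K) *ᵥ P.inputVec) := ⟨_, rfl⟩
  have h1 : (fun ξ => P.psi K ξ x) = -(fun ξ => g (ξ - x)) := by
    funext ξ; simp [psi_eq, hg]
  rw [chi, h1, iteratedDeriv_neg, iteratedDeriv_comp_sub_const, hg, iteratedDeriv_exp_mulVec]
  simp

lemma iteratedDeriv_phi (K : Fin n → ℝ) (j : ℕ) (y : ℝ) :
    iteratedDeriv j (fun y => P.phi K 1 y) y = (-1) ^ j *
      (P.rowD K ⬝ᵥ (NormedSpace.exp ((1 - y) • P.matD) *ᵥ ((P.matD ^ j) *ᵥ P.inputVec))) := by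
  obtain ⟨g, hg⟩ : ∃ g : ℝ → ℝ, g = fun z : ℝ =>
    P.rowD K ⬝ᵥ (NormedSpace.exp (z • P.matD) *ᵥ P.inputVec) := ⟨_, rfl⟩
  have h1 : (fun y => P.phi K 1 y) = fun y => g (1 - y) := by
    funext y; simp [phi_eq, hg]
  rw [h1, iteratedDeriv_comp_const_sub, hg, iteratedDeriv_exp_mulVec]
  simp

/-! ### Spatial derivatives of the state and of the target variable -/

/-- The state `e^{Dx} [ξ; 0] + ∫_0^x e^{D(x-y)} b v(y) dy` of the linear system that realizes the
backstepping transformation, together with its spatial derivatives. -/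
def stateSeq (v : ℝ → ℝ) (ξ : Fin n → ℝ) (i : ℕ) (x : ℝ) : Fin n ⊕ Fin n → ℝ :=
  ltiDer P.matD P.inputVec (Sum.elim ξ 0) (fun j => der j v) i x

/-- The spatial derivatives of the backstepping variable `w = v - ∫ φ v - Φ ξ`. -/
def targetSeq (K : Fin n → ℝ) (v : ℝ → ℝ) (ξ : Fin n → ℝ) (i : ℕ) (x : ℝ) : ℝ :=
  der i v x - P.rowD K ⬝ᵥ P.stateSeq v ξ i x

/-- The state `stateSeq` in the coordinates in which it is driven by the target variable. -/
def auxSeq (v : ℝ → ℝ) (ξ : Fin n → ℝ) (i : ℕ) (x : ℝ) : Fin n ⊕ Fin n → ℝ :=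
  P.matT *ᵥ P.stateSeq v ξ i x

variable {P} {K : Fin n → ℝ} {v : ℝ → ℝ} {ξ : Fin n → ℝ}

lemma stateSeq_succ (i : ℕ) (x : ℝ) :
    P.stateSeq v ξ (i + 1) x = P.matD *ᵥ P.stateSeq v ξ i x + der i v x • P.inputVec := rfl

lemma stateSeq_zero_zero : P.stateSeq v ξ 0 0 = Sum.elim ξ 0 := ltiSol_zero _ _ _ _

lemma auxSeq_zero_zero : P.auxSeq v ξ 0 0 = Sum.elim ξ 0 := by
  rw [auxSeq, stateSeq_zero_zero, matT, Matrix.fromBlocks_mulVec]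
  simp

lemma matTinv_mulVec_auxSeq (i : ℕ) (x : ℝ) :
    P.matTinv *ᵥ P.auxSeq v ξ i x = P.stateSeq v ξ i x := by
  rw [auxSeq, Matrix.mulVec_mulVec, matTinv_mul_matT, Matrix.one_mulVec]

/-- The inverse transformation: in the coordinates `matT` the system in `x` has the matrix `E` and
the input `w`. -/
lemma auxSeq_succ (K : Fin n → ℝ) (i : ℕ) (x : ℝ) : P.auxSeq v ξ (i + 1) x =
    P.matE K *ᵥ P.auxSeq v ξ i x + P.targetSeq K v ξ i x • P.inputVec := by
  have h := congrArg (fun M => M *ᵥ P.stateSeq v ξ i x) (P.matT_mul K)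
  simp only [← Matrix.mulVec_mulVec, Matrix.add_mulVec, Matrix.mulVec_add,
    Matrix.vecMulVec_mulVec, Matrix.mulVec_smul, matT_mulVec_inputVec, op_smul_eq_smul] at h
  rw [auxSeq, stateSeq_succ, Matrix.mulVec_add, Matrix.mulVec_smul, matT_mulVec_inputVec,
    targetSeq, sub_smul, auxSeq, ← h]
  abel

/-- The output equation `u = w + [C_X, K] h` of the inverse transformation. -/
lemma der_eq_targetSeq_add (i : ℕ) (x : ℝ) :
    der i v x = P.targetSeq K v ξ i x + P.rowE K ⬝ᵥ P.auxSeq v ξ i x := by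
  rw [targetSeq, auxSeq, Matrix.dotProduct_mulVec, rowE_vecMul_matT]
  ring

lemma auxSeq_eq_sum (K : Fin n → ℝ) (i : ℕ) (x : ℝ) : P.auxSeq v ξ i x =
    (P.matE K ^ i) *ᵥ P.auxSeq v ξ 0 x + ∑ j ∈ Finset.range i,
      P.targetSeq K v ξ (i - 1 - j) x • ((P.matE K ^ j) *ᵥ P.inputVec) :=
  recursion_eq_sum (G := fun i => P.auxSeq v ξ i x) (fun i => auxSeq_succ K i x) i

lemma stateSeq_eq_sum (i : ℕ) (x : ℝ) : P.stateSeq v ξ i x =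
    (P.matD ^ i) *ᵥ P.stateSeq v ξ 0 x + ∑ j ∈ Finset.range i,
      der (i - 1 - j) v x • ((P.matD ^ j) *ᵥ P.inputVec) :=
  recursion_eq_sum (G := fun i => P.stateSeq v ξ i x) (fun i => stateSeq_succ i x) i

variable {k : ℕ}

lemma isPrim_stateSeq (hv : MemH k v) {i : ℕ} (hi : i ≤ k) (a : Fin n ⊕ Fin n) :
    IsPrim (fun x => P.stateSeq v ξ i x a) (fun x => P.stateSeq v ξ (i + 1) x a) :=
  isPrim_ltiDer (F := fun j => der j v) (hv.2 0 (by omega)) (fun _ hj => hv.isPrim hj) hi a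

lemma isPrim_dotProduct_stateSeq (hv : MemH k v) {i : ℕ} (hi : i ≤ k) (r : Fin n ⊕ Fin n → ℝ) :
    IsPrim (fun x => r ⬝ᵥ P.stateSeq v ξ i x) (fun x => r ⬝ᵥ P.stateSeq v ξ (i + 1) x) :=
  IsPrim.sum Finset.univ fun a _ => (isPrim_stateSeq hv hi a).const_mul (r a)

lemma isPrim_targetSeq (hv : MemH k v) {i : ℕ} (hi : i < k) :
    IsPrim (P.targetSeq K v ξ i) (P.targetSeq K v ξ (i + 1)) :=
  (hv.isPrim hi).sub (isPrim_dotProduct_stateSeq hv hi.le _)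

lemma isPrim_auxSeq (hv : MemH k v) {i : ℕ} (hi : i ≤ k) (a : Fin n ⊕ Fin n) :
    IsPrim (fun x => P.auxSeq v ξ i x a) (fun x => P.auxSeq v ξ (i + 1) x a) :=
  isPrim_dotProduct_stateSeq hv hi (P.matT a)

/-! ### The boundary operators -/

variable (P K)

/-- The operator `S_k` on the sequence `G` of derivatives of a function at a point. -/
def seqS (k : ℕ) (G : ℕ → ℝ) : ℝ :=
  G k + ∑ j ∈ Finset.range k, (P.rowE K ⬝ᵥ ((P.matE K ^ j) *ᵥ P.inputVec)) * G (k - 1 - j)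

/-- The operator `𝓑` on the sequence `G` of derivatives of a function at `x = 1`. -/
def seqB (G : ℕ → ℝ) : ℝ :=
  (∑ k : Fin m, P.abar k * P.q ^ (k : ℕ) * P.seqS K (2 * (k : ℕ)) G) -
    P.q ^ m * ∑ i ∈ Finset.Icc 1 (2 * m),
      (P.rowD K ⬝ᵥ ((P.matD ^ (i - 1)) *ᵥ P.inputVec)) * P.seqS K (2 * m - i) G

/-- The operator `𝓒` on the sequence `G` of derivatives of a function at `x = 0`. -/
def seqC (G : ℕ → ℝ) : ℝ :=
  P.q ^ m * (∑ i ∈ Finset.Icc 1 (2 * m),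
      (P.rowD K ⬝ᵥ (NormedSpace.exp ((1 : ℝ) • P.matD) *ᵥ ((P.matD ^ (i - 1)) *ᵥ P.inputVec))) *
        P.seqS K (2 * m - i) G) -
    ∑ i ∈ Finset.Icc 1 m,
      (P.rowD K ⬝ᵥ (NormedSpace.exp ((1 : ℝ) • P.matD) *ᵥ Sum.elim (P.A ^ (i - 1) *ᵥ P.B) 0)) *
        P.q ^ (m - i) * P.seqS K (2 * (m - i) + 1) G

/-- The operator `𝓛` on the sequence `G` of derivatives of a function at `x = 1`. -/
def seqL (c : ℕ → ℝ) (G : ℕ → ℝ) : ℝ :=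
  -P.seqB K G - ∑ i ∈ Finset.range m, P.q ^ i * (alpha c m i + c m * beta c m i) * G (2 * i)

lemma localDer_eq (k : ℕ) (f : ℝ → ℝ) (x : ℝ) :
    P.localDer K k f x = P.seqS K k (fun i => der i f x) := by
  simp only [localDer, seqS, chi_eq, neg_mul, Finset.sum_neg_distrib, sub_neg_eq_add,
    Nat.sub_right_comm _ _ 1]

lemma neg_one_pow_mul_neg_one_pow_pred {i : ℕ} (hi : 1 ≤ i) :
    (-1 : ℝ) ^ i * (-1) ^ (i - 1) = -1 := by
  obtain ⟨j, rfl⟩ := Nat.exists_eq_add_of_le' hi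
  rw [Nat.add_sub_cancel, pow_succ, mul_right_comm, ← mul_pow]
  simp

lemma opB_eq (f : ℝ → ℝ) : P.opB K f = P.seqB K (fun i => der i f 1) := by
  rw [opB, seqB, sub_eq_add_neg, ← mul_neg, ← Finset.sum_neg_distrib]
  simp only [localDer_eq]
  congr 2
  refine Finset.sum_congr rfl fun i hi => ?_
  rw [iteratedDeriv_phi, ← mul_assoc, neg_one_pow_mul_neg_one_pow_pred (Finset.mem_Icc.1 hi).1,
    sub_self, exp_zero_smul, Matrix.one_mulVec]
  ring

lemma opC_eq (f : ℝ → ℝ) : P.opC K f = P.seqC K (fun i => der i f 0) := by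
  rw [opC, seqC, ← mul_neg, ← Finset.sum_neg_distrib]
  simp only [localDer_eq, Phi_dotProduct]
  congr 2
  refine Finset.sum_congr rfl fun i hi => ?_
  rw [iteratedDeriv_phi, ← mul_assoc, neg_one_pow_mul_neg_one_pow_pred (Finset.mem_Icc.1 hi).1,
    sub_zero]
  ring

lemma opL_eq (c : ℕ → ℝ) (f : ℝ → ℝ) : P.opL K c f = P.seqL K c (fun i => der i f 1) := by
  rw [opL, seqL, opB_eq]

lemma seqS_sub (k : ℕ) (G G' : ℕ → ℝ) :
    P.seqS K k (fun i => G i - G' i) = P.seqS K k G - P.seqS K k G' := by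
  simp only [seqS, mul_sub, Finset.sum_sub_distrib]
  ring

lemma seqB_sub (G G' : ℕ → ℝ) :
    P.seqB K (fun i => G i - G' i) = P.seqB K G - P.seqB K G' := by
  simp only [seqB, seqS_sub, mul_sub, Finset.sum_sub_distrib]
  ring

lemma seqC_sub (G G' : ℕ → ℝ) :
    P.seqC K (fun i => G i - G' i) = P.seqC K G - P.seqC K G' := by
  simp only [seqC, seqS_sub, mul_sub, Finset.sum_sub_distrib]
  ring

lemma seqL_sub (c G G' : ℕ → ℝ) :
    P.seqL K c (fun i => G i - G' i) = P.seqL K c G - P.seqL K c G' := by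
  simp only [seqL, seqB_sub, mul_sub, Finset.sum_sub_distrib]
  ring

lemma seqS_congr {k : ℕ} {G G' : ℕ → ℝ} (h : ∀ i ≤ k, G i = G' i) :
    P.seqS K k G = P.seqS K k G' := by
  rw [seqS, seqS, h k le_rfl]
  congr 1
  exact Finset.sum_congr rfl fun j _ => by rw [h _ (by omega)]

lemma seqB_congr {G G' : ℕ → ℝ} (h : ∀ i < 2 * m, G i = G' i) : P.seqB K G = P.seqB K G' := by
  have hS : ∀ k < 2 * m, P.seqS K k G = P.seqS K k G' := fun k hk =>
    P.seqS_congr K fun i hi => h i (by omega)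
  refine congrArg₂ (· - ·) (Finset.sum_congr rfl fun i _ => ?_)
    (congrArg _ (Finset.sum_congr rfl fun i hi => ?_))
  · rw [hS _ (by omega)]
  · have := Finset.mem_Icc.1 hi
    rw [hS _ (by omega)]

lemma seqC_congr {G G' : ℕ → ℝ} (h : ∀ i < 2 * m, G i = G' i) : P.seqC K G = P.seqC K G' := by
  have hS : ∀ k < 2 * m, P.seqS K k G = P.seqS K k G' := fun k hk =>
    P.seqS_congr K fun i hi => h i (by omega)
  refine congrArg₂ (· - ·) (congrArg _ (Finset.sum_congr rfl fun i hi => ?_))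
    (Finset.sum_congr rfl fun i hi => ?_)
  · have := Finset.mem_Icc.1 hi
    rw [hS _ (by omega)]
  · have := Finset.mem_Icc.1 hi
    rw [hS _ (by omega)]

lemma seqL_congr (c : ℕ → ℝ) {G G' : ℕ → ℝ} (h : ∀ i < 2 * m, G i = G' i) :
    P.seqL K c G = P.seqL K c G' := by
  rw [seqL, seqL, P.seqB_congr K h]
  congr 1
  exact Finset.sum_congr rfl fun i hi => by
    rw [h _ (by have := Finset.mem_range.1 hi; omega)]

end Plant

end SandwichedHeat

namespace SandwichedHeat

open MeasureTheory
open scoped RealInnerProductSpace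

/-! ### The feedback law in terms of the target variable -/

variable {n m : ℕ}

section

variable {ι : Type*} [Fintype ι]

/-- The linear functional `h ↦ r M h`. -/
def rowMap (r : ι → ℝ) (M : Matrix ι ι ℝ) : (ι → ℝ) →ₗ[ℝ] ℝ where
  toFun h := r ⬝ᵥ (M *ᵥ h)
  map_add' := by simp [Matrix.mulVec_add]
  map_smul' := by simp [Matrix.mulVec_smul]

lemma rowMap_apply (r : ι → ℝ) (M : Matrix ι ι ℝ) (h : ι → ℝ) : rowMap r M h = r ⬝ᵥ (M *ᵥ h) := rfl

variable [DecidableEq ι] {D : Matrix ι ι ℝ} {b : ι → ℝ}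

lemma ltiDer_eq_add (x₀ : ι → ℝ) (F : ℕ → ℝ → ℝ) (i : ℕ) (x : ℝ) :
    ltiDer D b x₀ F i x = ltiDer D b x₀ (fun _ _ => 0) i x + ltiDer D b 0 F i x := by
  induction i with
  | zero =>
    funext a
    simp [ltiDer, ltiSol]
  | succ i ih =>
    change D *ᵥ ltiDer D b x₀ F i x + F i x • b = (D *ᵥ ltiDer D b x₀ (fun _ _ => 0) i x +
      (0 : ℝ) • b) + (D *ᵥ ltiDer D b 0 F i x + F i x • b)
    rw [ih, Matrix.mulVec_add]
    simp [add_assoc]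

end

lemma sum_Icc_one_eq_sum_range (f : ℕ → ℝ) (N : ℕ) :
    ∑ i ∈ Finset.Icc 1 N, f i = ∑ j ∈ Finset.range N, f (j + 1) := by
  induction N with
  | zero => simp
  | succ N ih => rw [Finset.sum_Icc_succ_top (by omega), ih, Finset.sum_range_succ]

/-- The inclusion `ξ ↦ [ξ; 0]`. -/
def inlMap : (Fin n → ℝ) →ₗ[ℝ] (Fin n ⊕ Fin n → ℝ) where
  toFun ξ := Sum.elim ξ 0
  map_add' ξ η := by funext i; rcases i with i | i <;> simp
  map_smul' s ξ := by funext i; rcases i with i | i <;> simp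

lemma inlMap_apply (ξ : Fin n → ℝ) : inlMap ξ = Sum.elim ξ 0 := rfl

lemma der_zero (f : ℝ → ℝ) : der 0 f = f := iteratedDerivWithin_zero

lemma der_congr {f g : ℝ → ℝ} (h : ∀ x ∈ Set.Icc (0 : ℝ) 1, f x = g x) (i : ℕ) {x : ℝ}
    (hx : x ∈ Set.Icc (0 : ℝ) 1) : der i f x = der i g x :=
  iteratedDerivWithin_congr h hx

namespace Plant

variable {P : Plant n m} {K : Fin n → ℝ} {v : ℝ → ℝ} {ξ : Fin n → ℝ} {k : ℕ}

lemma der_Phi_dotProduct (i : ℕ) {x : ℝ} (hx : x ∈ Set.Icc (0 : ℝ) 1) :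
    der i (fun x => P.Phi K x ⬝ᵥ ξ) x =
      P.rowD K ⬝ᵥ ltiDer P.matD P.inputVec (Sum.elim ξ 0) (fun _ _ => 0) i x := by
  have h0 : SqInt (fun _ => (0 : ℝ)) := MemLp.zero
  have hp : ∀ j : ℕ, IsPrim
      (fun x => P.rowD K ⬝ᵥ ltiDer P.matD P.inputVec (Sum.elim ξ 0) (fun _ _ => 0) j x)
      (fun x => P.rowD K ⬝ᵥ ltiDer P.matD P.inputVec (Sum.elim ξ 0) (fun _ _ => 0) (j + 1) x) :=
    fun j => IsPrim.sum Finset.univ fun a _ => (isPrim_ltiDer (F := fun _ _ => 0) (k := j) h0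
      (fun _ _ => isPrim_zero) le_rfl a).const_mul (P.rowD K a)
  rw [← der_eq_of_isPrim (N := i) (fun j _ => hp j) (hp i).continuousOn le_rfl hx]
  refine der_congr (fun y _ => ?_) i hx
  rw [Phi_dotProduct]
  congr 1
  funext a
  simp [ltiDer, ltiSol]

lemma der_integral_phi (hv : MemH k v) {i : ℕ} (hi : i ≤ k) {x : ℝ} (hx : x ∈ Set.Icc (0 : ℝ) 1) :
    der i (fun x => ∫ y in (0 : ℝ)..x, P.phi K x y * v y) x =
      P.rowD K ⬝ᵥ ltiDer P.matD P.inputVec 0 (fun j => der j v) i x := by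
  have hp : ∀ j ≤ k, IsPrim
      (fun x => P.rowD K ⬝ᵥ ltiDer P.matD P.inputVec 0 (fun j => der j v) j x)
      (fun x => P.rowD K ⬝ᵥ ltiDer P.matD P.inputVec 0 (fun j => der j v) (j + 1) x) :=
    fun j hj => IsPrim.sum Finset.univ fun a _ => (isPrim_ltiDer (F := fun j => der j v)
      (hv.2 0 (by omega)) (fun _ h => hv.isPrim h) hj a).const_mul (P.rowD K a)
  rw [← der_eq_of_isPrim (N := k) (fun j hj => hp j hj.le) (hp k le_rfl).continuousOn hi hx]
  refine der_congr (fun y hy => ?_) i hx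
  have hv0 : SqInt v := by simpa [der_zero] using hv.2 0 (by omega)
  have hint : ∀ a, IntervalIntegrable (fun z => P.rowD K a *
      ((NormedSpace.exp ((y - z) • P.matD) *ᵥ P.inputVec) a * v z)) volume 0 y := fun a => by
    have := hv0.mul_continuousOn
      (g := fun z => (NormedSpace.exp ((y - z) • P.matD) *ᵥ P.inputVec) a)
      ((continuous_exp_mulVec P.matD P.inputVec a).comp
        (continuous_const.sub continuous_id)).continuousOn
    exact ((this.congr fun z _ => mul_comm _ _).intervalIntegrable' hy).const_mul _
  simp only [phi_eq, dotProduct, ltiDer, ltiSol, Finset.sum_mul, Matrix.mulVec_zero, Pi.zero_apply,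
    zero_add, mul_assoc]
  rw [intervalIntegral.integral_finsetSum fun a _ => hint a]
  simp only [intervalIntegral.integral_const_mul]
  simp [der]

lemma targetSeq_eq_der_sub (hv : MemH k v) {i : ℕ} (hi : i ≤ k) {x : ℝ}
    (hx : x ∈ Set.Icc (0 : ℝ) 1) : P.targetSeq K v ξ i x =
      der i v x - der i (fun x => P.Phi K x ⬝ᵥ ξ) x -
        der i (fun x => ∫ y in (0 : ℝ)..x, P.phi K x y * v y) x := by
  rw [der_Phi_dotProduct i hx, der_integral_phi hv hi hx, targetSeq, stateSeq, ltiDer_eq_add,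
    dotProduct_add]
  ring

/-- The feedback law depends on the plant state through the target variable only. -/
lemma controlLaw_eq (hv : MemH k v) (hk : 2 * m ≤ k) (c : ℕ → ℝ) :
    P.controlLaw K c v ξ = P.seqL K c (fun i => P.targetSeq K v ξ i 1) -
      P.seqC K (fun i => P.targetSeq K v ξ i 0) := by
  have hL : P.seqL K c (fun i => P.targetSeq K v ξ i 1) = P.opL K c v -
      P.opL K c (fun x => P.Phi K x ⬝ᵥ ξ) -
        P.opL K c (fun x => ∫ y in (0 : ℝ)..x, P.phi K x y * v y) := by
    simp only [opL_eq, ← seqL_sub]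
    exact seqL_congr P K c fun i hi => targetSeq_eq_der_sub hv (by omega) (by simp)
  have hC : P.seqC K (fun i => P.targetSeq K v ξ i 0) = P.opC K v -
      P.opC K (fun x => P.Phi K x ⬝ᵥ ξ) -
        P.opC K (fun x => ∫ y in (0 : ℝ)..x, P.phi K x y * v y) := by
    simp only [opC_eq, ← seqC_sub]
    exact seqC_congr P K fun i hi => targetSeq_eq_der_sub hv (by omega) (by simp)
  rw [hL, hC, controlLaw]
  ring

/-- `S_k w` differs from `∂_x^k u` by a linear functional of the state of the system in `x`. -/
lemma seqS_targetSeq (k : ℕ) (x : ℝ) : P.seqS K k (fun i => P.targetSeq K v ξ i x) =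
    der k v x - rowMap (P.rowE K) (P.matE K ^ k) (P.auxSeq v ξ 0 x) := by
  rw [seqS, der_eq_targetSeq_add (K := K) (ξ := ξ) (P := P) k x, auxSeq_eq_sum K k x,
    dotProduct_add, dotProduct_sum, rowMap_apply]
  simp only [dotProduct_smul, smul_eq_mul, mul_comm]
  ring

variable (P K)

/-- The terms at `x = 1` in the boundary equation are linear in the state at `x = 1`. -/
lemma exists_linear_right : ∃ L : (Fin n ⊕ Fin n → ℝ) →ₗ[ℝ] ℝ, ∀ (v : ℝ → ℝ) (ξ : Fin n → ℝ),
    (∑ k : Fin m, P.abar k * (P.q ^ (k : ℕ) * der (2 * (k : ℕ)) v 1)) -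
      P.seqB K (fun i => P.targetSeq K v ξ i 1) -
        P.q ^ m * (P.rowD K ⬝ᵥ P.stateSeq v ξ (2 * m) 1) = L (P.auxSeq v ξ 0 1) := by
  refine ⟨(∑ k : Fin m, (P.abar k * P.q ^ (k : ℕ)) • rowMap (P.rowE K) (P.matE K ^ (2 * (k : ℕ)))) -
    P.q ^ m • (∑ i ∈ Finset.Icc 1 (2 * m),
      (P.rowD K ⬝ᵥ ((P.matD ^ (i - 1)) *ᵥ P.inputVec)) •
        rowMap (P.rowE K) (P.matE K ^ (2 * m - i))) -
    P.q ^ m • rowMap (P.rowD K) (P.matD ^ (2 * m) * P.matTinv), fun v ξ => ?_⟩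
  have h1 : ∑ i ∈ Finset.Icc 1 (2 * m), (P.rowD K ⬝ᵥ ((P.matD ^ (i - 1)) *ᵥ P.inputVec)) *
      der (2 * m - i) v 1 = P.rowD K ⬝ᵥ P.stateSeq v ξ (2 * m) 1 -
        rowMap (P.rowD K) (P.matD ^ (2 * m) * P.matTinv) (P.auxSeq v ξ 0 1) := by
    rw [sum_Icc_one_eq_sum_range, stateSeq_eq_sum (2 * m), rowMap_apply, ← Matrix.mulVec_mulVec,
      matTinv_mulVec_auxSeq, dotProduct_add, dotProduct_sum]
    simp only [dotProduct_smul, smul_eq_mul, Nat.add_sub_cancel, Nat.sub_sub, add_comm 1, mul_comm]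
    ring
  simp only [seqB, seqS_targetSeq, LinearMap.sub_apply, LinearMap.sum_apply, LinearMap.smul_apply,
    smul_eq_mul, mul_sub, Finset.sum_sub_distrib, h1, mul_assoc]
  ring

/-- The operator `𝓒` of the target variable is linear in `ξ`, if the derivative of order `2m` of
the state has the indicated value at `x = 0`. -/
lemma exists_linear_left : ∃ L : (Fin n → ℝ) →ₗ[ℝ] ℝ, ∀ (v : ℝ → ℝ) (ξ : Fin n → ℝ),
    P.q ^ m • P.stateSeq v ξ (2 * m) 0 = inlMap ((P.A ^ m) *ᵥ ξ +
      ∑ l ∈ Finset.range m, (P.q ^ l * der (2 * l + 1) v 0) • ((P.A ^ (m - 1 - l)) *ᵥ P.B)) →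
    P.seqC K (fun i => P.targetSeq K v ξ i 0) = L ξ := by
  obtain ⟨g, hg⟩ : ∃ g, g = rowMap (P.rowD K) (NormedSpace.exp ((1 : ℝ) • P.matD)) := ⟨_, rfl⟩
  refine ⟨(g ∘ₗ inlMap) ∘ₗ Matrix.mulVecLin (P.A ^ m) -
    P.q ^ m • ((g ∘ₗ Matrix.mulVecLin (P.matD ^ (2 * m))) ∘ₗ inlMap) -
    P.q ^ m • (∑ i ∈ Finset.Icc 1 (2 * m), g ((P.matD ^ (i - 1)) *ᵥ P.inputVec) •
      (rowMap (P.rowE K) (P.matE K ^ (2 * m - i)) ∘ₗ inlMap)) +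
    ∑ i ∈ Finset.Icc 1 m, (g (inlMap (P.A ^ (i - 1) *ᵥ P.B)) * P.q ^ (m - i)) •
      (rowMap (P.rowE K) (P.matE K ^ (2 * (m - i) + 1)) ∘ₗ inlMap), fun v ξ hst => ?_⟩
  have h1 : P.q ^ m * ∑ i ∈ Finset.Icc 1 (2 * m), g ((P.matD ^ (i - 1)) *ᵥ P.inputVec) *
      der (2 * m - i) v 0 = g (inlMap ((P.A ^ m) *ᵥ ξ)) + (∑ i ∈ Finset.Icc 1 m,
        g (inlMap (P.A ^ (i - 1) *ᵥ P.B)) * (P.q ^ (m - i) * der (2 * (m - i) + 1) v 0)) -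
          P.q ^ m * g ((P.matD ^ (2 * m)) *ᵥ inlMap ξ) := by
    have h2 := congrArg g hst
    rw [stateSeq_eq_sum (2 * m), stateSeq_zero_zero, ← inlMap_apply] at h2
    simp only [map_smul, map_add, map_sum, smul_eq_mul] at h2
    rw [← Finset.sum_range_reflect (fun l => P.q ^ l * der (2 * l + 1) v 0 *
      g (inlMap (P.A ^ (m - 1 - l) *ᵥ P.B))) m] at h2
    rw [sum_Icc_one_eq_sum_range, sum_Icc_one_eq_sum_range]
    have h3 : ∀ j ∈ Finset.range m, P.q ^ (m - 1 - j) * der (2 * (m - 1 - j) + 1) v 0 *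
        g (inlMap (P.A ^ (m - 1 - (m - 1 - j)) *ᵥ P.B)) =
        g (inlMap (P.A ^ (j + 1 - 1) *ᵥ P.B)) *
          (P.q ^ (m - (j + 1)) * der (2 * (m - (j + 1)) + 1) v 0) := fun j hj => by
      have := Finset.mem_range.1 hj
      rw [show m - 1 - (m - 1 - j) = j by omega, show m - (j + 1) = m - 1 - j by omega,
        Nat.add_sub_cancel]
      ring
    rw [Finset.sum_congr rfl h3] at h2
    have h4 : ∀ j ∈ Finset.range (2 * m), g ((P.matD ^ (j + 1 - 1)) *ᵥ P.inputVec) *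
        der (2 * m - (j + 1)) v 0 = der (2 * m - 1 - j) v 0 *
          g ((P.matD ^ j) *ᵥ P.inputVec) := fun j _ => by
      rw [show 2 * m - (j + 1) = 2 * m - 1 - j by omega, Nat.add_sub_cancel, mul_comm]
    rw [Finset.sum_congr rfl h4]
    linarith
  have hgr : ∀ h, P.rowD K ⬝ᵥ (NormedSpace.exp ((1 : ℝ) • P.matD) *ᵥ h) = g h := fun h => by
    rw [hg, rowMap_apply]
  simp only [seqC, seqS_targetSeq, hgr, ← inlMap_apply, auxSeq_zero_zero, LinearMap.sub_apply,
    LinearMap.add_apply, LinearMap.comp_apply, Matrix.mulVecLin_apply,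
    LinearMap.sum_apply, LinearMap.smul_apply, smul_eq_mul, mul_sub, Finset.sum_sub_distrib, h1,
    mul_assoc]
  ring

end Plant

end SandwichedHeat

namespace SandwichedHeat

open MeasureTheory
open scoped RealInnerProductSpace

/-! ### Time derivatives along solutions of the closed loop -/

variable {n m : ℕ}

/-- Boundary values are differentiable in time if the function and its spatial derivative are
differentiable in time as elements of `L²(0,1)`. -/
lemma hasDerivWithinAt_boundary {q : ℝ} {F F₁ G G₁ : ℝ → ℝ → ℝ}
    (hF : ∀ t, 0 ≤ t → IsPrim (F t) (F₁ t)) (hG : ∀ t, 0 ≤ t → IsPrim (G t) (G₁ t)) {t : ℝ}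
    (ht : 0 ≤ t)
    (hd : HasDerivWithinAt (fun t => toL2 (F t)) (q • toL2 (G t)) (Set.Ici 0) t)
    (hd₁ : HasDerivWithinAt (fun t => toL2 (F₁ t)) (q • toL2 (G₁ t)) (Set.Ici 0) t) {x : ℝ}
    (hx : x = 0 ∨ x = 1) :
    HasDerivWithinAt (fun t => F t x) (q * G t x) (Set.Ici 0) t := by
  have key : ∀ a b : L2, HasDerivWithinAt (fun t => ⟪toL2 (F t), a⟫ + ⟪toL2 (F₁ t), b⟫)
      (q * (⟪toL2 (G t), a⟫ + ⟪toL2 (G₁ t), b⟫)) (Set.Ici 0) t := fun a b => by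
    have h1 := hd.inner ℝ (hasDerivWithinAt_const t (Set.Ici 0) a)
    have h2 := hd₁.inner ℝ (hasDerivWithinAt_const t (Set.Ici 0) b)
    refine (h1.add h2).congr_deriv ?_
    simp only [inner_zero_right, zero_add, inner_smul_left]
    simp [mul_add]
  rcases hx with rfl | rfl
  · rw [(hG t ht).eq_inner_zero]
    exact (key _ _).congr (fun s hs => (hF s hs).eq_inner_zero) (hF t ht).eq_inner_zero
  · rw [(hG t ht).eq_inner_one]
    exact (key _ _).congr (fun s hs => (hF s hs).eq_inner_one) (hF t ht).eq_inner_one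

lemma hasDerivWithinAt_mulVec {ι κ : Type*} [Fintype ι] [Fintype κ] (M : Matrix ι κ ℝ)
    {f : ℝ → κ → ℝ} {f' : κ → ℝ} {s : Set ℝ} {t : ℝ} (hf : HasDerivWithinAt f f' s t) :
    HasDerivWithinAt (fun t => M *ᵥ f t) (M *ᵥ f') s t :=
  (LinearMap.toContinuousLinearMap (Matrix.mulVecLin M)).hasFDerivAt.comp_hasDerivWithinAt t hf

lemma hasDerivWithinAt_dotProduct {ι : Type*} [Fintype ι] (r : ι → ℝ)
    {f : ℝ → ι → ℝ} {f' : ι → ℝ} {s : Set ℝ} {t : ℝ} (hf : HasDerivWithinAt f f' s t) :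
    HasDerivWithinAt (fun t => r ⬝ᵥ f t) (r ⬝ᵥ f') s t :=
  HasDerivWithinAt.fun_sum fun i _ => (hasDerivWithinAt_pi.1 hf i).const_mul (r i)

lemma hasDerivWithinAt_inlMap {f : ℝ → Fin n → ℝ} {f' : Fin n → ℝ} {s : Set ℝ} {t : ℝ}
    (hf : HasDerivWithinAt f f' s t) :
    HasDerivWithinAt (fun t => inlMap (f t)) (inlMap f') s t :=
  (LinearMap.toContinuousLinearMap inlMap).hasFDerivAt.comp_hasDerivWithinAt t hf

lemma HasDerivWithinAt.unique_Ici {E : Type*} [NormedAddCommGroup E] [NormedSpace ℝ E]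
    {f : ℝ → E} {a b : E} {t : ℝ} (ht : 0 ≤ t) (ha : HasDerivWithinAt f a (Set.Ici 0) t)
    (hb : HasDerivWithinAt f b (Set.Ici 0) t) : a = b :=
  (uniqueDiffOn_Ici 0 t ht).eq_deriv _ ha hb

namespace Plant

variable {P : Plant n m} {K : Fin n → ℝ} {v : ℝ → ℝ} {ξ : Fin n → ℝ} {k : ℕ}

/-- Two spatial derivatives of the state amount to one time derivative: the terms at `x = 0` are
those of the differential equation for `X`. -/
lemma smul_stateSeq_two (hq : P.q ≠ 0) (hv : MemH k v) (hk : 2 ≤ k) (hbc : v 0 = P.CX ⬝ᵥ ξ)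
    {x : ℝ} (hx : x ∈ Set.Icc (0 : ℝ) 1) : P.q • P.stateSeq v ξ 2 x =
      ltiSol P.matD P.inputVec (inlMap (P.A *ᵥ ξ + der 1 v 0 • P.B)) (fun y => P.q * der 2 v y)
        x := by
  rw [stateSeq, ltiDer_two_eq (F := fun j => der j v) hk (hv.2 0 (by omega))
    (fun _ h => hv.isPrim h) hx, ← ltiSol_smul]
  congr 1
  have h1 : P.matD *ᵥ Sum.elim ξ 0 + der 0 v 0 • P.inputVec =
      Sum.elim ((P.CX ⬝ᵥ ξ) • P.q⁻¹ • P.B) ξ := by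
    funext a
    rcases a with a | a <;>
      simp [matD, inputVec, Matrix.fromBlocks_mulVec, der_zero, hbc]
  rw [h1]
  funext a
  rcases a with a | a
  · simp [matD, inputVec, inlMap_apply, Matrix.fromBlocks_mulVec, Matrix.smul_mulVec]
    field_simp
  · simp [matD, inputVec, inlMap_apply, Matrix.fromBlocks_mulVec, Matrix.neg_mulVec,
      Matrix.smul_mulVec, Matrix.vecMulVec_mulVec]
    right
    ring

lemma auxSeq_one_inr (i : Fin n) (x : ℝ) :
    P.auxSeq v ξ 1 x (Sum.inr i) = P.auxSeq v ξ 0 x (Sum.inl i) := by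
  rw [auxSeq_succ 0]
  simp [matE, inputVec, Matrix.fromBlocks_mulVec]

lemma smul_auxSeq_one_inl (hq : P.q ≠ 0) (K : Fin n → ℝ) (i : Fin n) (x : ℝ) :
    P.q * P.auxSeq v ξ 1 x (Sum.inl i) = (∑ j, P.AK K i j * P.auxSeq v ξ 0 x (Sum.inr j)) +
      P.B i * P.targetSeq K v ξ 0 x := by
  rw [auxSeq_succ K]
  simp [matE, inputVec, Matrix.fromBlocks_mulVec, Matrix.smul_mulVec]
  field_simp
  simp [Matrix.mulVec, dotProduct]

lemma auxSeq_two_inr (i : Fin n) (x : ℝ) :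
    P.auxSeq v ξ 2 x (Sum.inr i) = P.auxSeq v ξ 1 x (Sum.inl i) := by
  rw [auxSeq_succ 0]
  simp [matE, inputVec, Matrix.fromBlocks_mulVec]

lemma toL2_dotProduct_stateSeq (hv : MemH k v) {i : ℕ} (hi : i ≤ k) (r : Fin n ⊕ Fin n → ℝ) :
    toL2 (fun x => r ⬝ᵥ P.stateSeq v ξ i x) =
      ∑ a, r a • toL2 (fun x => P.stateSeq v ξ i x a) := by
  have h := fun a => (isPrim_stateSeq (P := P) (ξ := ξ) hv hi a).sqInt_self
  simp only [dotProduct]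
  rw [toL2_sum _ fun a _ => (h a).const_mul' (r a)]
  simp only [fun a => toL2_const_mul (r a) (h a)]

lemma toL2_stateSeq_succ (hv : MemH k v) {i : ℕ} (hi : i ≤ k) (a : Fin n ⊕ Fin n) :
    toL2 (fun x => P.stateSeq v ξ (i + 1) x a) =
      (∑ c, P.matD a c • toL2 (fun x => P.stateSeq v ξ i x c)) +
        P.inputVec a • toL2 (der i v) := by
  have h1 := hv.2 i hi
  have h2 := (isPrim_dotProduct_stateSeq (P := P) (ξ := ξ) hv hi (P.matD a)).sqInt_self
  rw [← toL2_dotProduct_stateSeq hv hi, ← toL2_const_mul _ h1, ← toL2_add h2 (h1.const_mul' _)]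
  simp only [stateSeq_succ, Pi.add_apply, Pi.smul_apply, smul_eq_mul, mul_comm]
  rfl

variable {c : ℕ → ℝ} {u : ℝ → ℝ → ℝ} {X : ℝ → Fin n → ℝ} {Z : ℝ → Fin m → ℝ}

namespace IsClosedLoopSolution

section

variable (h : P.IsClosedLoopSolution K c k u X Z)

include h

lemma memH {t : ℝ} (ht : 0 ≤ t) : MemH k (fun x => u x t) := h.regular.1 t ht

lemma hasDerivWithinAt_toL2_der {i : ℕ} (hi : i + 2 ≤ k) {t : ℝ} (ht : 0 ≤ t) :
    HasDerivWithinAt (fun t => toL2 (der i (fun x => u x t)))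
      (P.q • toL2 (der (i + 2) (fun x => u x t))) (Set.Ici 0) t :=
  h.heat.hasDerivWithinAt_der h.regular hi ht

lemma hasDerivWithinAt_der {i : ℕ} (hi : i + 3 ≤ k) {t : ℝ} (ht : 0 ≤ t) {x : ℝ}
    (hx : x = 0 ∨ x = 1) :
    HasDerivWithinAt (fun t => der i (fun x => u x t) x)
      (P.q * der (i + 2) (fun x => u x t) x) (Set.Ici 0) t :=
  hasDerivWithinAt_boundary (F := fun t => der i (fun x => u x t))
    (F₁ := fun t => der (i + 1) (fun x => u x t)) (G := fun t => der (i + 2) (fun x => u x t))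
    (G₁ := fun t => der (i + 3) (fun x => u x t))
    (fun _ hs => (h.memH hs).isPrim (by omega)) (fun _ hs => (h.memH hs).isPrim (by omega)) ht
    (h.hasDerivWithinAt_toL2_der (by omega) ht) (h.hasDerivWithinAt_toL2_der (by omega) ht) hx

lemma hasDerivWithinAt_data (hk : 2 ≤ k) {t : ℝ} (ht : 0 ≤ t) :
    HasDerivWithinAt (fun t => (inlMap (X t), toL2 (der 0 (fun x => u x t))))
      (inlMap (P.A *ᵥ X t + der 1 (fun x => u x t) 0 • P.B),
        toL2 (fun x => P.q * der 2 (fun x => u x t) x)) (Set.Ici 0) t := by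
  rw [toL2_const_mul _ ((h.memH ht).2 2 hk)]
  exact (hasDerivWithinAt_inlMap (h.odeX t ht)).prodMk (h.hasDerivWithinAt_toL2_der hk ht)

lemma hasDerivWithinAt_stateSeq_zero (hq : P.q ≠ 0) (hk : 2 ≤ k) {t : ℝ} (ht : 0 ≤ t) {x : ℝ}
    (hx : x ∈ Set.Icc (0 : ℝ) 1) :
    HasDerivWithinAt (fun t => P.stateSeq (fun x => u x t) (X t) 0 x)
      (P.q • P.stateSeq (fun x => u x t) (X t) 2 x) (Set.Ici 0) t := by
  refine hasDerivWithinAt_pi.2 fun a => ?_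
  obtain ⟨L, hL⟩ := exists_ltiEval P.matD P.inputVec hx a
  have h1 := L.hasFDerivAt.comp_hasDerivWithinAt t (h.hasDerivWithinAt_data hk ht)
  rw [hL _ _ (((h.memH ht).2 2 hk).const_mul' _),
    ← smul_stateSeq_two hq (h.memH ht) hk (h.left_bc t ht) hx] at h1
  exact h1.congr (fun s hs => (hL _ _ ((h.memH hs).2 0 (by omega))).symm)
    (hL _ _ ((h.memH ht).2 0 (by omega))).symm

lemma hasDerivWithinAt_toL2_stateSeq_zero (hq : P.q ≠ 0) (hk : 2 ≤ k) {t : ℝ} (ht : 0 ≤ t)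
    (a : Fin n ⊕ Fin n) :
    HasDerivWithinAt (fun t => toL2 (fun x => P.stateSeq (fun x => u x t) (X t) 0 x a))
      (P.q • toL2 (fun x => P.stateSeq (fun x => u x t) (X t) 2 x a)) (Set.Ici 0) t := by
  obtain ⟨L, hL⟩ := exists_ltiL2 P.matD P.inputVec a
  have h1 := L.hasFDerivAt.comp_hasDerivWithinAt t (h.hasDerivWithinAt_data hk ht)
  rw [hL _ _ (((h.memH ht).2 2 hk).const_mul' _), toL2_congr fun x hx => (congrFun
    (smul_stateSeq_two hq (h.memH ht) hk (h.left_bc t ht) hx) a).symm] at h1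
  rw [← toL2_const_mul _ (isPrim_stateSeq (h.memH ht) hk a).sqInt_self]
  exact h1.congr (fun s hs => (hL _ _ ((h.memH hs).2 0 (by omega))).symm)
    (hL _ _ ((h.memH ht).2 0 (by omega))).symm

lemma hasDerivWithinAt_stateSeq (hq : P.q ≠ 0) {i : ℕ} (hi : i + 2 ≤ k) {t : ℝ} (ht : 0 ≤ t)
    {x : ℝ} (hx : x = 0 ∨ x = 1) :
    HasDerivWithinAt (fun t => P.stateSeq (fun x => u x t) (X t) i x)
      (P.q • P.stateSeq (fun x => u x t) (X t) (i + 2) x) (Set.Ici 0) t := by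
  induction i with
  | zero =>
    exact h.hasDerivWithinAt_stateSeq_zero hq hi ht (by rcases hx with rfl | rfl <;> simp)
  | succ i ih =>
    have h1 := (hasDerivWithinAt_mulVec P.matD (ih (by omega))).add
      ((h.hasDerivWithinAt_der (i := i) (by omega) ht hx).smul_const P.inputVec)
    refine h1.congr_deriv ?_
    rw [show i + 1 + 2 = (i + 2) + 1 by ring, stateSeq_succ (i + 2), smul_add, Matrix.mulVec_smul,
      smul_smul]

lemma hasDerivWithinAt_toL2_stateSeq (hq : P.q ≠ 0) {i : ℕ} (hi : i + 2 ≤ k) {t : ℝ}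
    (ht : 0 ≤ t) (a : Fin n ⊕ Fin n) :
    HasDerivWithinAt (fun t => toL2 (fun x => P.stateSeq (fun x => u x t) (X t) i x a))
      (P.q • toL2 (fun x => P.stateSeq (fun x => u x t) (X t) (i + 2) x a)) (Set.Ici 0) t := by
  induction i generalizing a with
  | zero => exact h.hasDerivWithinAt_toL2_stateSeq_zero hq hi ht a
  | succ i ih =>
    have h1 := (HasDerivWithinAt.fun_sum (u := Finset.univ) fun c _ =>
      (ih (by omega) c).const_smul (P.matD a c)).add
      ((h.hasDerivWithinAt_toL2_der (i := i) (by omega) ht).const_smul (P.inputVec a))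
    refine (h1.congr (fun s hs => toL2_stateSeq_succ (h.memH hs) (by omega) a)
      (toL2_stateSeq_succ (h.memH ht) (by omega) a)).congr_deriv ?_
    rw [show i + 1 + 2 = (i + 2) + 1 by ring, toL2_stateSeq_succ (h.memH ht) (by omega) a,
      smul_add, Finset.smul_sum]
    simp only [smul_comm P.q]

lemma hasDerivWithinAt_toL2_dotProduct (hq : P.q ≠ 0) {i : ℕ} (hi : i + 2 ≤ k) {t : ℝ}
    (ht : 0 ≤ t) (r : Fin n ⊕ Fin n → ℝ) :
    HasDerivWithinAt (fun t => toL2 (fun x => r ⬝ᵥ P.stateSeq (fun x => u x t) (X t) i x))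
      (P.q • toL2 (fun x => r ⬝ᵥ P.stateSeq (fun x => u x t) (X t) (i + 2) x)) (Set.Ici 0) t := by
  have h1 := HasDerivWithinAt.fun_sum (u := Finset.univ) fun c _ =>
    (h.hasDerivWithinAt_toL2_stateSeq hq hi ht c).const_smul (r c)
  refine (h1.congr (fun s hs => toL2_dotProduct_stateSeq (h.memH hs) (by omega) r)
    (toL2_dotProduct_stateSeq (h.memH ht) (by omega) r)).congr_deriv ?_
  rw [toL2_dotProduct_stateSeq (h.memH ht) (by omega) r, Finset.smul_sum]
  simp only [smul_comm P.q]

lemma hasDerivWithinAt_toL2_targetSeq (hq : P.q ≠ 0) {i : ℕ} (hi : i + 2 ≤ k) {t : ℝ}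
    (ht : 0 ≤ t) :
    HasDerivWithinAt (fun t => toL2 (P.targetSeq K (fun x => u x t) (X t) i))
      (P.q • toL2 (P.targetSeq K (fun x => u x t) (X t) (i + 2))) (Set.Ici 0) t := by
  have e : ∀ s, 0 ≤ s → ∀ j ≤ k, toL2 (P.targetSeq K (fun x => u x s) (X s) j) =
      toL2 (der j (fun x => u x s)) -
        toL2 (fun x => P.rowD K ⬝ᵥ P.stateSeq (fun x => u x s) (X s) j x) := fun s hs j hj =>
    toL2_sub ((h.memH hs).2 j hj) (isPrim_dotProduct_stateSeq (h.memH hs) hj _).sqInt_self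
  rw [e t ht _ hi, smul_sub]
  exact ((h.hasDerivWithinAt_toL2_der hi ht).sub
    (h.hasDerivWithinAt_toL2_dotProduct hq hi ht _)).congr (fun s hs => e s hs i (by omega))
      (e t ht i (by omega))

lemma continuousOn_toL2_stateSeq (hq : P.q ≠ 0) (hk : 2 ≤ k) {i : ℕ} (hi : i ≤ k)
    (a : Fin n ⊕ Fin n) :
    ContinuousOn (fun t => toL2 (fun x => P.stateSeq (fun x => u x t) (X t) i x a))
      (Set.Ici 0) := by
  induction i generalizing a with
  | zero =>
    exact fun t ht => (h.hasDerivWithinAt_toL2_stateSeq hq hk ht a).continuousWithinAt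
  | succ i ih =>
    refine ContinuousOn.congr ?_ fun s hs => toL2_stateSeq_succ (h.memH hs) (by omega) a
    have h1 : ∀ c, ContinuousOn (fun t => P.matD a c •
        toL2 (fun x => P.stateSeq (fun x => u x t) (X t) i x c)) (Set.Ici 0) :=
      fun c => (ih (by omega) c).const_smul (P.matD a c)
    have h2 : ContinuousOn (fun t => P.inputVec a • toL2 (der i (fun x => u x t))) (Set.Ici 0) :=
      (h.regular.continuousOn (by omega)).const_smul (P.inputVec a)
    exact (continuousOn_finsetSum _ fun c _ => h1 c).add h2

lemma continuousOn_toL2_targetSeq (hq : P.q ≠ 0) (hk : 2 ≤ k) {i : ℕ} (hi : i ≤ k) :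
    ContinuousOn (fun t => toL2 (P.targetSeq K (fun x => u x t) (X t) i)) (Set.Ici 0) := by
  have h0 : ∀ a, ContinuousOn (fun t => P.rowD K a •
      toL2 (fun x => P.stateSeq (fun x => u x t) (X t) i x a)) (Set.Ici 0) := fun a =>
    (h.continuousOn_toL2_stateSeq hq hk hi a).const_smul (P.rowD K a)
  have h1 : ContinuousOn (fun t => toL2 (der i (fun x => u x t)) - ∑ a, P.rowD K a •
      toL2 (fun x => P.stateSeq (fun x => u x t) (X t) i x a)) (Set.Ici 0) :=
    (h.regular.continuousOn hi).sub (continuousOn_finsetSum _ fun a _ => h0 a)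
  refine h1.congr fun s hs => ?_
  beta_reduce
  rw [← toL2_dotProduct_stateSeq (h.memH hs) hi]
  exact toL2_sub ((h.memH hs).2 i hi) (isPrim_dotProduct_stateSeq (h.memH hs) hi _).sqInt_self

lemma hasDerivWithinAt_targetSeq (hq : P.q ≠ 0) {i : ℕ} (hi : i + 3 ≤ k) {t : ℝ} (ht : 0 ≤ t)
    {x : ℝ} (hx : x = 0 ∨ x = 1) :
    HasDerivWithinAt (fun t => P.targetSeq K (fun x => u x t) (X t) i x)
      (P.q * P.targetSeq K (fun x => u x t) (X t) (i + 2) x) (Set.Ici 0) t := by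
  rw [targetSeq, mul_sub, ← smul_eq_mul (a := P.q) (b := _ ⬝ᵥ _), ← dotProduct_smul]
  exact (h.hasDerivWithinAt_der hi ht hx).sub
    (hasDerivWithinAt_dotProduct _ (h.hasDerivWithinAt_stateSeq hq (by omega) ht hx))

/-- The actuator states are the time derivatives of `u(1,t)`. -/
lemma Z_eq (hk : 2 * m ≤ k) {j : ℕ} (hj : j < m) {t : ℝ} (ht : 0 ≤ t) :
    Z t ⟨j, hj⟩ = P.q ^ j * der (2 * j) (fun x => u x t) 1 := by
  induction j generalizing t with
  | zero =>
    have h1 := h.right_bc t ht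
    simp only [mul_zero, der_zero, pow_zero, one_mul, h1, dotProduct, Cz]
    rw [Finset.sum_eq_single ⟨0, hj⟩ (fun b _ hb => ?_) (by simp)]
    · simp
    · have : (b : ℕ) ≠ 0 := fun hb' => hb (Fin.ext hb')
      simp [this]
  | succ j ih =>
    have hj' : j < m := by omega
    have h1 := hasDerivWithinAt_pi.1 (h.odeZ t ht) ⟨j, hj'⟩
    have h2 := (h.hasDerivWithinAt_der (i := 2 * j) (by omega) ht (Or.inr rfl)).const_mul
      (P.q ^ j)
    have h3 := HasDerivWithinAt.unique_Ici ht h1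
      (h2.congr (fun s hs => ih hj' hs) (ih hj' ht))
    have hne : ¬ (j + 1 = m) := by omega
    rw [Pi.add_apply, Pi.smul_apply, Bz, if_neg hne, smul_zero, add_zero, Matrix.mulVec,
      dotProduct, Finset.sum_eq_single ⟨j + 1, hj⟩ (fun b _ hb => ?_) (by simp)] at h3
    · simp only [Az, Matrix.of_apply, if_neg hne, if_true, one_mul] at h3
      rw [h3, show 2 * (j + 1) = 2 * j + 2 by ring]
      ring
    · have : (b : ℕ) ≠ j + 1 := fun hb' => hb (Fin.ext hb')
      simp [Az, hne, this]

/-- The spatial derivatives of even order of the state at `x = 0`. -/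
lemma smul_stateSeq_two_mul (hq : P.q ≠ 0) (hk : 2 * m ≤ k) {j : ℕ} (hj : j ≤ m) {t : ℝ}
    (ht : 0 ≤ t) : P.q ^ j • P.stateSeq (fun x => u x t) (X t) (2 * j) 0 =
      inlMap ((P.A ^ j) *ᵥ X t + ∑ l ∈ Finset.range j,
        (P.q ^ l * der (2 * l + 1) (fun x => u x t) 0) • ((P.A ^ (j - 1 - l)) *ᵥ P.B)) := by
  induction j generalizing t with
  | zero => simp [stateSeq_zero_zero, inlMap_apply]
  | succ j ih =>
    have h1 := (h.hasDerivWithinAt_stateSeq hq (i := 2 * j) (by omega) ht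
      (Or.inl rfl)).const_smul (P.q ^ j)
    have h2 := hasDerivWithinAt_inlMap ((hasDerivWithinAt_mulVec (P.A ^ j) (h.odeX t ht)).add
      (HasDerivWithinAt.fun_sum (u := Finset.range j) fun l hl =>
        ((h.hasDerivWithinAt_der (i := 2 * l + 1)
          (by have := Finset.mem_range.1 hl; omega) ht (Or.inl rfl)).const_mul
            (P.q ^ l)).smul_const ((P.A ^ (j - 1 - l)) *ᵥ P.B)))
    have h3 := HasDerivWithinAt.unique_Ici ht h1
      (h2.congr (fun s hs => ih (by omega) hs) (ih (by omega) ht))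
    rw [smul_smul, ← pow_succ] at h3
    rw [show 2 * (j + 1) = 2 * j + 2 by ring, h3, Finset.sum_range_succ', Matrix.mulVec_add,
      Matrix.mulVec_mulVec, ← pow_succ, Matrix.mulVec_smul]
    congr 1
    rw [add_assoc]
    congr 1
    rw [add_comm]
    congr 1
    · refine Finset.sum_congr rfl fun l hl => ?_
      rw [show j + 1 - 1 - (l + 1) = j - 1 - l by omega,
        show 2 * (l + 1) + 1 = 2 * l + 1 + 2 by ring]
      congr 1
      ring
    · simp

lemma targetSeq_two_mul_zero (hq : P.q ≠ 0) {j : ℕ} (hj : 2 * j + 1 ≤ k) {t : ℝ} (ht : 0 ≤ t) :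
    P.targetSeq K (fun x => u x t) (X t) (2 * j) 0 = 0 := by
  induction j generalizing t with
  | zero =>
    rw [targetSeq, mul_zero, stateSeq_zero_zero, der_zero, h.left_bc t ht, rowD]
    simp
  | succ j ih =>
    have h1 := h.hasDerivWithinAt_targetSeq (K := K) hq (i := 2 * j) (by omega) ht (Or.inl rfl)
    have h2 := HasDerivWithinAt.unique_Ici ht h1
      ((hasDerivWithinAt_const t (Set.Ici 0) (0 : ℝ)).congr (fun s hs => ih (by omega) hs)
        (ih (by omega) ht))
    exact (mul_eq_zero.1 h2).resolve_left hq

end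

end IsClosedLoopSolution
end Plant
end SandwichedHeat

namespace SandwichedHeat

open MeasureTheory
open scoped RealInnerProductSpace

/-! ### The boundary dynamics at `x = 1` -/

variable {n m : ℕ}

lemma tau_succ (c : ℕ → ℝ) (i : ℕ) : tau c (i + 1) =
    Polynomial.X * tau c i + yPoly c i + Polynomial.C (c (i + 1)) * yPoly c (i + 1) := by
  cases i with
  | zero => simp [tau, yPoly]
  | succ i => rfl

lemma X_mul_yPoly (c : ℕ → ℝ) (i : ℕ) : Polynomial.X * yPoly c (i + 1) =
    yPoly c (i + 2) - yPoly c i - Polynomial.C (c (i + 1)) * yPoly c (i + 1) := by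
  have h1 : yPoly c (i + 2) = Polynomial.X ^ (i + 1) + tau c (i + 1) := rfl
  have h2 : yPoly c (i + 1) = Polynomial.X ^ i + tau c i := rfl
  rw [h1, tau_succ, h2]
  ring

lemma coeff_tau_eq_zero (c : ℕ → ℝ) (i : ℕ) : ∀ j, i ≤ j → (tau c i).coeff j = 0 := by
  induction i using Nat.twoStepInduction with
  | zero => simp [tau]
  | one =>
    intro j hj
    rw [tau, Polynomial.coeff_C, if_neg (by omega)]
  | more i h1 h2 =>
    intro j hj
    obtain ⟨j, rfl⟩ : ∃ l, j = l + 1 := ⟨j - 1, by omega⟩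
    have e1 : (Polynomial.X ^ i : Polynomial ℝ).coeff (j + 1) = 0 := by
      rw [Polynomial.coeff_X_pow, if_neg (by omega)]
    have e2 : (Polynomial.X ^ (i + 1) : Polynomial ℝ).coeff (j + 1) = 0 := by
      rw [Polynomial.coeff_X_pow, if_neg (by omega)]
    simp only [tau, Polynomial.coeff_add, Polynomial.coeff_X_mul, Polynomial.coeff_C_mul, e1, e2,
      h1 (j + 1) (by omega), h2 j (by omega), h2 (j + 1) (by omega)]
    ring

lemma coeff_yPoly_eq_zero (c : ℕ → ℝ) (i : ℕ) {j : ℕ} (hj : i ≤ j) : (yPoly c i).coeff j = 0 := by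
  cases i with
  | zero => simp [yPoly]
  | succ i =>
    rw [yPoly, Polynomial.coeff_add, Polynomial.coeff_X_pow, if_neg (by omega),
      coeff_tau_eq_zero c i j (by omega), add_zero]

/-- The polynomial `∑ p_i s^i`, truncated at degree `m`, with `ω_i` in the place of `s^i`. -/
def evalSeq (m : ℕ) (p : Polynomial ℝ) (ω : ℕ → ℝ) : ℝ := ∑ i ∈ Finset.range m, p.coeff i * ω i

lemma evalSeq_add (p r : Polynomial ℝ) (ω : ℕ → ℝ) :
    evalSeq m (p + r) ω = evalSeq m p ω + evalSeq m r ω := by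
  simp [evalSeq, add_mul, Finset.sum_add_distrib]

lemma evalSeq_sub (p r : Polynomial ℝ) (ω : ℕ → ℝ) :
    evalSeq m (p - r) ω = evalSeq m p ω - evalSeq m r ω := by
  simp [evalSeq, sub_mul, Finset.sum_sub_distrib]

lemma evalSeq_C_mul (a : ℝ) (p : Polynomial ℝ) (ω : ℕ → ℝ) :
    evalSeq m (Polynomial.C a * p) ω = a * evalSeq m p ω := by
  simp [evalSeq, mul_assoc, Finset.mul_sum]

lemma evalSeq_X_pow {i : ℕ} (hi : i < m) (ω : ℕ → ℝ) :
    evalSeq m (Polynomial.X ^ i) ω = ω i := by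
  simp [evalSeq, Polynomial.coeff_X_pow, hi]

/-- Multiplication by the variable is differentiation in time, as long as the degree is small. -/
lemma hasDerivWithinAt_evalSeq {p : Polynomial ℝ} (hp : ∀ j, m ≤ j + 1 → p.coeff j = 0)
    {ω : ℕ → ℝ → ℝ} {s : Set ℝ} {t : ℝ}
    (hω : ∀ j, j + 1 < m → HasDerivWithinAt (ω j) (ω (j + 1) t) s t) :
    HasDerivWithinAt (fun t => evalSeq m p fun j => ω j t)
      (evalSeq m (Polynomial.X * p) fun j => ω j t) s t := by
  cases m with
  | zero => simpa [evalSeq] using hasDerivWithinAt_const t s (0 : ℝ)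
  | succ m =>
    have h1 : ∀ t, (evalSeq (m + 1) p fun j => ω j t) =
        ∑ j ∈ Finset.range m, p.coeff j * ω j t := fun t => by
      rw [evalSeq, Finset.sum_range_succ, hp m le_rfl, zero_mul, add_zero]
    simp only [h1]
    rw [evalSeq, Finset.sum_range_succ', Polynomial.coeff_X_mul_zero, zero_mul, add_zero]
    simp only [Polynomial.coeff_X_mul]
    exact HasDerivWithinAt.fun_sum fun j hj =>
      (hω j (by have := Finset.mem_range.1 hj; omega)).const_mul _

/-- The coupling matrix of the boundary states `y_1, …, y_m`. -/
def skewMat (m : ℕ) : Matrix (Fin m) (Fin m) ℝ := Matrix.of fun i j =>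
  (if (j : ℕ) = i + 1 then 1 else 0) - (if (i : ℕ) = j + 1 then 1 else 0)

lemma sum_skewMat_mul {g : ℕ → ℝ} (hg : g 0 = 0) (i : Fin m) :
    ∑ j : Fin m, skewMat m i j * g (j + 1) = (if (i : ℕ) + 1 < m then g (i + 2) else 0) - g i := by
  simp only [skewMat, Matrix.of_apply, sub_mul, ite_mul, one_mul, zero_mul, Finset.sum_sub_distrib]
  congr 1
  · split_ifs with h
    · rw [Finset.sum_eq_single ⟨i + 1, h⟩ (fun b _ hb => ?_) (by simp)]
      · simp
      · rw [if_neg fun hb' => hb (Fin.ext hb')]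
    · exact Finset.sum_eq_zero fun b _ => if_neg (by omega)
  · rcases Nat.eq_zero_or_pos i with h | h
    · rw [h, hg]
      exact Finset.sum_eq_zero fun b _ => if_neg (by omega)
    · rw [Finset.sum_eq_single ⟨i - 1, by omega⟩ (fun b _ hb => ?_) (by simp)]
      · simp only
        rw [if_pos (by omega), show (i : ℕ) - 1 + 1 = i by omega]
      · rw [if_neg fun hb' => hb (Fin.ext (by simp only; omega))]

/-- Differentiation of `y_i = ev(yPoly c i)` along a chain `ω_0, …, ω_{m-1}` of time derivatives in
which the last member is subject to the feedback `-∑ (α_i + c_m β_i) ω_i`. -/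
lemma hasDerivWithinAt_evalSeq_yPoly {c : ℕ → ℝ} {ω : ℕ → ℝ → ℝ} {N : ℝ} {s : Set ℝ} {t : ℝ}
    (hω : ∀ j, j + 1 < m → HasDerivWithinAt (ω j) (ω (j + 1) t) s t)
    (hlast : HasDerivWithinAt (ω (m - 1))
      (-(∑ i ∈ Finset.range m, (alpha c m i + c m * beta c m i) * ω i t) + N) s t) (i : Fin m) :
    HasDerivWithinAt (fun t => evalSeq m (yPoly c (i + 1)) fun j => ω j t)
      (-c (i + 1) * evalSeq m (yPoly c (i + 1)) (fun j => ω j t) +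
        ∑ j : Fin m, skewMat m i j * evalSeq m (yPoly c (j + 1)) (fun j => ω j t) +
          if (i : ℕ) + 1 = m then N else 0) s t := by
  have hz : evalSeq m (yPoly c 0) (fun j => ω j t) = 0 := by simp [yPoly, evalSeq]
  rw [sum_skewMat_mul (g := fun l => evalSeq m (yPoly c l) (fun j => ω j t)) hz i]
  rcases Nat.lt_or_ge (i + 1) m with hi | hi
  · rw [if_pos hi, if_neg hi.ne]
    refine (hasDerivWithinAt_evalSeq (p := yPoly c (i + 1))
      (fun j hj => coeff_yPoly_eq_zero c _ (by omega)) hω).congr_deriv ?_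
    rw [X_mul_yPoly, evalSeq_sub, evalSeq_sub, evalSeq_C_mul]
    ring
  · have him : (i : ℕ) + 1 = m := by omega
    have hm1 : m - 1 = i := by omega
    rw [if_neg (by omega), if_pos him]
    have e1 : ∀ t, (evalSeq m (yPoly c (i + 1)) fun j => ω j t) =
        ω (m - 1) t + evalSeq m (tau c i) fun j => ω j t := fun t => by
      rw [yPoly, evalSeq_add, evalSeq_X_pow i.2, hm1]
    have e2 : ∑ l ∈ Finset.range m, (alpha c m l + c m * beta c m l) * ω l t =
        (evalSeq m (yPoly c i) fun j => ω j t) +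
          (evalSeq m (Polynomial.X * tau c i) fun j => ω j t) +
          c m * evalSeq m (yPoly c (i + 1)) fun j => ω j t := by
      rw [← evalSeq_add, ← evalSeq_C_mul, ← evalSeq_add, evalSeq]
      refine Finset.sum_congr rfl fun l _ => ?_
      rw [alpha, beta, hm1, Polynomial.coeff_add (yPoly c i + _), Polynomial.coeff_C_mul, him]
    have h2 := hlast.add (hasDerivWithinAt_evalSeq (p := tau c i)
      (fun j hj => coeff_tau_eq_zero c _ j (by omega)) hω)
    refine (h2.congr (fun r _ => e1 r) (e1 t)).congr_deriv ?_
    rw [e2, him]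
    ring

namespace Plant

variable (P : Plant n m) (K : Fin n → ℝ)

/-- The time derivative of order `j` of `w(1,t)`, in terms of spatial derivatives. -/
def bdryVal (v : ℝ → ℝ) (ξ : Fin n → ℝ) (j : ℕ) : ℝ := P.q ^ j * P.targetSeq K v ξ (2 * j) 1

/-- The closed loop at the boundary `x = 1`: the feedback cancels everything but a linear
functional of the state of the system in `x` at `x = 1` and of `X`. -/
theorem exists_boundary_ode (hq : P.q ≠ 0) (hm : 0 < m) :
    ∃ (L : (Fin n ⊕ Fin n → ℝ) →ₗ[ℝ] ℝ) (L₀ : (Fin n → ℝ) →ₗ[ℝ] ℝ),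
      ∀ (c : ℕ → ℝ) (k : ℕ) (u : ℝ → ℝ → ℝ) (X : ℝ → Fin n → ℝ) (Z : ℝ → Fin m → ℝ),
        P.IsClosedLoopSolution K c k u X Z → 2 * m ≤ k → ∀ t, 0 ≤ t →
        HasDerivWithinAt (fun t => P.bdryVal K (fun x => u x t) (X t) (m - 1))
          (-(∑ i ∈ Finset.range m, (alpha c m i + c m * beta c m i) *
            P.bdryVal K (fun x => u x t) (X t) i) +
            (L (P.auxSeq (fun x => u x t) (X t) 0 1) - L₀ (X t))) (Set.Ici 0) t := by
  obtain ⟨L, hL⟩ := P.exists_linear_right K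
  obtain ⟨L₀, hL₀⟩ := P.exists_linear_left K
  refine ⟨L, L₀, fun c k u X Z h hk t ht => ?_⟩
  have hm1 : m - 1 < m := by omega
  have e1 : ∀ s, 0 ≤ s → P.bdryVal K (fun x => u x s) (X s) (m - 1) =
      Z s ⟨m - 1, hm1⟩ - P.q ^ (m - 1) *
        (P.rowD K ⬝ᵥ P.stateSeq (fun x => u x s) (X s) (2 * (m - 1)) 1) := fun s hs => by
    rw [h.Z_eq hk hm1 hs, bdryVal, targetSeq, mul_sub]
  have h1 := hasDerivWithinAt_pi.1 (h.odeZ t ht) ⟨m - 1, hm1⟩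
  have h2 := (hasDerivWithinAt_dotProduct (P.rowD K) (h.hasDerivWithinAt_stateSeq hq
    (i := 2 * (m - 1)) (by omega) ht (Or.inr rfl))).const_mul (P.q ^ (m - 1))
  refine ((h1.sub h2).congr e1 (e1 t ht)).congr_deriv ?_
  have e2 : (P.Az *ᵥ Z t + P.controlLaw K c (fun x => u x t) (X t) • P.Bz) ⟨m - 1, hm1⟩ =
      (∑ k : Fin m, P.abar k * (P.q ^ (k : ℕ) * der (2 * (k : ℕ)) (fun x => u x t) 1)) +
        P.controlLaw K c (fun x => u x t) (X t) := by
    have hmm : m - 1 + 1 = m := by omega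
    simp only [Pi.add_apply, Pi.smul_apply, Bz, Az, Matrix.mulVec, dotProduct, Matrix.of_apply,
      hmm, if_true, smul_eq_mul, mul_one]
    congr 1
    exact Finset.sum_congr rfl fun j _ => by rw [h.Z_eq hk j.2 ht]
  rw [e2, controlLaw_eq (h.memH ht) hk, ← hL, ← hL₀ _ _ (h.smul_stateSeq_two_mul hq hk le_rfl ht),
    seqL, dotProduct_smul, smul_eq_mul, ← mul_assoc, ← pow_succ, show m - 1 + 1 = m by omega,
    show 2 * (m - 1) + 2 = 2 * m by omega]
  have e3 : ∑ i ∈ Finset.range m, (alpha c m i + c m * beta c m i) *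
      P.bdryVal K (fun x => u x t) (X t) i = ∑ i ∈ Finset.range m, P.q ^ i *
        (alpha c m i + c m * beta c m i) * P.targetSeq K (fun x => u x t) (X t) (2 * i) 1 :=
    Finset.sum_congr rfl fun i _ => by rw [bdryVal]; ring
  rw [e3]
  ring

variable {P K} in
lemma IsClosedLoopSolution.hasDerivWithinAt_bdryVal {c : ℕ → ℝ} {k : ℕ} {u : ℝ → ℝ → ℝ}
    {X : ℝ → Fin n → ℝ} {Z : ℝ → Fin m → ℝ} (h : P.IsClosedLoopSolution K c k u X Z)
    (hq : P.q ≠ 0) (hk : 2 * m ≤ k) {j : ℕ} (hj : j + 1 < m) {t : ℝ} (ht : 0 ≤ t) :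
    HasDerivWithinAt (fun t => P.bdryVal K (fun x => u x t) (X t) j)
      (P.bdryVal K (fun x => u x t) (X t) (j + 1)) (Set.Ici 0) t := by
  refine ((h.hasDerivWithinAt_targetSeq (K := K) hq (i := 2 * j) (by omega) ht
    (Or.inr rfl)).const_mul (P.q ^ j)).congr_deriv ?_
  rw [bdryVal, show 2 * (j + 1) = 2 * j + 2 by ring]
  ring

end Plant

/-! ### The states at the boundary as functionals of the target variables -/

/-- Boundary values of an `H²` function and its derivative as functionals of the function and its
second derivative. -/
lemma IsPrim.inner_quadratic {f f₁ f₂ : ℝ → ℝ} (hf : IsPrim f f₁) (hf₁ : IsPrim f₁ f₂) (a b : ℝ) :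
    ⟪toL2 f₂, toL2 (fun x => a + b * x - x ^ 2)⟫ + 2 * ⟪toL2 f, toL2 (fun _ => 1)⟫ =
      f₁ 1 * (a + b - 1) - f₁ 0 * a - f 1 * (b - 2) + f 0 * b := by
  have hg : IsPrim (fun x : ℝ => a + b * x - x ^ 2) (fun x => b - 2 * x) :=
    isPrim_of_hasDerivAt (fun x => by
      have := (((hasDerivAt_id x).const_mul b).const_add a).sub (hasDerivAt_pow 2 x)
      exact this.congr_deriv (by simp)) (by fun_prop)
  have hg₁ : IsPrim (fun x : ℝ => b - 2 * x) (fun _ => -2 * 1) :=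
    isPrim_of_hasDerivAt (fun x => by
      simpa using ((hasDerivAt_id x).const_mul 2).const_sub b) (by fun_prop)
  have h1 := hf₁.inner_eq hg
  have h2 := hf.inner_eq hg₁
  rw [toL2_const_mul (-2) (sqInt_of_continuousOn continuousOn_const), inner_smul_right] at h2
  norm_num at h1 h2
  linarith

end SandwichedHeat

namespace SandwichedHeat

open MeasureTheory
open scoped RealInnerProductSpace

variable {n m : ℕ}

namespace Plant

variable (P : Plant n m) (K : Fin n → ℝ)

/-- The second component of the state of the system in `x`, as a vector of elements of
`L²(0,1)`. -/
def auxL2 (v : ℝ → ℝ) (ξ : Fin n → ℝ) : PiLp 2 (fun _ : Fin n => L2) :=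
  WithLp.toLp 2 fun i => toL2 (fun x => P.auxSeq v ξ 0 x (Sum.inr i))

/-- Multiplication by `B`. -/
def mulB : L2 →L[ℝ] PiLp 2 (fun _ : Fin n => L2) :=
  ((PiLp.continuousLinearEquiv 2 ℝ (fun _ : Fin n => L2)).symm : _ →L[ℝ] _) ∘L
    ContinuousLinearMap.pi fun i => P.B i • ContinuousLinearMap.id ℝ L2

@[simp] lemma mulB_apply (w : L2) (i : Fin n) : P.mulB w i = P.B i • w := by
  simp [mulB]

/-- The right-hand side `(A + B K) p + B w` of the equation for `p`. -/
def auxRhs (i : Fin n) : L2 × PiLp 2 (fun _ : Fin n => L2) →L[ℝ] L2 :=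
  PiLp.proj 2 (fun _ : Fin n => L2) i ∘L
    (matAct (P.AK K) ∘L ContinuousLinearMap.snd ℝ _ _ + P.mulB ∘L ContinuousLinearMap.fst ℝ _ _)

lemma auxRhs_apply (i : Fin n) (w : L2) (p : PiLp 2 (fun _ : Fin n => L2)) :
    P.auxRhs K i (w, p) = (matAct (P.AK K) p + P.mulB w) i := rfl

variable {P} {v : ℝ → ℝ} {ξ : Fin n → ℝ} {k : ℕ}

lemma auxRhs_eq (hq : P.q ≠ 0) (hv : MemH k v) (hk : 0 < k) (i : Fin n) :
    P.auxRhs K i (toL2 (P.targetSeq K v ξ 0), P.auxL2 v ξ) =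
      P.q • toL2 (fun x => P.auxSeq v ξ 1 x (Sum.inl i)) := by
  have h1 : ∀ a, SqInt (fun x => P.auxSeq v ξ 0 x a) := fun a =>
    (isPrim_auxSeq hv (Nat.zero_le k) a).sqInt_self
  have h2 : SqInt (P.targetSeq K v ξ 0) := (isPrim_targetSeq hv hk).sqInt_self
  have h3 : SqInt (fun x => P.auxSeq v ξ 1 x (Sum.inl i)) :=
    (isPrim_auxSeq hv hk (Sum.inl i)).sqInt_self
  rw [auxRhs_apply, ← toL2_const_mul _ h3]
  simp only [smul_auxSeq_one_inl hq K]
  rw [toL2_add (sqInt_sum _ fun j _ => (h1 (Sum.inr j)).const_mul' _) (h2.const_mul' _),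
    toL2_sum _ fun j _ => (h1 (Sum.inr j)).const_mul' _, toL2_const_mul _ h2]
  simp only [fun j => toL2_const_mul (P.AK K i j) (h1 (Sum.inr j))]
  simp [auxL2]

/-- The values at `x = 0` and `x = 1` of the state of the system in `x` are continuous functionals
of its second component and of the target variable. -/
lemma exists_trace (hq : P.q ≠ 0) :
    ∃ G : L2 × PiLp 2 (fun _ : Fin n => L2) →L[ℝ] (Fin n ⊕ Fin n → ℝ) × (Fin n → ℝ),
      ∀ (v : ℝ → ℝ) (ξ : Fin n → ℝ) (k : ℕ), MemH k v → 0 < k →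
        G (toL2 (P.targetSeq K v ξ 0), P.auxL2 v ξ) = (P.auxSeq v ξ 0 1, ξ) := by
  obtain ⟨F, hF⟩ : ∃ F : ℝ → ℝ → Fin n → L2 × PiLp 2 (fun _ : Fin n => L2) →L[ℝ] ℝ,
      F = fun a b i => P.q⁻¹ • (innerSL ℝ (toL2 fun x => a + b * x - x ^ 2)) ∘L P.auxRhs K i +
        (2 : ℝ) • (innerSL ℝ (toL2 fun _ => 1)) ∘L PiLp.proj 2 (fun _ : Fin n => L2) i ∘L
          ContinuousLinearMap.snd ℝ _ _ := ⟨_, rfl⟩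
  have key : ∀ (v : ℝ → ℝ) (ξ : Fin n → ℝ) (k : ℕ), MemH k v → 0 < k → ∀ a b i,
      F a b i (toL2 (P.targetSeq K v ξ 0), P.auxL2 v ξ) =
        P.auxSeq v ξ 0 1 (Sum.inl i) * (a + b - 1) - ξ i * a -
          P.auxSeq v ξ 0 1 (Sum.inr i) * (b - 2) := by
    intro v ξ k hv hk a b i
    have h1 : IsPrim (fun x => P.auxSeq v ξ 0 x (Sum.inr i))
        (fun x => P.auxSeq v ξ 0 x (Sum.inl i)) :=
      (isPrim_auxSeq hv (Nat.zero_le k) (Sum.inr i)).congr (fun _ _ => rfl)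
        fun x _ => auxSeq_one_inr i x
    have h2 := h1.inner_quadratic (isPrim_auxSeq hv (Nat.zero_le k) (Sum.inl i)) a b
    rw [auxSeq_zero_zero] at h2
    simp only [Sum.elim_inl, Sum.elim_inr, Pi.zero_apply, zero_mul, add_zero] at h2
    rw [← h2, hF]
    simp only [add_apply, smul_apply,
      ContinuousLinearMap.comp_apply, ContinuousLinearMap.coe_snd', auxRhs_eq K hq hv hk,
      innerSL_apply_apply, inner_smul_right, smul_eq_mul, PiLp.proj_apply]
    rw [inv_mul_cancel_left₀ hq, real_inner_comm, real_inner_comm (toL2 fun _ => 1)]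
    rfl
  refine ⟨(ContinuousLinearMap.pi (Sum.elim (F 0 2) (F 0 1))).prod
    (ContinuousLinearMap.pi (F (-1) 2)), fun v ξ k hv hk => ?_⟩
  have hkey := key v ξ k hv hk
  refine Prod.ext (funext fun a => ?_) (funext fun i => ?_)
  · rcases a with i | i
    · exact (hkey 0 2 i).trans (by ring)
    · exact (hkey 0 1 i).trans (by ring)
  · exact (hkey (-1) 2 i).trans (by ring)

/-- The first component of the state of the system in `x` is the derivative of the second one, so
it is bounded by the second component and the target variable. -/
lemma exists_norm_aux_inl_le (hq : P.q ≠ 0) : ∃ C, 0 ≤ C ∧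
    ∀ (v : ℝ → ℝ) (ξ : Fin n → ℝ) (k : ℕ), MemH k v → 0 < k → ∀ a,
      ‖toL2 (fun x => P.auxSeq v ξ 0 x a)‖ ≤
        C * (‖toL2 (P.targetSeq K v ξ 0)‖ + ‖P.auxL2 v ξ‖) := by
  obtain ⟨G, hG⟩ := exists_trace (P := P) K hq
  obtain ⟨R, hR⟩ : ∃ R, R = ∑ i, ‖P.auxRhs K i‖ := ⟨_, rfl⟩
  have hR0 : 0 ≤ R := by rw [hR]; exact Finset.sum_nonneg fun _ _ => norm_nonneg _
  have hRi : ∀ i, ‖P.auxRhs K i‖ ≤ R := fun i => by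
    rw [hR]
    exact Finset.single_le_sum (f := fun i => ‖P.auxRhs K i‖) (fun _ _ => norm_nonneg _)
      (Finset.mem_univ i)
  refine ⟨‖G‖ + |P.q|⁻¹ * R + 1, by positivity, fun v ξ k hv hk a => ?_⟩
  obtain ⟨z, hz⟩ : ∃ z, z = (toL2 (P.targetSeq K v ξ 0), P.auxL2 v ξ) := ⟨_, rfl⟩
  have hzle : ‖z‖ ≤ ‖toL2 (P.targetSeq K v ξ 0)‖ + ‖P.auxL2 v ξ‖ := by
    rw [hz, Prod.norm_def]
    exact max_le (le_add_of_nonneg_right (norm_nonneg _)) (le_add_of_nonneg_left (norm_nonneg _))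
  refine le_trans ?_ (mul_le_mul_of_nonneg_left hzle (by positivity))
  have hpos : 0 ≤ |P.q|⁻¹ * R := by positivity
  rcases a with i | i
  · have h1 := isPrim_auxSeq (P := P) (ξ := ξ) hv (Nat.zero_le k) (Sum.inl i)
    have hder : ‖toL2 (fun x => P.auxSeq v ξ 1 x (Sum.inl i))‖ ≤ |P.q|⁻¹ * R * ‖z‖ := by
      have h2 := auxRhs_eq (ξ := ξ) K hq hv hk i
      rw [← hz] at h2
      have h3 : toL2 (fun x => P.auxSeq v ξ 1 x (Sum.inl i)) = P.q⁻¹ • P.auxRhs K i z := by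
        rw [h2, smul_smul, inv_mul_cancel₀ hq, one_smul]
      rw [h3, norm_smul, norm_inv, Real.norm_eq_abs, mul_assoc]
      gcongr
      exact (P.auxRhs K i).le_of_opNorm_le (hRi i) z
    have hξ : |ξ i| ≤ ‖G‖ * ‖z‖ := by
      have h2 := G.le_opNorm z
      rw [hz, hG v ξ k hv hk, ← hz] at h2
      exact (norm_le_pi_norm ξ i).trans ((norm_snd_le (P.auxSeq v ξ 0 1, ξ)).trans h2)
    refine (norm_toL2_le_of_bound h1.sqInt_self (C := |ξ i| + |P.q|⁻¹ * R * ‖z‖)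
      (by positivity) fun x hx => ?_).trans ?_
    · refine (h1.abs_le hx).trans (add_le_add (le_of_eq ?_) hder)
      rw [auxSeq_zero_zero]
      rfl
    · have := norm_nonneg z
      linarith
  · have h1 : toL2 (fun x => P.auxSeq v ξ 0 x (Sum.inr i)) = z.2 i := by rw [hz]; rfl
    rw [h1]
    have h2 := (PiLp.norm_apply_le z.2 i).trans (norm_snd_le z)
    have := norm_nonneg z
    have : 0 ≤ (‖G‖ + |P.q|⁻¹ * R) * ‖z‖ := by positivity
    linarith

end Plant

end SandwichedHeat

namespace SandwichedHeat

open MeasureTheory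
open scoped RealInnerProductSpace

/-! ### Chains of time derivatives of a target solution -/

section Chain

variable {H Hp Y : Type*} [NormedAddCommGroup H] [InnerProductSpace ℝ H]
  [NormedAddCommGroup Hp] [InnerProductSpace ℝ Hp] [NormedAddCommGroup Y] [InnerProductSpace ℝ Y]

/-- A solution of a target system with time derivatives up to order `N + 1`: `W j`, `W1 j` and
`g j` are the time derivatives of order `j` of `W 0`, of its spatial derivative and of its boundary
value. -/
structure TargetSystem.IsChain (S : TargetSystem H Hp Y) (Ay : Y →L[ℝ] Y) (N : ℕ)
    (W W1 : ℕ → ℝ → H) (g : ℕ → ℝ → ℝ) (p : ℝ → Hp) (y : ℝ → Y) : Prop where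
  mem : ∀ j ≤ N, ∀ t, 0 ≤ t → (W j t, W1 j t, W (j + 1) t, g j t) ∈ S.graph
  cont : ∀ j ≤ N, ContinuousOn (W (j + 1)) (Set.Ici 0)
  derivW : ∀ j ≤ N, ∀ t, 0 ≤ t → HasDerivWithinAt (W j) (W (j + 1) t) (Set.Ici 0) t
  derivg : ∀ j < N, ∀ t, 0 ≤ t → HasDerivWithinAt (g j) (g (j + 1) t) (Set.Ici 0) t
  first : ∀ t, 0 ≤ t → g 0 t = S.first (y t)
  derivp : ∀ t, 0 ≤ t → HasDerivWithinAt p (S.M (p t) + S.Bp (W 0 t)) (Set.Ici 0) t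
  derivy : ∀ t, 0 ≤ t →
    HasDerivWithinAt y (Ay (y t) + S.N (W 0 t, p t) • S.e) (Set.Ici 0) t

namespace TargetSystem

variable {S : TargetSystem H Hp Y} {Ay : Y →L[ℝ] Y} {N : ℕ} {W W1 : ℕ → ℝ → H} {g : ℕ → ℝ → ℝ}
  {p : ℝ → Hp} {y : ℝ → Y}

lemma IsChain.isSolution (h : S.IsChain Ay N W W1 g p y) :
    S.IsSolution Ay (W 0) (W1 0) (W 1) p y where
  mem t ht := by rw [← h.first t ht]; exact h.mem 0 (Nat.zero_le _) t ht
  cont := h.cont 0 (Nat.zero_le _)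
  derivW := h.derivW 0 (Nat.zero_le _)
  derivp := h.derivp
  derivy := h.derivy

/-- The time derivative of a chain is a chain. -/
lemma IsChain.tail (h : S.IsChain Ay (N + 1) W W1 g p y) :
    S.IsChain Ay N (fun j => W (j + 1)) (fun j => W1 (j + 1)) (fun j => g (j + 1))
      (fun t => S.M (p t) + S.Bp (W 0 t)) (fun t => Ay (y t) + S.N (W 0 t, p t) • S.e) := by
  have hfirst : ∀ t, 0 ≤ t → g 1 t = S.first (Ay (y t) + S.N (W 0 t, p t) • S.e) := fun t ht => by
    have h1 := S.first.hasFDerivAt.comp_hasDerivWithinAt t (h.derivy t ht)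
    exact HasDerivWithinAt.unique_Ici ht (h.derivg 0 (Nat.succ_pos N) t ht)
      (h1.congr (fun s hs => h.first s hs) (h.first t ht))
  have hsol := h.isSolution.deriv (W1' := W1 1) (W'' := W 2)
    (fun t ht => by rw [← hfirst t ht]; exact h.mem 1 (by omega) t ht)
    (h.cont 1 (by omega)) (h.derivW 1 (by omega))
  exact ⟨fun j hj => h.mem (j + 1) (by omega), fun j hj => h.cont (j + 1) (by omega),
    fun j hj => h.derivW (j + 1) (by omega), fun j hj => h.derivg (j + 1) (by omega), hfirst,
    hsol.derivp, hsol.derivy⟩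

lemma le_sqrt_mul_exp {a B κ t : ℝ} (hB : 0 ≤ B) (h : a ^ 2 ≤ B * Real.exp (-κ * t)) :
    a ≤ (Real.sqrt B + 1) * Real.exp (-(κ / 2) * t) := by
  have h1 : (Real.sqrt B * Real.exp (-(κ / 2) * t)) ^ 2 = B * Real.exp (-κ * t) := by
    rw [mul_pow, Real.sq_sqrt hB, ← Real.exp_nat_mul]
    congr 2
    push_cast
    ring
  rw [← h1] at h
  have h2 := abs_le_of_sq_le_sq h (by positivity)
  have := Real.exp_pos (-(κ / 2) * t)
  linarith [(le_abs_self a).trans h2]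

/-- Exponential decay of a target solution and its time derivatives, for one gain and one rate.
The constant is determined by the initial values. -/
theorem IsStabilizable.exists_gain_chain {A : ℝ → Y →L[ℝ] Y} {q : ℝ}
    (hS : S.IsStabilizable q A) : ∃ c > 0, ∃ rate > 0,
      (∀ (N : ℕ) (w w1 : ℕ → H) (p₀ : Hp) (y₀ : Y), ∃ Υ > 0,
        ∀ (W W1 : ℕ → ℝ → H) (g : ℕ → ℝ → ℝ) (p : ℝ → Hp) (y : ℝ → Y),
          S.IsChain (A c) N W W1 g p y → (∀ j, W j 0 = w j) → (∀ j, W1 j 0 = w1 j) →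
          p 0 = p₀ → y 0 = y₀ → ∀ t, 0 ≤ t → ‖p t‖ ≤ Υ * Real.exp (-rate * t) ∧
            ∀ j ≤ N, ‖W j t‖ ≤ Υ * Real.exp (-rate * t) ∧ ‖W1 j t‖ ≤ Υ * Real.exp (-rate * t) ∧
              ‖W (j + 1) t‖ ≤ Υ * Real.exp (-rate * t)) ∧
      (∀ (w w' d : H) (p₀ : Hp) (y₀ : Y), ∃ Υ > 0,
        ∀ (W W1 W' W1' : ℝ → H) (p : ℝ → Hp) (y : ℝ → Y), S.IsSolution (A c) W W1 W' p y →
          (∀ t, 0 ≤ t → HasDerivWithinAt W1 (W1' t) (Set.Ici 0) t) →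
          W 0 = w → W' 0 = w' → W1' 0 = d → p 0 = p₀ → y 0 = y₀ → ∀ t, 0 ≤ t →
            ‖W1' t‖ ≤ Υ * Real.exp (-rate * t)) := by
  obtain ⟨c, hc, κ, hκ, C, hC, hmain⟩ := hS.exists_gain_deriv
  refine ⟨c, hc, κ / 2, by positivity, fun N => ?_, fun w w' d p₀ y₀ => ?_⟩
  · have hlevel : ∀ (w w1 : ℕ → H) (p₀ : Hp) (y₀ : Y), ∃ Υ > 0, ∀ (N : ℕ)
        (W W1 : ℕ → ℝ → H) (g : ℕ → ℝ → ℝ) (p : ℝ → Hp) (y : ℝ → Y),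
          S.IsChain (A c) N W W1 g p y → (∀ j, W j 0 = w j) → (∀ j, W1 j 0 = w1 j) →
          p 0 = p₀ → y 0 = y₀ → ∀ t, 0 ≤ t → ‖p t‖ ≤ Υ * Real.exp (-(κ / 2) * t) ∧
            ‖W 0 t‖ ≤ Υ * Real.exp (-(κ / 2) * t) ∧ ‖W1 0 t‖ ≤ Υ * Real.exp (-(κ / 2) * t) ∧
              ‖W 1 t‖ ≤ Υ * Real.exp (-(κ / 2) * t) := by
      intro w w1 p₀ y₀
      obtain ⟨B, hB⟩ : ∃ B, B = C * (‖w 0‖ ^ 2 + ‖w1 0‖ ^ 2 + ‖p₀‖ ^ 2 + ‖y₀‖ ^ 2) := ⟨_, rfl⟩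
      obtain ⟨B', hB'⟩ : ∃ B', B' = C * (‖w 1‖ ^ 2 + ‖S.M p₀ + S.Bp (w 0)‖ ^ 2 +
        ‖A c y₀ + S.N (w 0, p₀) • S.e‖ ^ 2) := ⟨_, rfl⟩
      have hB0 : 0 ≤ B := by rw [hB]; positivity
      have hB0' : 0 ≤ B' := by rw [hB']; positivity
      refine ⟨(Real.sqrt B + 1) + (Real.sqrt B' + 1), by positivity,
        fun N W W1 g p y h hw hw1 hp hy t ht => ?_⟩
      obtain ⟨h1, h2, -⟩ := hmain _ _ _ _ _ h.isSolution t ht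
      rw [hw, hw1, hp, hy, ← hB] at h1
      rw [hw, hw, hp, hy, ← hB'] at h2
      have hE := Real.exp_pos (-(κ / 2) * t)
      have e1 : ∀ {a : ℝ}, a ≤ (Real.sqrt B + 1) * Real.exp (-(κ / 2) * t) →
          a ≤ ((Real.sqrt B + 1) + (Real.sqrt B' + 1)) * Real.exp (-(κ / 2) * t) := fun h => by
        have : 0 ≤ (Real.sqrt B' + 1) * Real.exp (-(κ / 2) * t) := by positivity
        linarith
      have n1 := sq_nonneg ‖W 0 t‖
      have n2 := sq_nonneg ‖W1 0 t‖
      have n3 := sq_nonneg ‖p t‖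
      have n4 := sq_nonneg ‖y t‖
      refine ⟨e1 (le_sqrt_mul_exp hB0 (by linarith)), e1 (le_sqrt_mul_exp hB0 (by linarith)),
        e1 (le_sqrt_mul_exp hB0 (by linarith)), ?_⟩
      have := le_sqrt_mul_exp hB0' h2
      have : 0 ≤ (Real.sqrt B + 1) * Real.exp (-(κ / 2) * t) := by positivity
      linarith
    induction N with
    | zero =>
      intro w w1 p₀ y₀
      obtain ⟨Υ, hΥ, h⟩ := hlevel w w1 p₀ y₀
      refine ⟨Υ, hΥ, fun W W1 g p y hch hw hw1 hp hy t ht => ?_⟩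
      obtain ⟨h1, h2⟩ := h 0 W W1 g p y hch hw hw1 hp hy t ht
      refine ⟨h1, fun j hj => ?_⟩
      obtain rfl : j = 0 := by omega
      exact h2
    | succ N ih =>
      intro w w1 p₀ y₀
      obtain ⟨Υ, hΥ, h⟩ := hlevel w w1 p₀ y₀
      obtain ⟨Υ', hΥ', h'⟩ := ih (fun j => w (j + 1)) (fun j => w1 (j + 1)) (S.M p₀ + S.Bp (w 0))
        (A c y₀ + S.N (w 0, p₀) • S.e)
      refine ⟨Υ + Υ', by positivity, fun W W1 g p y hch hw hw1 hp hy t ht => ?_⟩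
      obtain ⟨h1, h2⟩ := h (N + 1) W W1 g p y hch hw hw1 hp hy t ht
      obtain ⟨-, h3⟩ := h' _ _ _ _ _ hch.tail (fun j => hw (j + 1)) (fun j => hw1 (j + 1))
        (by rw [hp, hw]) (by rw [hy, hw, hp]) t ht
      have hE := Real.exp_pos (-(κ / 2) * t)
      have e1 : ∀ {a : ℝ}, a ≤ Υ * Real.exp (-(κ / 2) * t) →
          a ≤ (Υ + Υ') * Real.exp (-(κ / 2) * t) := fun h => by
        have : 0 ≤ Υ' * Real.exp (-(κ / 2) * t) := by positivity
        linarith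
      have e2 : ∀ {a : ℝ}, a ≤ Υ' * Real.exp (-(κ / 2) * t) →
          a ≤ (Υ + Υ') * Real.exp (-(κ / 2) * t) := fun h => by
        have : 0 ≤ Υ * Real.exp (-(κ / 2) * t) := by positivity
        linarith
      refine ⟨e1 h1, fun j hj => ?_⟩
      cases j with
      | zero => exact ⟨e1 h2.1, e1 h2.2.1, e1 h2.2.2⟩
      | succ j =>
        obtain ⟨h4, h5, h6⟩ := h3 j (by omega)
        exact ⟨e2 h4, e2 h5, e2 h6⟩
  · obtain ⟨B, hB⟩ : ∃ B, B = C * (‖w'‖ ^ 2 + ‖d‖ ^ 2 + ‖S.M p₀ + S.Bp w‖ ^ 2 +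
      ‖A c y₀ + S.N (w, p₀) • S.e‖ ^ 2) := ⟨_, rfl⟩
    have hB0 : 0 ≤ B := by rw [hB]; positivity
    refine ⟨Real.sqrt B + 1, by positivity,
      fun W W1 W' W1' p y h hd hw hw' hd0 hp hy t ht => ?_⟩
    have h1 := (hmain _ _ _ _ _ h t ht).2.2 W1' hd
    rw [hw, hw', hd0, hp, hy, ← hB] at h1
    exact le_sqrt_mul_exp hB0 h1

end TargetSystem

end Chain

end SandwichedHeat

namespace SandwichedHeat

open MeasureTheory
open scoped RealInnerProductSpace

/-! ### The target system of the closed loop -/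

variable {n m : ℕ}

/-- The operator `y ↦ -c y + J y` with the skew-symmetric matrix `J = skewMat m`. -/
def boundaryOp (m : ℕ) (c : ℝ) : EuclideanSpace ℝ (Fin m) →L[ℝ] EuclideanSpace ℝ (Fin m) :=
  -c • ContinuousLinearMap.id ℝ _ + Matrix.toEuclideanCLM (𝕜 := ℝ) (skewMat m)

lemma boundaryOp_apply (c : ℝ) (y : EuclideanSpace ℝ (Fin m)) (i : Fin m) :
    boundaryOp m c y i = -c * y i + ∑ j, skewMat m i j * y j := by
  simp [boundaryOp, Matrix.mulVec, dotProduct]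

lemma inner_boundaryOp (c : ℝ) (y : EuclideanSpace ℝ (Fin m)) :
    ⟪y, boundaryOp m c y⟫ = -c * ‖y‖ ^ 2 := by
  have hskew : ∑ i, ∑ j, y i * (skewMat m i j * y j) = 0 := by
    have h1 : ∑ i, ∑ j, y i * (skewMat m i j * y j) = -∑ i, ∑ j, y i * (skewMat m i j * y j) := by
      conv_lhs => rw [Finset.sum_comm]
      rw [← Finset.sum_neg_distrib]
      refine Finset.sum_congr rfl fun i _ => ?_
      rw [← Finset.sum_neg_distrib]
      refine Finset.sum_congr rfl fun j _ => ?_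
      simp only [skewMat, Matrix.of_apply]
      ring
    linarith
  rw [PiLp.inner_apply, EuclideanSpace.norm_sq_eq]
  simp only [boundaryOp_apply, RCLike.inner_apply, conj_trivial, Real.norm_eq_abs, sq_abs]
  have h2 : ∀ i, (-c * y i + ∑ j, skewMat m i j * y j) * y i =
      -c * y i ^ 2 + ∑ j, y i * (skewMat m i j * y j) := fun i => by
    rw [← Finset.mul_sum]; ring
  simp only [h2, Finset.sum_add_distrib, hskew, Finset.mul_sum, add_zero]

lemma abs_boundaryOp_zero_add_le (hm : 0 < m) (c : ℝ) (y : EuclideanSpace ℝ (Fin m)) :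
    |boundaryOp m c y ⟨0, hm⟩ + c * y ⟨0, hm⟩| ≤ ‖y‖ := by
  rw [boundaryOp_apply, neg_mul, neg_add_cancel_comm]
  by_cases h : 1 < m
  · rw [Finset.sum_eq_single ⟨1, h⟩ (fun b _ hb => ?_) (by simp)]
    · simpa [skewMat] using PiLp.norm_apply_le y ⟨1, h⟩
    · have : (b : ℕ) ≠ 1 := fun hb' => hb (Fin.ext hb')
      simp [skewMat, this]
  · have : ∀ j : Fin m, skewMat m ⟨0, hm⟩ j = 0 := fun j => by
      have : (j : ℕ) ≠ 1 := by omega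
      simp [skewMat, this]
    simp [this]

namespace Plant

variable (P : Plant n m) (K : Fin n → ℝ)

/-- The target system of the closed loop: the heat equation for `w`, the equation for the second
component `p` of the system in `x`, and the boundary states `y`. -/
def targetSystem (hm : 0 < m) (N : L2 × PiLp 2 (fun _ : Fin n => L2) →L[ℝ] ℝ) :
    TargetSystem L2 (PiLp 2 (fun _ : Fin n => L2)) (EuclideanSpace ℝ (Fin m)) where
  graph := heatGraph P.q
  M := matAct (P.AK K)
  Bp := P.mulB
  N := N
  e := EuclideanSpace.single ⟨m - 1, by omega⟩ 1
  first := EuclideanSpace.proj ⟨0, hm⟩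

lemma targetSystem_isStabilizable (hn : 0 < n) (hm : 0 < m) (hq : 0 < P.q)
    (hK : Hurwitz (P.AK K)) (N : L2 × PiLp 2 (fun _ : Fin n => L2) →L[ℝ] ℝ) :
    (P.targetSystem K hm N).IsStabilizable P.q (boundaryOp m) where
  q_pos := hq
  green _ _ _ _ _ _ hh hk := heatGraph_green hh hk
  poincare _ _ _ hh := heatGraph_poincare hh
  lift _ hε := heatGraph_lift P.q hε
  euler := hK.exists_euler_matAct hn
  damping := inner_boundaryOp
  damping_first := abs_boundaryOp_zero_add_le hm
  first_le y := PiLp.norm_apply_le y ⟨0, hm⟩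
  norm_e_le := by simp [targetSystem]

/-- The boundary states `y_1, …, y_m`. -/
def bdryState (c : ℕ → ℝ) (v : ℝ → ℝ) (ξ : Fin n → ℝ) : EuclideanSpace ℝ (Fin m) :=
  WithLp.toLp 2 fun i => evalSeq m (yPoly c (i + 1)) (P.bdryVal K v ξ)

lemma hasDerivWithinAt_toLp {ι E : Type*} [Fintype ι] [NormedAddCommGroup E] [NormedSpace ℝ E]
    {f : ℝ → ι → E} {f' : PiLp 2 (fun _ : ι => E)} {s : Set ℝ} {t : ℝ}
    (h : ∀ i, HasDerivWithinAt (fun t => f t i) (f' i) s t) :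
    HasDerivWithinAt (fun t => WithLp.toLp 2 (f t)) f' s t := by
  let L : (ι → E) →L[ℝ] PiLp 2 (fun _ : ι => E) :=
    ((PiLp.continuousLinearEquiv 2 ℝ (fun _ : ι => E)).symm : _ →L[ℝ] _)
  exact L.hasFDerivAt.comp_hasDerivWithinAt t (hasDerivWithinAt_pi.2 h)

variable {P K} {k : ℕ} {c : ℕ → ℝ} {u : ℝ → ℝ → ℝ} {X : ℝ → Fin n → ℝ} {Z : ℝ → Fin m → ℝ}

lemma IsClosedLoopSolution.hasDerivWithinAt_auxL2 (h : P.IsClosedLoopSolution K c k u X Z)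
    (hq : P.q ≠ 0) (hk : 2 ≤ k) {t : ℝ} (ht : 0 ≤ t) :
    HasDerivWithinAt (fun t => P.auxL2 (fun x => u x t) (X t))
      (matAct (P.AK K) (P.auxL2 (fun x => u x t) (X t)) +
        P.mulB (toL2 (P.targetSeq K (fun x => u x t) (X t) 0))) (Set.Ici 0) t := by
  refine hasDerivWithinAt_toLp fun i => ?_
  rw [← auxRhs_apply, auxRhs_eq K hq (h.memH ht) (by omega)]
  have h1 := h.hasDerivWithinAt_toL2_dotProduct hq (i := 0) hk ht (P.matT (Sum.inr i))
  refine h1.congr_deriv ?_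
  congr 1
  exact toL2_congr fun x _ => auxSeq_two_inr i x

/-- There is a choice of the coupling functional for which every solution of the closed loop is a
chain of time derivatives of a solution of the target system. -/
theorem exists_isChain (hm : 0 < m) (hq : P.q ≠ 0) :
    ∃ N : L2 × PiLp 2 (fun _ : Fin n => L2) →L[ℝ] ℝ,
      ∀ (c : ℝ) (k : ℕ) (u : ℝ → ℝ → ℝ) (X : ℝ → Fin n → ℝ) (Z : ℝ → Fin m → ℝ),
        P.IsClosedLoopSolution K (fun _ => c) k u X Z → 2 * m ≤ k →
        (P.targetSystem K hm N).IsChain (boundaryOp m c) (m - 1)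
          (fun j t => P.q ^ j • toL2 (P.targetSeq K (fun x => u x t) (X t) (2 * j)))
          (fun j t => P.q ^ j • toL2 (P.targetSeq K (fun x => u x t) (X t) (2 * j + 1)))
          (fun j t => P.bdryVal K (fun x => u x t) (X t) j)
          (fun t => P.auxL2 (fun x => u x t) (X t))
          (fun t => P.bdryState K (fun _ => c) (fun x => u x t) (X t)) := by
  obtain ⟨L, L₀, hode⟩ := P.exists_boundary_ode K hq hm
  obtain ⟨G, hG⟩ := exists_trace (P := P) K hq
  refine ⟨(LinearMap.toContinuousLinearMap L ∘L ContinuousLinearMap.fst ℝ _ _ -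
    LinearMap.toContinuousLinearMap L₀ ∘L ContinuousLinearMap.snd ℝ _ _) ∘L G,
    fun c k u X Z h hk => ?_⟩
  have hpow : ∀ j, P.q ^ (j + 1) = P.q ^ j * P.q := fun j => pow_succ _ _
  have htwo : ∀ j, 2 * (j + 1) = 2 * j + 2 := fun j => by ring
  refine ⟨fun j hj t ht => ?_, fun j hj => ?_, fun j hj t ht => ?_, fun j hj t ht => ?_,
    fun t ht => ?_, fun t ht => ?_, fun t ht => ?_⟩
  · have hp1 := (isPrim_targetSeq (P := P) (K := K) (ξ := X t) (h.memH ht)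
      (i := 2 * j) (by omega)).const_mul (P.q ^ j)
    have hp2 := (isPrim_targetSeq (P := P) (K := K) (ξ := X t) (h.memH ht)
      (i := 2 * j + 1) (by omega)).const_mul (P.q ^ j)
    refine ⟨_, _, _, hp1, hp2, ?_, ?_⟩
    · rw [h.targetSeq_two_mul_zero hq (by omega) ht, mul_zero]
    · have hv := h.memH ht
      rw [toL2_const_mul _ (isPrim_targetSeq hv (by omega)).sqInt_self,
        toL2_const_mul _ (isPrim_targetSeq hv (by omega)).sqInt_self,
        toL2_const_mul _ (isPrim_targetSeq hv (by omega)).sqInt, smul_smul, mul_comm P.q, ← hpow]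
      rfl
  · exact (h.continuousOn_toL2_targetSeq hq (by omega) (i := 2 * (j + 1)) (by omega)).const_smul
      (P.q ^ (j + 1))
  · refine ((h.hasDerivWithinAt_toL2_targetSeq hq (i := 2 * j) (by omega) ht).const_smul
      (P.q ^ j)).congr_deriv ?_
    rw [smul_smul, ← hpow]
    rfl
  · exact h.hasDerivWithinAt_bdryVal hq hk (by omega) ht
  · change _ = evalSeq m (yPoly _ 1) _
    have : yPoly (fun _ => c) 1 = Polynomial.X ^ 0 := by simp [yPoly, tau]
    rw [this, evalSeq_X_pow hm]
  · have h1 := h.hasDerivWithinAt_auxL2 hq (by omega) ht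
    simpa [targetSystem] using h1
  · refine hasDerivWithinAt_toLp fun i => ?_
    refine (hasDerivWithinAt_evalSeq_yPoly (fun j hj => h.hasDerivWithinAt_bdryVal hq hk hj ht)
      (hode _ k u X Z h hk t ht) i).congr_deriv ?_
    have hz : (toL2 (P.targetSeq K (fun x => u x t) (X t) 0),
        P.auxL2 (fun x => u x t) (X t)) =
        (P.q ^ 0 • toL2 (P.targetSeq K (fun x => u x t) (X t) (2 * 0)),
          P.auxL2 (fun x => u x t) (X t)) := by rw [pow_zero, one_smul]
    rw [PiLp.add_apply, PiLp.smul_apply, boundaryOp_apply, targetSystem, ← hz,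
      ContinuousLinearMap.comp_apply, hG _ _ k (h.memH ht) (by omega)]
    have he : (EuclideanSpace.single (⟨m - 1, by omega⟩ : Fin m) (1 : ℝ)) i =
        if (i : ℕ) + 1 = m then 1 else 0 := by
      rw [PiLp.single_apply]
      congr 1
      rw [Fin.ext_iff, eq_iff_iff]
      simp only
      omega
    rw [he]
    congr 1
    split_ifs <;> simp

/-! ### The initial values -/

lemma stateSeq_congr {v v' : ℝ → ℝ} (hv : ∀ x ∈ Set.Icc (0 : ℝ) 1, v x = v' x) (ξ : Fin n → ℝ)
    (i : ℕ) {x : ℝ} (hx : x ∈ Set.Icc (0 : ℝ) 1) : P.stateSeq v ξ i x = P.stateSeq v' ξ i x := by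
  induction i with
  | zero =>
    exact ltiSol_congr_ae _ _ _ (ae_restrict_of_forall_mem measurableSet_Icc
      fun y hy => der_congr hv 0 hy) hx
  | succ i ih => rw [stateSeq_succ, stateSeq_succ, ih, der_congr hv i hx]

lemma targetSeq_congr {v v' : ℝ → ℝ} (hv : ∀ x ∈ Set.Icc (0 : ℝ) 1, v x = v' x) (ξ : Fin n → ℝ)
    (i : ℕ) {x : ℝ} (hx : x ∈ Set.Icc (0 : ℝ) 1) :
    P.targetSeq K v ξ i x = P.targetSeq K v' ξ i x := by
  rw [targetSeq, targetSeq, stateSeq_congr hv ξ i hx, der_congr hv i hx]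

lemma auxL2_congr {v v' : ℝ → ℝ} (hv : ∀ x ∈ Set.Icc (0 : ℝ) 1, v x = v' x) (ξ : Fin n → ℝ) :
    P.auxL2 v ξ = P.auxL2 v' ξ := by
  rw [auxL2, auxL2]
  congr 1
  funext i
  exact toL2_congr fun x hx => by rw [auxSeq, auxSeq, stateSeq_congr hv ξ 0 hx]

lemma bdryState_congr {v v' : ℝ → ℝ} (hv : ∀ x ∈ Set.Icc (0 : ℝ) 1, v x = v' x) (ξ : Fin n → ℝ)
    (c : ℕ → ℝ) : P.bdryState K c v ξ = P.bdryState K c v' ξ := by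
  have : P.bdryVal K v ξ = P.bdryVal K v' ξ := by
    funext j
    rw [bdryVal, bdryVal, targetSeq_congr hv ξ (2 * j) (by simp)]
  rw [bdryState, bdryState, this]

/-! ### Return to the original variables -/

lemma exists_norm_auxSeq_le (K : Fin n → ℝ) (hq : P.q ≠ 0) (i : ℕ) : ∃ C, 0 ≤ C ∧
    ∀ (v : ℝ → ℝ) (ξ : Fin n → ℝ) (k : ℕ) (b : ℝ), MemH k v → 0 < k → i ≤ k →
      (∀ j ≤ i, ‖toL2 (P.targetSeq K v ξ j)‖ ≤ b) → ‖P.auxL2 v ξ‖ ≤ b →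
      ∀ a, ‖toL2 (fun x => P.auxSeq v ξ i x a)‖ ≤ C * b := by
  induction i with
  | zero =>
    obtain ⟨C, hC, h⟩ := exists_norm_aux_inl_le (P := P) K hq
    refine ⟨C * 2, by positivity, fun v ξ k b hv hk _ hb hp a => (h v ξ k hv hk a).trans ?_⟩
    rw [mul_assoc]
    have := hb 0 le_rfl
    gcongr
    linarith
  | succ i ih =>
    obtain ⟨C, hC, h⟩ := ih
    obtain ⟨R, hR⟩ : ∃ R, R = ∑ a, (∑ l, |P.matE K a l| * C + |P.inputVec a|) := ⟨_, rfl⟩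
    have hterm : ∀ a, 0 ≤ ∑ l, |P.matE K a l| * C + |P.inputVec a| := fun a =>
      add_nonneg (Finset.sum_nonneg fun l _ => mul_nonneg (abs_nonneg _) hC) (abs_nonneg _)
    refine ⟨R, by rw [hR]; exact Finset.sum_nonneg fun a _ => hterm a,
      fun v ξ k b hv hk hi hb hp a => ?_⟩
    have hb0 : 0 ≤ b := (norm_nonneg _).trans hp
    have hs : ∀ l, SqInt (fun x => P.auxSeq v ξ i x l) := fun l =>
      (isPrim_auxSeq hv (by omega) l).sqInt_self
    have hw : SqInt (P.targetSeq K v ξ i) := (isPrim_targetSeq hv (by omega)).sqInt_self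
    have h1 : toL2 (fun x => P.auxSeq v ξ (i + 1) x a) =
        (∑ l, P.matE K a l • toL2 (fun x => P.auxSeq v ξ i x l)) +
          P.inputVec a • toL2 (P.targetSeq K v ξ i) := by
      simp only [← fun l => toL2_const_mul (P.matE K a l) (hs l)]
      rw [← toL2_sum _ fun l _ => (hs l).const_mul' _, ← toL2_const_mul _ hw,
        ← toL2_add (sqInt_sum _ fun l _ => (hs l).const_mul' _) (hw.const_mul' _)]
      refine toL2_congr fun x _ => ?_
      rw [auxSeq_succ K]
      simp [Matrix.mulVec, dotProduct, mul_comm]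
    have h2 : ‖toL2 (fun x => P.auxSeq v ξ (i + 1) x a)‖ ≤
        (∑ l, |P.matE K a l| * C + |P.inputVec a|) * b := by
      rw [h1, add_mul, Finset.sum_mul]
      refine (norm_add_le _ _).trans (add_le_add ((norm_sum_le _ _).trans
        (Finset.sum_le_sum fun l _ => ?_)) ?_)
      · rw [norm_smul, Real.norm_eq_abs, mul_assoc]
        exact mul_le_mul_of_nonneg_left
          (h v ξ k b hv hk (by omega) (fun j hj => hb j (by omega)) hp l) (abs_nonneg _)
      · rw [norm_smul, Real.norm_eq_abs]
        exact mul_le_mul_of_nonneg_left (hb i (by omega)) (abs_nonneg _)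
    refine h2.trans (mul_le_mul_of_nonneg_right ?_ hb0)
    rw [hR]
    exact Finset.single_le_sum (f := fun a => ∑ l, |P.matE K a l| * C + |P.inputVec a|)
      (fun a _ => hterm a) (Finset.mem_univ a)

/-- The inverse transformation is bounded: the spatial derivatives of `u` are controlled by those
of the target variable and by the second component of the system in `x`. -/
lemma exists_l2norm_der_le (K : Fin n → ℝ) (hq : P.q ≠ 0) (i : ℕ) : ∃ C, 0 ≤ C ∧
    ∀ (v : ℝ → ℝ) (ξ : Fin n → ℝ) (k : ℕ) (b : ℝ), MemH k v → 0 < k → i ≤ k →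
      (∀ j ≤ i, ‖toL2 (P.targetSeq K v ξ j)‖ ≤ b) → ‖P.auxL2 v ξ‖ ≤ b →
      l2norm (der i v) ≤ C * b := by
  obtain ⟨C, hC, h⟩ := exists_norm_auxSeq_le (P := P) K hq i
  refine ⟨1 + ∑ a, |P.rowE K a| * C, add_nonneg zero_le_one (Finset.sum_nonneg fun a _ =>
    mul_nonneg (abs_nonneg _) hC), fun v ξ k b hv hk hi hb hp => ?_⟩
  have hs : ∀ a, SqInt (fun x => P.auxSeq v ξ i x a) := fun a =>
    (isPrim_auxSeq hv hi a).sqInt_self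
  have hU : SqInt (der i v) := hv.2 i hi
  have hsum : SqInt (fun x => ∑ a, P.rowE K a * P.auxSeq v ξ i x a) :=
    sqInt_sum _ fun a _ => (hs a).const_mul' _
  have hw : SqInt (P.targetSeq K v ξ i) := (hU.sub' hsum).congr fun x _ => by
    rw [der_eq_targetSeq_add (P := P) (K := K) (ξ := ξ) i x, dotProduct]
    ring
  rw [l2norm_eq_norm hU]
  have h1 : toL2 (der i v) = toL2 (P.targetSeq K v ξ i) +
      ∑ a, P.rowE K a • toL2 (fun x => P.auxSeq v ξ i x a) := by
    simp only [← fun a => toL2_const_mul (P.rowE K a) (hs a)]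
    rw [← toL2_sum _ fun a _ => (hs a).const_mul' _, ← toL2_add hw hsum]
    exact toL2_congr fun x _ => der_eq_targetSeq_add i x
  rw [h1, add_mul, one_mul, Finset.sum_mul]
  refine (norm_add_le _ _).trans (add_le_add (hb i le_rfl) ((norm_sum_le _ _).trans
    (Finset.sum_le_sum fun a _ => ?_)))
  rw [norm_smul, Real.norm_eq_abs, mul_assoc]
  exact mul_le_mul_of_nonneg_left (h v ξ k b hv hk hi hb hp a) (abs_nonneg _)

end Plant

end SandwichedHeat

namespace SandwichedHeat

open MeasureTheory
open scoped RealInnerProductSpace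

/-! ### Decay of the closed loop -/

variable {n m : ℕ}

namespace Plant

/-- Exponential decay of the target variable and its spatial derivatives. The constant depends on
the initial values of `u` and `X` only; those of `Z` are boundary values of `u`. -/
theorem exists_decay (P : Plant n m) (K : Fin n → ℝ) (hn : 0 < n) (hm : 0 < m) (hq : 0 < P.q)
    (hK : Hurwitz (P.AK K)) : ∃ c > 0, ∃ rate > 0, ∀ (u₀ : ℝ → ℝ) (X₀ : Fin n → ℝ), ∃ Υ > 0,
      ∀ (k : ℕ) (u : ℝ → ℝ → ℝ) (X : ℝ → Fin n → ℝ) (Z : ℝ → Fin m → ℝ),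
        P.IsClosedLoopSolution K (fun _ => c) k u X Z → 2 * m ≤ k →
        (∀ x ∈ Set.Icc (0 : ℝ) 1, u x 0 = u₀ x) → X 0 = X₀ → ∀ t, 0 ≤ t →
          ‖P.auxL2 (fun x => u x t) (X t)‖ ≤ Υ * Real.exp (-rate * t) ∧
          (∀ i ≤ 2 * m, ‖toL2 (P.targetSeq K (fun x => u x t) (X t) i)‖ ≤
            Υ * Real.exp (-rate * t)) ∧
          (3 ≤ k → ‖toL2 (P.targetSeq K (fun x => u x t) (X t) 3)‖ ≤
            Υ * Real.exp (-rate * t)) := by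
  obtain ⟨N, hN⟩ := exists_isChain (P := P) (K := K) hm hq.ne'
  obtain ⟨c, hc, rate, hrate, hchain, hlast⟩ :=
    (P.targetSystem_isStabilizable K hn hm hq hK N).exists_gain_chain
  refine ⟨c, hc, rate, hrate, fun u₀ X₀ => ?_⟩
  obtain ⟨Υ, hΥ, hdecay⟩ := hchain (m - 1)
    (fun j => P.q ^ j • toL2 (P.targetSeq K u₀ X₀ (2 * j)))
    (fun j => P.q ^ j • toL2 (P.targetSeq K u₀ X₀ (2 * j + 1)))
    (P.auxL2 u₀ X₀) (P.bdryState K (fun _ => c) u₀ X₀)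
  obtain ⟨Υ', hΥ', hdecay'⟩ := hlast (P.q ^ 0 • toL2 (P.targetSeq K u₀ X₀ (2 * 0)))
    (P.q ^ (0 + 1) • toL2 (P.targetSeq K u₀ X₀ (2 * (0 + 1))))
    (P.q ^ 0 • P.q • toL2 (P.targetSeq K u₀ X₀ 3))
    (P.auxL2 u₀ X₀) (P.bdryState K (fun _ => c) u₀ X₀)
  obtain ⟨Q, hQ⟩ : ∃ Q, Q = ∑ j ∈ Finset.range (m + 1), (P.q ^ j)⁻¹ := ⟨_, rfl⟩
  have hQj : ∀ j ≤ m, (P.q ^ j)⁻¹ ≤ Q := fun j hj => by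
    rw [hQ]
    exact Finset.single_le_sum (f := fun j => (P.q ^ j)⁻¹) (fun _ _ => by positivity)
      (Finset.mem_range.2 (by omega))
  have hQ1 : 1 ≤ Q := by simpa using hQj 0 (Nat.zero_le _)
  refine ⟨Q * Υ + P.q⁻¹ * Υ', by positivity, fun k u X Z h hk hu0 hX0 t ht => ?_⟩
  have hch := hN c k u X Z h hk
  have hU0 : ∀ i, toL2 (P.targetSeq K (fun x => u x 0) (X 0) i) =
      toL2 (P.targetSeq K u₀ X₀ i) := fun i => by
    rw [hX0]; exact toL2_congr fun x hx => targetSeq_congr hu0 X₀ i hx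
  have hp0 : P.auxL2 (fun x => u x 0) (X 0) = P.auxL2 u₀ X₀ := by
    rw [hX0]; exact auxL2_congr hu0 X₀
  have hy0 : P.bdryState K (fun _ => c) (fun x => u x 0) (X 0) =
      P.bdryState K (fun _ => c) u₀ X₀ := by
    rw [hX0]; exact bdryState_congr hu0 X₀ _
  obtain ⟨h1, h2⟩ := hdecay _ _ _ _ _ hch (fun j => by simp only [hU0])
    (fun j => by simp only [hU0]) hp0 hy0 t ht
  have hE := Real.exp_pos (-rate * t)
  have hnonneg : 0 ≤ P.q⁻¹ * Υ' * Real.exp (-rate * t) := by positivity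
  have hscale : ∀ j ≤ m, ∀ w : L2, ‖P.q ^ j • w‖ ≤ Υ * Real.exp (-rate * t) →
      ‖w‖ ≤ (Q * Υ + P.q⁻¹ * Υ') * Real.exp (-rate * t) := fun j hj w hw => by
    have e1 : ‖w‖ = (P.q ^ j)⁻¹ * ‖P.q ^ j • w‖ := by
      rw [norm_smul, Real.norm_eq_abs, abs_of_pos (by positivity), inv_mul_cancel_left₀]
      positivity
    have e2 : (P.q ^ j)⁻¹ * ‖P.q ^ j • w‖ ≤ Q * (Υ * Real.exp (-rate * t)) :=
      mul_le_mul (hQj j hj) hw (norm_nonneg _) (by linarith)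
    rw [e1]
    linarith
  refine ⟨?_, fun i hi => ?_, fun hk3 => ?_⟩
  · have : Υ * Real.exp (-rate * t) ≤ Q * (Υ * Real.exp (-rate * t)) :=
      le_mul_of_one_le_left (by positivity) hQ1
    linarith
  · obtain ⟨j, rfl | rfl⟩ := Nat.even_or_odd' i
    · rcases Nat.lt_or_ge j m with hj | hj
      · exact hscale j hj.le _ (h2 j (by omega)).1
      · obtain rfl : j = m := by omega
        have h3 := (h2 (j - 1) le_rfl).2.2
        rw [show j - 1 + 1 = j by omega] at h3
        exact hscale j le_rfl _ h3
    · exact hscale j (by omega) _ (h2 j (by omega)).2.1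
  · have h3 := hdecay' _ _ _ (fun t => P.q ^ 0 • P.q •
      toL2 (P.targetSeq K (fun x => u x t) (X t) 3)) _ _ hch.isSolution (fun s hs =>
        (h.hasDerivWithinAt_toL2_targetSeq hq.ne' (i := 2 * 0 + 1) hk3 hs).const_smul (P.q ^ 0))
      (by simp only [hU0]) (by simp only [hU0]) (by simp only [hU0]) hp0 hy0 t ht
    have e1 : ‖toL2 (P.targetSeq K (fun x => u x t) (X t) 3)‖ = P.q⁻¹ *
        ‖P.q ^ 0 • P.q • toL2 (P.targetSeq K (fun x => u x t) (X t) 3)‖ := by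
      rw [pow_zero, one_smul, norm_smul, Real.norm_eq_abs, abs_of_pos hq,
        inv_mul_cancel_left₀ hq.ne']
    have e2 := mul_le_mul_of_nonneg_left h3 (inv_nonneg.2 hq.le)
    have : 0 ≤ Q * Υ * Real.exp (-rate * t) := by positivity
    rw [e1]
    linarith

end Plant

end SandwichedHeat

end

theorem mainTheorem3 {n m : ℕ} (hn : 0 < n) (hm : 0 < m)
    (P : SandwichedHeat.Plant n m) (hq : 0 < P.q)
    (hctrl : SandwichedHeat.Controllable P.A P.B)
    (K : Fin n → ℝ) (hK : SandwichedHeat.Hurwitz (P.AK K)) :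
    ∃ c : ℕ → ℝ, (∀ i ∈ Finset.Icc 1 m, 0 < c i) ∧
      (∃ rate : ℝ, 0 < rate ∧
        ∀ (u₀ : ℝ → ℝ) (X₀ : Fin n → ℝ) (Z₀ : Fin m → ℝ), ∃ Υ : ℝ, 0 < Υ ∧
          ∀ (u : ℝ → ℝ → ℝ) (X : ℝ → Fin n → ℝ) (Z : ℝ → Fin m → ℝ),
            P.IsClosedLoopSolution K c (max (2 * m) 3) u X Z →
            SandwichedHeat.Plant.HasInitialValues u X Z u₀ X₀ Z₀ →
            ∀ t : ℝ, 0 ≤ t →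
              Real.sqrt (SandwichedHeat.l2norm (SandwichedHeat.der 2 (fun x => u x t)) ^ 2 +
                  SandwichedHeat.l2norm (SandwichedHeat.der 3 (fun x => u x t)) ^ 2) ≤
                Υ * Real.exp (-rate * t)) ∧
      (∃ rate : ℝ, 0 < rate ∧
        ∀ (u₀ : ℝ → ℝ) (X₀ : Fin n → ℝ) (Z₀ : Fin m → ℝ), ∃ Υ : ℝ, 0 < Υ ∧
          ∀ (u : ℝ → ℝ → ℝ) (X : ℝ → Fin n → ℝ) (Z : ℝ → Fin m → ℝ),
            P.IsClosedLoopSolution K c (2 * m) u X Z →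
            SandwichedHeat.Plant.HasInitialValues u X Z u₀ X₀ Z₀ →
            ∀ t : ℝ, 0 ≤ t →
              ∑ i ∈ Finset.Icc 2 (2 * m),
                  SandwichedHeat.l2norm (SandwichedHeat.der i (fun x => u x t)) ≤
                Υ * Real.exp (-rate * t)) := by
  obtain ⟨c, hc, rate, hrate, h⟩ := P.exists_decay K hn hm hq hK
  choose C hC0 hC using fun i => SandwichedHeat.Plant.exists_l2norm_der_le (P := P) K hq.ne' i
  refine ⟨fun _ => c, fun _ _ => hc, ⟨rate, hrate, fun u₀ X₀ Z₀ => ?_⟩,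
    ⟨rate, hrate, fun u₀ X₀ Z₀ => ?_⟩⟩ <;> obtain ⟨Υ, hΥ, hdecay⟩ := h u₀ X₀
  · have h2 := hC0 2
    have h3 := hC0 3
    refine ⟨(C 2 + C 3 + 1) * Υ, by positivity, fun u X Z hsol hinit t ht => ?_⟩
    have hb := hdecay _ u X Z hsol (le_max_left _ _) hinit.1 hinit.2.1 t ht
    obtain ⟨hp, hw, hw3⟩ := hb
    have hk3 : 3 ≤ max (2 * m) 3 := le_max_right _ _
    have hw' : ∀ j ≤ 3, ‖SandwichedHeat.toL2 (P.targetSeq K (fun x => u x t) (X t) j)‖ ≤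
        Υ * Real.exp (-rate * t) := fun j hj => by
      rcases Nat.lt_or_ge j 3 with hj3 | hj3
      · exact hw j (by omega)
      · obtain rfl : j = 3 := by omega
        exact hw3 hk3
    have b2 := hC 2 _ (X t) _ _ (hsol.memH ht) (by omega) (by omega)
      (fun j hj => hw' j (by omega)) hp
    have b3 := hC 3 _ (X t) _ _ (hsol.memH ht) (by omega) hk3 hw' hp
    have n2 : 0 ≤ SandwichedHeat.l2norm (SandwichedHeat.der 2 fun x => u x t) := Real.sqrt_nonneg _
    have n3 : 0 ≤ SandwichedHeat.l2norm (SandwichedHeat.der 3 fun x => u x t) := Real.sqrt_nonneg _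
    have hpos : 0 ≤ Υ * Real.exp (-rate * t) := by positivity
    refine (Real.sqrt_le_sqrt (y := (SandwichedHeat.l2norm (SandwichedHeat.der 2 fun x => u x t) +
      SandwichedHeat.l2norm (SandwichedHeat.der 3 fun x => u x t)) ^ 2) ?_).trans ?_
    · have := mul_nonneg n2 n3
      linarith
    · rw [Real.sqrt_sq (add_nonneg n2 n3)]
      linarith
  · have hsum : 0 ≤ ∑ i ∈ Finset.Icc 2 (2 * m), C i := Finset.sum_nonneg fun i _ => hC0 i
    refine ⟨(∑ i ∈ Finset.Icc 2 (2 * m), C i + 1) * Υ, by positivity,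
      fun u X Z hsol hinit t ht => ?_⟩
    obtain ⟨hp, hw, -⟩ := hdecay _ u X Z hsol le_rfl hinit.1 hinit.2.1 t ht
    have hpos : 0 ≤ Υ * Real.exp (-rate * t) := by positivity
    have hle : ∑ i ∈ Finset.Icc 2 (2 * m),
        SandwichedHeat.l2norm (SandwichedHeat.der i fun x => u x t) ≤
        ∑ i ∈ Finset.Icc 2 (2 * m), C i * (Υ * Real.exp (-rate * t)) :=
      Finset.sum_le_sum fun i hi => by
        have := Finset.mem_Icc.1 hi
        exact hC i _ (X t) _ _ (hsol.memH ht) (by omega) this.2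
          (fun j hj => hw j (by omega)) hp
    rw [← Finset.sum_mul] at hle
    linarith
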